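/- **Setting.** For $z\in\mathbb R$ let $T_zw=w(\cdot+z)$. For a locally integrable $w$ on $\mathbb R$ let $\|w\|_{BS}=\sup_t\int_t^{t+1}|w|\,dx$, and let $BS$ be the space of those $w$ with $\|w\|_{BS}<\infty$. A function $w\in BS$ is *Stepanov almost periodic* if every sequence of shifts of $w$ has a subsequence that converges in $BS$. For a Carathéodory function $g(x,u)$ put $\|g\|_R=\big\|\sup_{|u|\le R}|g(\cdot,u)|\big\|_{BS}$; $g$ is *strictly Stepanov almost periodic* in $x$ if $\|g\|_R<\infty$ for all $R>0$ and every sequence $z_k$ has a subsequence along which $g(\cdot+z_k,\cdot)$ converges, in $\|\cdot\|_R$ for every $R>0$, to a Carathéodory function with finite seminorms $\|\cdot\|_R$. Let $\chi\in\{1,-1\}$, let $V$ be a real function on $\mathbb R$ and $L=-\frac{d^2}{dx^2}+V$ the self-adjoint operator in $L^2(\mathbb R)$ defined through its quadratic form, and write $(Lu,v)=\int_{\mathbb R}(u'v'+Vuv)\,dx$ for $u,v\in H^1(\mathbb R)$. Let $f=f(x,u)$ and $F(x,u)=\int_0^uf(x,s)\,ds$. Assume: * (i) $V$ is Stepanov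 almost periodic and $0\notin\sigma(L)$; if $\chi=-1$, then also $\sigma(L)\cap(-\infty,0)\ne\emptyset$. * (ii) For a.e. $x$, $f(x,\cdot)$ is $C^1$; $F$, $f$ and $f_u$ are strictly Stepanov almost periodic in $x$; for each $u\ne0$ there is $\delta>0$ with $F(x,u)\ge\delta$ for a.e. $x$. * (iii) $f(x,0)=f_u(x,0)=0$ for a.e. $x$, and for every $R>0$ there is $\mu(R)>0$ such that for a.e. $x$, $|f_u(x,u)-f_u(x,v)|\le\mu(R)|u-v|$ whenever $|u|,|v|\le R$. * (iv) There is $\theta\in(0,1)$ such that for a.e. $x$, $0<f(x,u)u\le\theta f_u(x,u)u^2$ for all $u\neq0$. On $H^1(\mathbb R)$, with norm $\|u\|^2=\|u\|_2^2+\|u'\|_2^2$, consider $$J(u)=\chi\Big(\tfrac12(Lu,u)-\chi\int_{\mathbb R}F(x,u(x))\,dx\Big).$$ Let $E^{+}$ and $E^-$ be the positive and negative spectral subspaces of $L$ in $H^1(\mathbb R)$, and put $E=E^-$ if $\chi=1$, $E=E^+$ if $\chi=-1$. The generalized Nehari manifold is $$\mathcal N=\{u\in H^1(\mathbb R)\setminus\{0\}:\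 (J'(u),u)=0,\ (J'(u),v)=0\ \ \forall v\in E\},$$ and $m=\inf_{\mathcal N}J$. The envelope $\mathcal E$ of $(V,f)$ is the set of all pairs $(V_h,f_h)$, with $V_h\in BS$, $f_h(x,u)$ measurable in $x$ for every $u$, $f_h(x,\cdot)\in C^1$ and $f_h(x,0)=0$ for a.e. $x$, for which there is a sequence $z_k\in\mathbb R$ with $\|T_{z_k}V-V_h\|_{BS}\to0$ and $\|f_u(\cdot+z_k,\cdot)-(f_h)_u\|_R\to0$ for all $R>0$. For $(V_h,f_h)\in\mathcal E$, let $J_h$ be the functional defined as $J$ with $(V_h,f_h)$ in place of $(V,f)$. **Lemma 5.1.** Let $u_n$ be a Palais–Smale sequence for $J$ at a level $c\in[m,2m)$, that is, $J(u_n)\to c$ and $J'(u_n)\to0$ strongly in $H^{-1}(\mathbb R)$, and suppose that $u_n\to u_0$ weakly in $H^1(\mathbb R)$. (a) If $u_0\neq0$, then $u_n\to u_0$ strongly in $H^1(\mathbb R)$, $u_0$ is a critical point of $J$, and $J(u_0)=c$. (b) If $u_0=0$, then there exist a sequence $x_n\in\mathbb R$ with $|x_n|\to\infty$ and a nontrivial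 critical point $v_h$ of $J_h$, for some $(V_h,f_h)\in\mathcal E$, with $J_h(v_h)=c$, such that along a subsequence $T_{x_n}u_n\to v_h$ and $u_n-T_{-x_n}v_h\to0$ strongly in $H^1(\mathbb R)$. -/

import Mathlib

open MeasureTheory Filter Topology Set
open scoped ENNReal NNReal ContDiff InnerProductSpace

noncomputable section

namespace StepanovNLS

/-! ### The Sobolev space of order one on the line -/

/-- The real Hilbert space `L²(ℝ)` of real valued functions. -/
abbrev L2 : Type := Lp ℝ 2 (volume : Measure ℝ)

/-- An `L²` function times a continuous compactly supported function is integrable. -/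
theorem integrable_mul_of_compactSupport (u : L2) {φ : ℝ → ℝ} (hφ : Continuous φ)
    (hc : HasCompactSupport φ) : Integrable (fun x => u x * φ x) volume :=
  (Lp.memLp u).integrable_mul (q := 2) (hφ.memLp_of_hasCompactSupport hc)

/-- The pairs `(u, u')` in `L² × L²` such that `u'` is the weak derivative of `u`, as a subspace
of the Hilbert sum of two copies of `L²`. -/
def sobolevGraph : Submodule ℝ (WithLp 2 (L2 × L2)) where
  carrier := {p | ∀ φ : ℝ → ℝ, ContDiff ℝ ∞ φ → HasCompactSupport φ →
    ∫ x, p.fst x * deriv φ x = -∫ x, p.snd x * φ x}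
  zero_mem' := by
    intro φ _ _
    have h : ∀ ψ : ℝ → ℝ, ∫ x, (0 : L2) x * ψ x = 0 := by
      intro ψ
      refine integral_eq_zero_of_ae ?_
      filter_upwards [Lp.coeFn_zero ℝ 2 (volume : Measure ℝ)] with x hx
      rw [hx]
      simp
    simp only [WithLp.zero_fst, WithLp.zero_snd, h, neg_zero]
  add_mem' := by
    intro p q hp hq φ hφ hc
    have h : ∀ (a b : L2) (ψ : ℝ → ℝ), Continuous ψ → HasCompactSupport ψ →
        ∫ x, (a + b : L2) x * ψ x = (∫ x, a x * ψ x) + ∫ x, b x * ψ x := by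
      intro a b ψ hψ hψc
      rw [← integral_add (integrable_mul_of_compactSupport a hψ hψc)
        (integrable_mul_of_compactSupport b hψ hψc)]
      refine integral_congr_ae ?_
      filter_upwards [Lp.coeFn_add a b] with x hx
      rw [hx, Pi.add_apply, add_mul]
    rw [WithLp.add_fst, WithLp.add_snd,
      h _ _ _ (hφ.continuous_deriv (by simp)) hc.deriv, h _ _ _ hφ.continuous hc,
      hp φ hφ hc, hq φ hφ hc]
    ring
  smul_mem' := by
    intro r p hp φ hφ hc
    have h : ∀ (a : L2) (ψ : ℝ → ℝ), ∫ x, (r • a : L2) x * ψ x = r * ∫ x, a x * ψ x := by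
      intro a ψ
      rw [← integral_const_mul]
      refine integral_congr_ae ?_
      filter_upwards [Lp.coeFn_smul r a] with x hx
      rw [hx, Pi.smul_apply, smul_eq_mul, mul_assoc]
    rw [WithLp.smul_fst, WithLp.smul_snd, h, h, hp φ hφ hc]
    ring

/-- `H¹(ℝ)`, with the inner product `⟪u, v⟫ = (u, v)_{L²} + (u', v')_{L²}`. -/
abbrev H1 : Type := sobolevGraph

/-- The underlying `L²` function of an element of `H¹`. -/
def H1.val (u : H1) : L2 := (u : WithLp 2 (L2 × L2)).fst

/-- The weak derivative of an element of `H¹`. -/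
def H1.der (u : H1) : L2 := (u : WithLp 2 (L2 × L2)).snd

/-- The shift `u ↦ u(· + z)` on `L²`. -/
def shiftL2 (z : ℝ) (u : L2) : L2 :=
  Lp.compMeasurePreserving (fun x : ℝ => x + z) (measurePreserving_add_right volume z) u

theorem integral_shiftL2_mul (z : ℝ) (u : L2) (φ : ℝ → ℝ) :
    ∫ x, shiftL2 z u x * φ x = ∫ x, u x * φ (x - z) := by
  rw [← integral_add_right_eq_self (fun x => u x * φ (x - z)) z]
  refine integral_congr_ae ?_
  filter_upwards [Lp.coeFn_compMeasurePreserving u (measurePreserving_add_right volume z)]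
    with x hx
  rw [shiftL2, hx]
  simp

/-- The shift `T_z u = u(· + z)` on `H¹`. -/
def shift (z : ℝ) (u : H1) : H1 :=
  ⟨WithLp.toLp 2 (shiftL2 z u.val, shiftL2 z u.der), by
    intro φ hφ hc
    change ∫ x, shiftL2 z u.val x * deriv φ x = -∫ x, shiftL2 z u.der x * φ x
    rw [integral_shiftL2_mul, integral_shiftL2_mul]
    have h := u.2 (fun x => φ (x - z)) (hφ.comp (contDiff_id.sub contDiff_const))
      (hc.comp_homeomorph (Homeomorph.subRight z))
    simp only [deriv_comp_sub_const] at h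
    exact h⟩

/-- Weak convergence in `H¹`. -/
def WeaklyTendsto (u : ℕ → H1) (u₀ : H1) : Prop :=
  ∀ ℓ : StrongDual ℝ H1, Tendsto (fun n => ℓ (u n)) atTop (𝓝 (ℓ u₀))

/-! ### Stepanov almost periodicity -/

/-- The Stepanov norm `sup_t ∫_t^{t+1} |w|`. -/
def stepanovNorm (w : ℝ → ℝ) : ℝ≥0∞ := ⨆ t : ℝ, ∫⁻ x in Icc t (t + 1), ‖w x‖ₑ

/-- Stepanov bounded functions, the space `BS(ℝ)`. -/
def StepanovBounded (w : ℝ → ℝ) : Prop :=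
  LocallyIntegrable w volume ∧ stepanovNorm w < ⊤

/-- Stepanov almost periodic functions, the space `S(ℝ)`. -/
def StepanovAP (w : ℝ → ℝ) : Prop :=
  StepanovBounded w ∧ ∀ z : ℕ → ℝ, ∃ φ : ℕ → ℕ, StrictMono φ ∧ ∃ w' : ℝ → ℝ, StepanovBounded w' ∧
    Tendsto (fun k => stepanovNorm (fun x => w (x + z (φ k)) - w' x)) atTop (𝓝 0)

/-- Carathéodory functions of `(x, u)`. -/
def Caratheodory (g : ℝ → ℝ → ℝ) : Prop :=
  (∀ᵐ x : ℝ, Continuous (g x)) ∧ ∀ u : ℝ, AEStronglyMeasurable (fun x => g x u) volume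

/-- The seminorm `‖g‖_R`, the Stepanov norm of `x ↦ sup_{|u| ≤ R} |g(x, u)|`. -/
def stepanovSeminorm (R : ℝ) (g : ℝ → ℝ → ℝ) : ℝ≥0∞ :=
  ⨆ t : ℝ, ∫⁻ x in Icc t (t + 1), ⨆ u ∈ Icc (-R) R, ‖g x u‖ₑ

/-- Strictly Stepanov almost periodic functions, the class `S(ℝ × ℝ)`. -/
def StrictStepanovAP (g : ℝ → ℝ → ℝ) : Prop :=
  Caratheodory g ∧ (∀ R > 0, stepanovSeminorm R g < ⊤) ∧
    ∀ z : ℕ → ℝ, ∃ φ : ℕ → ℕ, StrictMono φ ∧ ∃ g' : ℝ → ℝ → ℝ, Caratheodory g' ∧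
      (∀ R > 0, stepanovSeminorm R g' < ⊤) ∧
      ∀ R > 0, Tendsto (fun k => stepanovSeminorm R (fun x u => g (x + z (φ k)) u - g' x u))
        atTop (𝓝 0)

/-! ### The Schrödinger operator -/

/-- The form `(Lu, v) = ∫ u'v' + ∫ V u v` of the operator `L = -d²/dx² + V`. -/
def schrodingerForm (V : ℝ → ℝ) (u v : H1) : ℝ :=
  (∫ x, u.der x * v.der x) + ∫ x, V x * u.val x * v.val x

/-- The graph of the self-adjoint operator `L` in `L²` associated to the form: `u` is in the domain
of `L`, and `L u = g`. -/
def IsSchrodingerImage (V : ℝ → ℝ) (u : H1) (g : L2) : Prop :=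
  ∀ v : H1, schrodingerForm V u v = ⟪g, v.val⟫_ℝ

/-- The resolvent set of `L`: those (real) `r` for which `L - r` is a bijection from the domain of
`L` onto `L²` with bounded inverse. -/
def schrodingerResolventSet (V : ℝ → ℝ) : Set ℝ :=
  {r | (∀ g : L2, ∃! u : H1, IsSchrodingerImage V u (r • u.val + g)) ∧
    ∃ C : ℝ, ∀ (u : H1) (g : L2), IsSchrodingerImage V u (r • u.val + g) → ‖u.val‖ ≤ C * ‖g‖}

/-- The spectrum of `L` (a set of reals, because `L` is self-adjoint). -/
def schrodingerSpectrum (V : ℝ → ℝ) : Set ℝ := (schrodingerResolventSet V)ᶜ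

/-- `(Ep, Em)` is the splitting of `H¹` into the positive and the negative (spectral) subspace of
`L`: the two closed subspaces are complementary, orthogonal to each other in `L²` and with
respect to the form of `L` (so that they reduce `L`), and the form is positive on the first and
negative on the second one. For `0 ∉ σ(L)` there is exactly one such pair, formed by the
intersections of `H¹` with the ranges of the spectral projectors of `L` for `(0, ∞)` and for
`(-∞, 0)`. -/
structure IsSpectralSplitting (V : ℝ → ℝ) (Ep Em : Submodule ℝ H1) : Prop where
  closed_pos : IsClosed (Ep : Set H1)
  closed_neg : IsClosed (Em : Set H1)
  isCompl : IsCompl Ep Em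
  orthogonal : ∀ u ∈ Ep, ∀ v ∈ Em, ⟪u.val, v.val⟫_ℝ = 0
  form_orthogonal : ∀ u ∈ Ep, ∀ v ∈ Em, schrodingerForm V u v = 0
  form_pos : ∀ u ∈ Ep, u ≠ 0 → 0 < schrodingerForm V u u
  form_neg : ∀ u ∈ Em, u ≠ 0 → schrodingerForm V u u < 0

/-- The pair `(E⁺, E⁻)`: the unique spectral splitting of `H¹`. -/
def spectralSplitting (V : ℝ → ℝ) : Submodule ℝ H1 × Submodule ℝ H1 :=
  Classical.epsilon fun E => IsSpectralSplitting V E.1 E.2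

/-! ### The nonlinearity, the standing assumptions and the envelope -/

/-- The primitive `F(x, u) = ∫_0^u f(x, s) ds`. -/
def primitive (f : ℝ → ℝ → ℝ) (x u : ℝ) : ℝ := ∫ s in (0 : ℝ)..u, f x s

/-- The partial derivative `f_u(x, u)`. -/
def partialU (f : ℝ → ℝ → ℝ) (x u : ℝ) : ℝ := deriv (f x) u

/-- The assumptions on the equation `-u'' + V(x) u = χ f(x, u)`. -/
structure StandingAssumptions (χ : ℝ) (V : ℝ → ℝ) (f : ℝ → ℝ → ℝ) : Prop where
  sign : χ = 1 ∨ χ = -1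
  potential : StepanovAP V
  zero_notMem_spectrum : (0 : ℝ) ∉ schrodingerSpectrum V
  spectrum_below : χ = -1 → ∃ r ∈ schrodingerSpectrum V, r < 0
  contDiff : ∀ᵐ x : ℝ, ContDiff ℝ 1 (f x)
  ap_primitive : StrictStepanovAP (primitive f)
  ap_self : StrictStepanovAP f
  ap_partialU : StrictStepanovAP (partialU f)
  primitive_lower : ∀ u : ℝ, u ≠ 0 → ∃ δ > 0, ∀ᵐ x : ℝ, δ ≤ primitive f x u
  self_zero : ∀ᵐ x : ℝ, f x 0 = 0
  partialU_zero : ∀ᵐ x : ℝ, partialU f x 0 = 0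
  partialU_lipschitz : ∀ R > 0, ∃ μ > 0, ∀ᵐ x : ℝ, ∀ u v : ℝ, |u| ≤ R → |v| ≤ R →
    |partialU f x u - partialU f x v| ≤ μ * |u - v|
  superlinear : ∃ θ ∈ Ioo (0 : ℝ) 1, ∀ᵐ x : ℝ, ∀ u : ℝ, u ≠ 0 →
    0 < f x u * u ∧ f x u * u ≤ θ * (partialU f x u * u ^ 2)

/-- `(V', f')` belongs to the envelope of `(V, f)`, the closure of the set of all shifts
`(T_z V, T_z f)` in the topology of the seminorms `‖V‖_{BS} + ‖f_u‖_R`, `R > 0`, on the pairs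
whose second entry is a `C¹` nonlinearity that vanishes at `u = 0`. -/
structure InEnvelope (V : ℝ → ℝ) (f : ℝ → ℝ → ℝ) (V' : ℝ → ℝ) (f' : ℝ → ℝ → ℝ) : Prop where
  bounded : StepanovBounded V'
  measurable : ∀ u : ℝ, AEStronglyMeasurable (fun x => f' x u) volume
  contDiff : ∀ᵐ x : ℝ, ContDiff ℝ 1 (f' x)
  self_zero : ∀ᵐ x : ℝ, f' x 0 = 0
  approx : ∃ z : ℕ → ℝ,
    Tendsto (fun k => stepanovNorm (fun x => V (x + z k) - V' x)) atTop (𝓝 0) ∧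
    ∀ R > 0, Tendsto (fun k => stepanovSeminorm R
      (fun x u => partialU f (x + z k) u - partialU f' x u)) atTop (𝓝 0)

/-! ### The functional, Palais–Smale sequences and the generalized Nehari manifold -/

/-- The energy `½ (Lu, u) - χ ∫ F(x, u(x)) dx` of the equation `-u'' + V u = χ f(x, u)`. -/
def energy (χ : ℝ) (V : ℝ → ℝ) (f : ℝ → ℝ → ℝ) (u : H1) : ℝ :=
  schrodingerForm V u u / 2 - χ * ∫ x, primitive f x (u.val x)

/-- The functional `J`: it is the energy if `χ = 1`, and minus the energy if `χ = -1`. -/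
def functionalJ (χ : ℝ) (V : ℝ → ℝ) (f : ℝ → ℝ → ℝ) (u : H1) : ℝ := χ * energy χ V f u

/-- The subspace which enters the Nehari manifold: `E⁻` if `χ = 1`, and `E⁺` if `χ = -1`. -/
def nehariSubspace (χ : ℝ) (V : ℝ → ℝ) : Submodule ℝ H1 :=
  open Classical in if χ = 1 then (spectralSplitting V).2 else (spectralSplitting V).1

/-- The generalized Nehari manifold: all `u ≠ 0` with `(J'(u), u) = 0` and `(J'(u), v) = 0` for
all `v` in the subspace above. -/
def nehariManifold (χ : ℝ) (V : ℝ → ℝ) (f : ℝ → ℝ → ℝ) : Set H1 :=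
  {u | u ≠ 0 ∧ fderiv ℝ (functionalJ χ V f) u u = 0 ∧
    ∀ v ∈ nehariSubspace χ V, fderiv ℝ (functionalJ χ V f) u v = 0}

/-- The infimum `m` of `J` over the generalized Nehari manifold. -/
def nehariLevel (χ : ℝ) (V : ℝ → ℝ) (f : ℝ → ℝ → ℝ) : ℝ :=
  sInf (functionalJ χ V f '' nehariManifold χ V f)

/-- Palais–Smale sequences of a functional on `H¹` at a level `c`; the derivatives converge in
the norm of the dual space `H⁻¹`. -/
def IsPalaisSmale (J : H1 → ℝ) (c : ℝ) (u : ℕ → H1) : Prop :=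
  Tendsto (fun n => J (u n)) atTop (𝓝 c) ∧ Tendsto (fun n => fderiv ℝ J (u n)) atTop (𝓝 0)

/-- `u` is a critical point of `J`: the derivative of `J` at `u` exists and is zero. -/
def IsCriticalPoint (J : H1 → ℝ) (u : H1) : Prop := HasFDerivAt J (0 : StrongDual ℝ H1) u

end StepanovNLS

end

open StepanovNLS

noncomputable section

namespace StepanovNLS

/-! ### Functions with vanishing weak derivative, and primitives -/

/-! The engine is a quantitative link between almost critical points and the Nehari manifold. Let
`v` be bounded and almost critical for `J`, with `∫ f_u(x, v) v²` bounded away from zero. The form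
`χ (Lu, u)` is negative on `E`, and assumption (iv) makes `J''(v)` uniformly negative definite on `E
+ ℝv`. Hence `J` is uniformly concave on a small ball of `v + (E + ℝv)` and has an interior maximum
there. This maximum lies on the Nehari manifold, and its energy exceeds `J(v)` only slightly. So `m`
is at most `J(v)` plus a small error (`Admissible.nehariLevel_le`).

There are two consequences. First, a bounded almost critical sequence whose level is below `m` must
have `∫ f_u(x, v) v² → 0`; then the nonlinear term vanishes in `L²`, and the gap of `L` at `0`
forces strong convergence to `0` (`Admissible.tendsto_zero_of_level_lt`). Second, a nontrivial
critical point of an envelope functional, shifted back, is almost critical for `J` itself, so its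
energy is at least `m` (`ShiftLimit.nehariLevel_le`). No spectral information on the limit operators
is needed.

For an almost critical sequence `w_n` of shifted functionals with weak limit `w₀ ≠ 0`, a Brezis–Lieb
splitting shows that `w_n - w₀` is almost critical at the level `c - J_h(w₀) ≤ c - m < m`. Shifted
back, it tends to `0` by the first consequence, so `w_n → w₀` and `J_h(w₀) = c`
(`ShiftLimit.tendsto_of_weaklyTendsto`). Part (a) is the case of zero shifts. In part (b), `c > 0`
prevents `u_n` from vanishing uniformly, so there are points `x_n` with `|u_n(x_n)| ≥ κ`, and `|x_n|
→ ∞` because `u_n` is weakly null. The sequence translated by `x_n` has a nonzero weak limit, and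
almost periodicity yields a limit pair in the envelope (`StandingAssumptions.exists_shiftLimit`).

Two preliminaries carry this. Functions in `H¹` have continuous representatives, with local bounds
that control Stepanov bounded potentials. The spectral splitting is obtained from operator square
roots built by a contraction argument. -/

theorem exists_Ioo_of_hasCompactSupport {φ : ℝ → ℝ} (hc : HasCompactSupport φ) :
    ∃ M : ℝ, 0 < M ∧ ∀ x, M ≤ |x| → φ x = 0 := by
  obtain ⟨R, hR⟩ := hc.isCompact.isBounded.subset_closedBall 0
  refine ⟨|R| + 1, by positivity, fun x hx => ?_⟩
  by_contra h
  have h1 := hR (subset_tsupport _ h)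
  rw [mem_closedBall_zero_iff, Real.norm_eq_abs] at h1
  linarith [le_abs_self R]

/-- The primitive started to the left of the support vanishes to its right as well, since the total
integral is zero. -/
theorem exists_compactlySupported_primitive {h : ℝ → ℝ} (hh : ContDiff ℝ ∞ h)
    (hc : HasCompactSupport h) (h0 : ∫ x, h x = 0) :
    ∃ ψ : ℝ → ℝ, ContDiff ℝ ∞ ψ ∧ HasCompactSupport ψ ∧ deriv ψ = h := by
  obtain ⟨M, hM, hM'⟩ := exists_Ioo_of_hasCompactSupport hc
  have hd : ∀ x, HasDerivAt (fun x => ∫ t in (-M)..x, h t) (h x) x := fun x =>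
    intervalIntegral.integral_hasDerivAt_right (hh.continuous.intervalIntegrable _ _)
      (hh.continuous.stronglyMeasurableAtFilter _ _) hh.continuous.continuousAt
  have hderiv : deriv (fun x => ∫ t in (-M)..x, h t) = h := funext fun x => (hd x).deriv
  refine ⟨fun x => ∫ t in (-M)..x, h t, ?_, ?_, hderiv⟩
  · rw [contDiff_infty_iff_deriv, hderiv]
    exact ⟨fun x => (hd x).differentiableAt, hh⟩
  · refine HasCompactSupport.intro (isCompact_Icc (a := -M) (b := M)) fun x hx => ?_
    rw [mem_Icc, not_and_or, not_le, not_le] at hx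
    rcases hx with hx | hx
    · refine intervalIntegral.integral_zero_ae (Eventually.of_forall fun t ht => hM' t ?_)
      rw [uIoc_of_ge hx.le] at ht
      rw [abs_of_nonpos (by linarith [ht.2])]
      linarith [ht.2]
    · rw [intervalIntegral.integral_eq_integral_of_support_subset, h0]
      intro t ht
      by_contra h1
      refine ht (hM' t ?_)
      rw [mem_Ioc, not_and_or, not_le, not_lt] at h1
      rcases h1 with h1 | h1
      · rw [abs_of_nonpos (by linarith)]; linarith
      · rw [abs_of_nonneg (by linarith)]; linarith

/-- Du Bois-Reymond: with a fixed bump `η` of integral one, `φ - (∫ φ) η` is the derivative of a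
test function, so `∫ g φ = (∫ φ) ∫ g η`. -/
theorem ae_eq_const_of_integral_mul_deriv_eq_zero {g : ℝ → ℝ} (hg : LocallyIntegrable g volume)
    (h : ∀ φ : ℝ → ℝ, ContDiff ℝ ∞ φ → HasCompactSupport φ → ∫ x, g x * deriv φ x = 0) :
    ∃ c : ℝ, ∀ᵐ x, g x = c := by
  let b : ContDiffBump (0 : ℝ) := default
  set η : ℝ → ℝ := b.normed volume with hη
  have hη1 : ContDiff ℝ ∞ η := b.contDiff_normed
  have hη2 : HasCompactSupport η := b.hasCompactSupport_normed
  have hη3 : ∫ x, η x = 1 := b.integral_normed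
  have int : ∀ φ : ℝ → ℝ, Continuous φ → HasCompactSupport φ →
      Integrable (fun x => g x * φ x) volume := fun φ h1 h2 => by
    simpa [mul_comm] using hg.integrable_smul_left_of_hasCompactSupport h1 h2
  refine ⟨∫ x, g x * η x, ?_⟩
  refine ae_eq_of_integral_contDiff_smul_eq (f' := fun _ => ∫ x, g x * η x) hg
    (locallyIntegrable_const _) fun φ hφ hφc => ?_
  have hφi := hφ.continuous.integrable_of_hasCompactSupport (μ := volume) hφc
  have hηi := hη1.continuous.integrable_of_hasCompactSupport (μ := volume) hη2
  obtain ⟨ψ, hψ, hψc, hψd⟩ := exists_compactlySupported_primitive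
    (h := fun x => φ x - (∫ y, φ y) * η x) (hφ.sub (contDiff_const.mul hη1))
    (hφc.sub hη2.mul_left) (by
      rw [integral_sub hφi (hηi.const_mul _), integral_const_mul, hη3]; ring)
  have h1 := h ψ hψ hψc
  have h2 : ∫ x, g x * deriv ψ x = (∫ x, g x * φ x) - (∫ y, φ y) * ∫ x, g x * η x := by
    rw [← integral_const_mul, ← integral_sub (int φ hφ.continuous hφc)
      ((int η hη1.continuous hη2).const_mul _), hψd]
    congr 1; ext x; ring
  rw [h1] at h2
  simp only [smul_eq_mul]
  rw [integral_mul_const]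
  simp only [mul_comm (φ _)]
  linarith

/-- Integration by parts for absolutely continuous functions on an interval containing the support
of `φ`, where the boundary terms vanish. -/
theorem integral_primitive_mul_deriv {w : ℝ → ℝ} (hw : LocallyIntegrable w volume) {φ : ℝ → ℝ}
    (hφ : ContDiff ℝ ∞ φ) (hc : HasCompactSupport φ) :
    ∫ x, (∫ t in (0 : ℝ)..x, w t) * deriv φ x = -∫ x, w x * φ x := by
  obtain ⟨M, hM, hM'⟩ := exists_Ioo_of_hasCompactSupport hc
  obtain ⟨M₁, hM₁, hM₁'⟩ := exists_Ioo_of_hasCompactSupport hc.deriv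
  set K := max M M₁ + 1
  have hK : 0 < K := by positivity
  have hK1 : ∀ x, K - 1 ≤ |x| → φ x = 0 := fun x hx =>
    hM' x (le_trans (by simp [K]) hx)
  have hK2 : ∀ x, K - 1 ≤ |x| → deriv φ x = 0 := fun x hx =>
    hM₁' x (le_trans (by simp [K]) hx)
  have hi : ∀ a b, IntervalIntegrable w volume a b := fun a b =>
    (hw.integrableOn_isCompact isCompact_uIcc).intervalIntegrable
  have ac1 := (hi (-K) K).absolutelyContinuousOnInterval_intervalIntegral (c := 0)
    (by rw [uIcc_of_le (by linarith)]; constructor <;> linarith)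
  have ac2 : AbsolutelyContinuousOnInterval φ (-K) K :=
    ContDiffOn.absolutelyContinuousOnInterval (hφ.of_le (by norm_num)).contDiffOn
  have key := ac1.integral_mul_deriv_eq_deriv_mul ac2
  have sup : ∀ (q p : ℝ → ℝ), (∀ x, K - 1 ≤ |x| → p x = 0) →
      ∫ x in (-K)..K, q x * p x = ∫ x, q x * p x := by
    intro q p hp
    refine intervalIntegral.integral_eq_integral_of_support_subset fun x hx => ?_
    by_contra h1
    refine hx ?_
    simp only
    rw [hp x, mul_zero]
    rw [mem_Ioc, not_and_or, not_le, not_lt] at h1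
    rcases h1 with h1 | h1
    · rw [abs_of_nonpos (by linarith)]; linarith
    · rw [abs_of_nonneg (by linarith)]; linarith
  rw [sup _ _ hK2, sup _ _ hK1, hK1 K (by rw [abs_of_pos hK]; linarith),
    hK1 (-K) (by rw [abs_neg, abs_of_pos hK]; linarith)] at key
  rw [key, mul_zero, mul_zero, sub_zero, zero_sub]
  congr 1
  refine integral_congr_ae ?_
  filter_upwards [LocallyIntegrable.ae_hasDerivAt_integral hw] with x hx
  rw [(hx 0).deriv]

/-! ### Hilbert space structure of `H¹` -/

theorem L2_inner_eq (u v : L2) : ⟪u, v⟫_ℝ = ∫ x, u x * v x := by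
  rw [L2.inner_def]
  congr 1; ext x
  rw [real_inner_eq_re_inner, real_inner_comm]
  simp

theorem L2_norm_sq_eq (u : L2) : ‖u‖ ^ 2 = ∫ x, u x ^ 2 := by
  rw [← real_inner_self_eq_norm_sq, L2_inner_eq]
  simp only [pow_two]

theorem L2_integrable_mul (u v : L2) : Integrable (fun x => u x * v x) volume :=
  (Lp.memLp u).integrable_mul (Lp.memLp v)

theorem L2_integrable_sq (u : L2) : Integrable (fun x => u x ^ 2) volume := by
  simpa only [pow_two] using L2_integrable_mul u u

/-- Each test function imposes one equation between continuous `L²` inner products. Completeness of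
`H¹` follows. -/
theorem isClosed_sobolevGraph : IsClosed (sobolevGraph : Set (WithLp 2 (L2 × L2))) := by
  have h : (sobolevGraph : Set (WithLp 2 (L2 × L2))) =
      ⋂ (φ : ℝ → ℝ) (h1 : ContDiff ℝ ∞ φ) (h2 : HasCompactSupport φ),
        {p | ⟪p.fst, ((h1.continuous_deriv (by simp)).memLp_of_hasCompactSupport (p := 2)
            (μ := volume) h2.deriv).toLp _⟫_ℝ
          = -⟪p.snd, (h1.continuous.memLp_of_hasCompactSupport (p := 2)
            (μ := volume) h2).toLp _⟫_ℝ} := by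
    ext p
    simp only [mem_iInter, mem_ofPred_eq]
    refine forall_congr' fun φ => forall_congr' fun h1 => forall_congr' fun h2 => ?_
    have key : ∀ (a : L2) {ψ : ℝ → ℝ} (hψ : MemLp ψ 2 volume),
        ⟪a, hψ.toLp ψ⟫_ℝ = ∫ x, a x * ψ x := fun a ψ hψ => by
      rw [L2_inner_eq]
      refine integral_congr_ae ?_
      filter_upwards [hψ.coeFn_toLp] with x hx
      rw [hx]
    rw [key, key]
  rw [h]
  refine isClosed_iInter fun φ => isClosed_iInter fun h1 => isClosed_iInter fun h2 => ?_
  refine isClosed_eq ?_ ?_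
  · exact (WithLp.continuous_fst 2 L2 L2).inner continuous_const
  · exact ((WithLp.continuous_snd 2 L2 L2).inner continuous_const).neg

instance : CompleteSpace H1 := isClosed_sobolevGraph.completeSpace_coe

theorem H1.norm_sq_eq (u : H1) : ‖u‖ ^ 2 = ‖u.val‖ ^ 2 + ‖u.der‖ ^ 2 :=
  WithLp.prod_norm_sq_eq_of_L2 _

theorem H1.norm_val_le (u : H1) : ‖u.val‖ ≤ ‖u‖ :=
  abs_le_of_sq_le_sq' (by rw [H1.norm_sq_eq]; nlinarith [sq_nonneg ‖u.der‖]) (norm_nonneg _) |>.2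

theorem H1.norm_der_le (u : H1) : ‖u.der‖ ≤ ‖u‖ :=
  abs_le_of_sq_le_sq' (by rw [H1.norm_sq_eq]; nlinarith [sq_nonneg ‖u.val‖]) (norm_nonneg _) |>.2

/-- The embedding of `H¹` into `L²`. -/
def H1.valL : H1 →L[ℝ] L2 :=
  LinearMap.mkContinuous ⟨⟨H1.val, fun _ _ => rfl⟩, fun _ _ => rfl⟩ 1 fun u => by
    rw [one_mul]; exact u.norm_val_le

theorem H1.val_add (u v : H1) : (u + v).val = u.val + v.val := rfl

theorem H1.val_smul (r : ℝ) (u : H1) : (r • u).val = r • u.val := rfl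

theorem H1.der_add (u v : H1) : (u + v).der = u.der + v.der := rfl

theorem H1.der_smul (r : ℝ) (u : H1) : (r • u).der = r • u.der := rfl

/-- Separability is what allows weakly convergent subsequences to be extracted by the sequential
Banach–Alaoglu theorem. -/
instance : SecondCountableTopology H1 := by
  have h : SecondCountableTopology L2 :=
    have : Fact ((1 : ℝ≥0∞) ≤ 2) := ⟨by norm_num⟩
    have : Fact ((2 : ℝ≥0∞) ≠ ⊤) := ⟨by norm_num⟩
    Lp.SecondCountableTopology
  have : SecondCountableTopology (WithLp 2 (L2 × L2)) :=
    (WithLp.prodContinuousLinearEquiv 2 ℝ L2 L2).toHomeomorph.secondCountableTopology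
  exact TopologicalSpace.Subtype.secondCountableTopology _

/-! ### The continuous representative -/

theorem H1.locallyIntegrable_der (u : H1) : LocallyIntegrable u.der volume :=
  (Lp.memLp u.der).locallyIntegrable (by norm_num)

theorem H1.intervalIntegrable_der (u : H1) (a b : ℝ) : IntervalIntegrable u.der volume a b :=
  (u.locallyIntegrable_der.integrableOn_isCompact isCompact_uIcc).intervalIntegrable

theorem H1.continuous_primitive_der (u : H1) : Continuous fun x => ∫ t in (0 : ℝ)..x, u.der t :=
  intervalIntegral.continuous_primitive u.intervalIntegrable_der 0

/-- The difference between `u` and the primitive of `u'` has zero weak derivative. -/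
theorem H1.exists_rep (u : H1) : ∃ c : ℝ, ∀ᵐ x, u.val x = c + ∫ t in (0 : ℝ)..x, u.der t := by
  have hp := u.continuous_primitive_der
  have hv : LocallyIntegrable u.val volume := (Lp.memLp u.val).locallyIntegrable (by norm_num)
  obtain ⟨c, hc⟩ := ae_eq_const_of_integral_mul_deriv_eq_zero
    (g := fun x => u.val x - ∫ t in (0 : ℝ)..x, u.der t)
    (hv.sub (hp.locallyIntegrable (μ := volume))) fun φ hφ hφc => by
      have hd := hφ.continuous_deriv (by simp)
      have h1 := u.2 φ hφ hφc
      have h2 := integral_primitive_mul_deriv u.locallyIntegrable_der hφ hφc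
      have hi : Integrable (fun x => (∫ t in (0 : ℝ)..x, u.der t) * deriv φ x) volume :=
        (hp.mul hd).integrable_of_hasCompactSupport hφc.deriv.mul_left
      simp only [sub_mul]
      rw [integral_sub (integrable_mul_of_compactSupport u.val hd hφc.deriv) hi, h2]
      exact sub_eq_zero.2 h1
  refine ⟨c, ?_⟩
  filter_upwards [hc] with x hx
  linarith

/-- The continuous representative of an element of `H¹`. -/
def H1.rep (u : H1) (x : ℝ) : ℝ := u.exists_rep.choose + ∫ t in (0 : ℝ)..x, u.der t

theorem H1.val_ae_eq_rep (u : H1) : u.val =ᵐ[volume] u.rep := u.exists_rep.choose_spec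

theorem H1.continuous_rep (u : H1) : Continuous u.rep :=
  continuous_const.add u.continuous_primitive_der

theorem H1.rep_sub_rep (u : H1) (x y : ℝ) : u.rep y - u.rep x = ∫ t in x..y, u.der t := by
  rw [H1.rep, H1.rep, ← intervalIntegral.integral_add_adjacent_intervals
    (u.intervalIntegrable_der 0 x) (u.intervalIntegrable_der x y)]
  ring

theorem H1.rep_eq_of_ae {u : H1} {g : ℝ → ℝ} (hg : Continuous g) (h : u.val =ᵐ[volume] g) :
    u.rep = g :=
  Continuous.ae_eq_iff_eq volume u.continuous_rep hg |>.1 (u.val_ae_eq_rep.symm.trans h)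

theorem H1.rep_add (u v : H1) (x : ℝ) : (u + v).rep x = u.rep x + v.rep x := by
  refine congrFun (H1.rep_eq_of_ae (g := fun x => u.rep x + v.rep x)
    (u.continuous_rep.add v.continuous_rep) ?_) x
  filter_upwards [Lp.coeFn_add u.val v.val, u.val_ae_eq_rep, v.val_ae_eq_rep] with x h1 h2 h3
  rw [H1.val_add, h1, Pi.add_apply, h2, h3]

theorem H1.rep_smul (r : ℝ) (u : H1) (x : ℝ) : (r • u).rep x = r * u.rep x := by
  refine congrFun (H1.rep_eq_of_ae (g := fun x => r * u.rep x)
    (continuous_const.mul u.continuous_rep) ?_) x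
  filter_upwards [Lp.coeFn_smul r u.val, u.val_ae_eq_rep] with x h1 h2
  rw [H1.val_smul, h1, Pi.smul_apply, h2, smul_eq_mul]

theorem H1.rep_neg (u : H1) (x : ℝ) : (-u).rep x = -u.rep x := by
  rw [← neg_one_smul ℝ u, H1.rep_smul]; ring

theorem H1.rep_sub (u v : H1) (x : ℝ) : (u - v).rep x = u.rep x - v.rep x := by
  rw [sub_eq_add_neg, H1.rep_add, H1.rep_neg]; ring

theorem H1.rep_zero (x : ℝ) : (0 : H1).rep x = 0 := by
  rw [← zero_smul ℝ (0 : H1), H1.rep_smul]; ring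

theorem H1.memLp_rep (u : H1) : MemLp u.rep 2 volume :=
  (memLp_congr_ae u.val_ae_eq_rep).1 (Lp.memLp u.val)

theorem H1.integrable_rep_mul (u v : H1) : Integrable (fun x => u.rep x * v.rep x) volume :=
  u.memLp_rep.integrable_mul v.memLp_rep

theorem H1.integrable_rep_sq (u : H1) : Integrable (fun x => u.rep x ^ 2) volume := by
  simpa only [pow_two] using u.integrable_rep_mul u

theorem H1.integral_rep_sq (u : H1) : ∫ x, u.rep x ^ 2 = ‖u.val‖ ^ 2 := by
  rw [L2_norm_sq_eq]
  refine integral_congr_ae ?_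
  filter_upwards [u.val_ae_eq_rep] with x hx
  rw [hx]

theorem H1.integral_rep_sq_le (u : H1) : ∫ x, u.rep x ^ 2 ≤ ‖u‖ ^ 2 := by
  rw [u.integral_rep_sq]
  exact pow_le_pow_left₀ (norm_nonneg _) u.norm_val_le 2

theorem H1.val_eq_of_rep_eq {u v : H1} (h : u.rep = v.rep) : u.val = v.val :=
  Lp.ext (u.val_ae_eq_rep.trans (h ▸ v.val_ae_eq_rep.symm))

/-- A weak derivative is determined by its function. This reduces identities in `H¹` to pointwise
identities of representatives. -/
theorem H1.ext_rep {u v : H1} (h : u.rep = v.rep) : u = v := by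
  have h0 : (u - v).val = 0 := by
    have : (u - v).val = u.val - v.val := rfl
    rw [this, H1.val_eq_of_rep_eq h, sub_self]
  have h1 : (u - v).der = 0 := by
    refine (Lp.eq_zero_iff_ae_eq_zero).2 ?_
    refine ae_eq_zero_of_integral_contDiff_smul_eq_zero (u - v).locallyIntegrable_der
      fun φ hφ hφc => ?_
    have h2 := (u - v).2 φ hφ hφc
    change ∫ x, (u - v).val x * deriv φ x = -∫ x, (u - v).der x * φ x at h2
    rw [h0, integral_eq_zero_of_ae (by
      filter_upwards [Lp.coeFn_zero ℝ 2 (volume : Measure ℝ)] with x hx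
      rw [hx]; simp)] at h2
    simp only [smul_eq_mul, mul_comm (φ _)]
    linarith
  have h3 := (u - v).norm_sq_eq
  rw [h0, h1, norm_zero] at h3
  rw [← sub_eq_zero, ← norm_eq_zero]
  exact pow_eq_zero_iff (two_ne_zero) |>.1 (by linarith)

/-- Cauchy–Schwarz against a constant, from expanding `∫ (m w - A)² ≥ 0` with `m` the measure of `s`
and `A` the integral of `w`. -/
theorem sq_setIntegral_le {w : ℝ → ℝ} {s : Set ℝ} (hs : volume s ≠ ⊤)
    (hw : IntegrableOn w s volume) (hw2 : IntegrableOn (fun x => w x ^ 2) s volume) :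
    (∫ x in s, w x) ^ 2 ≤ volume.real s * ∫ x in s, w x ^ 2 := by
  set m := volume.real s
  set A := ∫ x in s, w x
  have hm : 0 ≤ m := measureReal_nonneg
  have hconst : ∀ c : ℝ, IntegrableOn (fun _ : ℝ => c) s volume := fun c => integrableOn_const hs
  have h1 : 0 ≤ ∫ x in s, (m * w x - A) ^ 2 := integral_nonneg fun x => sq_nonneg _
  have h2 : ∫ x in s, (m * w x - A) ^ 2 = m * (m * (∫ x in s, w x ^ 2) - A ^ 2) := by
    have : ∀ x, (m * w x - A) ^ 2 = m ^ 2 * w x ^ 2 - (2 * m * A) * w x + A ^ 2 := fun x => by ring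
    have i1 : IntegrableOn (fun x => m ^ 2 * w x ^ 2) s volume := hw2.const_mul _
    have i2 : IntegrableOn (fun x => 2 * m * A * w x) s volume := hw.const_mul _
    have i3 : IntegrableOn (fun x => m ^ 2 * w x ^ 2 - 2 * m * A * w x) s volume := i1.sub i2
    simp only [this]
    rw [integral_add i3 (hconst _), integral_sub i1 i2, integral_const_mul, integral_const_mul,
      setIntegral_const]
    simp only [smul_eq_mul]
    ring
  rcases hm.eq_or_lt with h0 | h0
  · have : A = 0 := by
      have h3 : volume s = 0 := by
        rcases (ENNReal.toReal_eq_zero_iff _).1 h0.symm with h | h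
        · exact h
        · exact absurd h hs
      exact setIntegral_measure_zero _ h3
    rw [this, ← h0]; simp
  · rw [h2] at h1
    have := nonneg_of_mul_nonneg_right h1 h0
    linarith

theorem H1.sq_rep_sub_rep_le (u : H1) {a b x y : ℝ} (hab : a ≤ b) (hx : x ∈ Icc a b)
    (hy : y ∈ Icc a b) :
    (u.rep y - u.rep x) ^ 2 ≤ (b - a) * ∫ t in Ioc a b, u.der t ^ 2 := by
  have hw := u.locallyIntegrable_der
  have h2 := (L2_integrable_sq u.der)
  rw [H1.rep_sub_rep, ← sq_abs, intervalIntegral.abs_intervalIntegral_eq, sq_abs]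
  have hsub : uIoc x y ⊆ Ioc a b := by
    intro t ht
    rw [mem_uIoc] at ht
    rcases ht with ht | ht
    · exact ⟨lt_of_le_of_lt hx.1 ht.1, ht.2.trans hy.2⟩
    · exact ⟨lt_of_le_of_lt hy.1 ht.1, ht.2.trans hx.2⟩
  have hvol : volume (uIoc x y) ≠ ⊤ := by
    refine ne_top_of_le_ne_top ?_ (measure_mono hsub)
    simp
  refine (sq_setIntegral_le hvol
    ((u.intervalIntegrable_der x y).def') h2.integrableOn).trans ?_
  refine mul_le_mul ?_ (setIntegral_mono_set h2.integrableOn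
    (Eventually.of_forall fun t => sq_nonneg _) hsub.eventuallyLE)
    (integral_nonneg fun t => sq_nonneg _) (by linarith)
  refine (measureReal_mono hsub (by simp)).trans ?_
  simp [hab]

/-- Average `u(y)² ≤ 2 u(x)² + 2 (u(y) - u(x))²` over `x` in the interval. A short interval makes
the coefficient of the derivative small, which the Gårding inequality exploits. -/
theorem H1.sq_rep_le (u : H1) (a : ℝ) {δ : ℝ} (hδ : 0 < δ) {y : ℝ} (hy : y ∈ Ioc a (a + δ)) :
    u.rep y ^ 2 ≤ (2 / δ) * (∫ t in Ioc a (a + δ), u.rep t ^ 2)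
      + 2 * δ * ∫ t in Ioc a (a + δ), u.der t ^ 2 := by
  set D := ∫ t in Ioc a (a + δ), u.der t ^ 2
  have h1 : ∀ x ∈ Ioc a (a + δ), u.rep y ^ 2 ≤ 2 * u.rep x ^ 2 + 2 * δ * D := by
    intro x hx
    have := u.sq_rep_sub_rep_le (by linarith) (Ioc_subset_Icc_self hx) (Ioc_subset_Icc_self hy)
    rw [add_sub_cancel_left] at this
    nlinarith [sq_nonneg (u.rep y - 2 * u.rep x)]
  have hi := u.integrable_rep_sq.integrableOn (s := Ioc a (a + δ))
  have hc : ∀ c : ℝ, IntegrableOn (fun _ : ℝ => c) (Ioc a (a + δ)) volume := fun c =>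
    integrableOn_const (by simp)
  have h2 := setIntegral_mono_on (hc (u.rep y ^ 2)) ((hi.const_mul 2).add (hc (2 * δ * D)))
    measurableSet_Ioc h1
  simp only [Pi.add_apply] at h2
  rw [integral_add (hi.const_mul 2) (hc _), setIntegral_const, setIntegral_const,
    integral_const_mul] at h2
  simp only [Real.volume_real_Ioc, add_sub_cancel_left, smul_eq_mul, max_eq_left hδ.le] at h2
  have h3 : u.rep y ^ 2 = (δ * u.rep y ^ 2) / δ := by field_simp
  rw [h3, div_le_iff₀ hδ]
  refine h2.trans (le_of_eq ?_)
  field_simp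

/-- The previous estimate on a unit interval. The constant is not sharp; it is the source of the
conditions `2 * ‖u‖ ≤ n` that keep the values of `u` in `[-n, n]`. -/
theorem H1.abs_rep_le (u : H1) (x : ℝ) : |u.rep x| ≤ 2 * ‖u‖ := by
  have h := u.sq_rep_le (x - 1) one_pos (y := x) (by constructor <;> linarith)
  have h1 : ∫ t in Ioc (x - 1) (x - 1 + 1), u.rep t ^ 2 ≤ ‖u.val‖ ^ 2 := by
    rw [← u.integral_rep_sq]
    exact setIntegral_le_integral u.integrable_rep_sq (Eventually.of_forall fun t => sq_nonneg _)
  have h2 : ∫ t in Ioc (x - 1) (x - 1 + 1), u.der t ^ 2 ≤ ‖u.der‖ ^ 2 := by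
    rw [L2_norm_sq_eq]
    exact setIntegral_le_integral (L2_integrable_sq _) (Eventually.of_forall fun t => sq_nonneg _)
  have h3 := u.norm_sq_eq
  refine abs_le_of_sq_le_sq ?_ (by positivity)
  nlinarith

theorem H1.abs_rep_sub_rep_le (u : H1) (x y : ℝ) :
    (u.rep y - u.rep x) ^ 2 ≤ |y - x| * ‖u‖ ^ 2 := by
  have key : ∀ a b, a ≤ b → (u.rep b - u.rep a) ^ 2 ≤ (b - a) * ‖u‖ ^ 2 := by
    intro a b hab
    refine (u.sq_rep_sub_rep_le hab (left_mem_Icc.2 hab) (right_mem_Icc.2 hab)).trans ?_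
    refine mul_le_mul_of_nonneg_left ?_ (by linarith)
    have h2 : ∫ t in Ioc a b, u.der t ^ 2 ≤ ‖u.der‖ ^ 2 := by
      rw [L2_norm_sq_eq]
      exact setIntegral_le_integral (L2_integrable_sq _)
        (Eventually.of_forall fun t => sq_nonneg _)
    exact h2.trans (pow_le_pow_left₀ (norm_nonneg _) u.norm_der_le 2)
  rcases le_total x y with h | h
  · rw [abs_of_nonneg (by linarith)]; exact key x y h
  · rw [abs_of_nonpos (by linarith)]
    have := key y x h
    nlinarith

/-- Evaluation at a point. -/
def H1.evalL (x : ℝ) : StrongDual ℝ H1 :=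
  LinearMap.mkContinuous ⟨⟨fun u => u.rep x, fun u v => u.rep_add v x⟩, fun r u => u.rep_smul r x⟩
    2 fun u => u.abs_rep_le x

/-! ### Weak convergence -/

theorem WeaklyTendsto.tendsto_rep {u : ℕ → H1} {u₀ : H1} (h : WeaklyTendsto u u₀) (x : ℝ) :
    Tendsto (fun n => (u n).rep x) atTop (𝓝 (u₀.rep x)) :=
  h (H1.evalL x)

theorem WeaklyTendsto.exists_norm_le {u : ℕ → H1} {u₀ : H1} (h : WeaklyTendsto u u₀) :
    ∃ R : ℝ, ∀ n, ‖u n‖ ≤ R := by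
  obtain ⟨C, hC⟩ := banach_steinhaus (g := fun n => InnerProductSpace.toDual ℝ H1 (u n))
    fun v => by
      obtain ⟨C, hC⟩ := (h (InnerProductSpace.toDual ℝ H1 v)).norm.bddAbove_range
      refine ⟨C, fun n => ?_⟩
      have := hC ⟨n, rfl⟩
      simp only [InnerProductSpace.toDual_apply_apply] at this ⊢
      rwa [real_inner_comm]
  exact ⟨C, fun n => ((InnerProductSpace.toDual ℝ H1).norm_map (u n)).symm.le.trans (hC n)⟩

/-- Sequential Banach–Alaoglu in the dual, transported to `H¹` by the Riesz isomorphism. -/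
theorem exists_subseq_weaklyTendsto {u : ℕ → H1} {R : ℝ} (h : ∀ n, ‖u n‖ ≤ R) :
    ∃ φ : ℕ → ℕ, StrictMono φ ∧ ∃ u₀ : H1, WeaklyTendsto (u ∘ φ) u₀ := by
  obtain ⟨a, -, φ, hφ, ha⟩ := WeakDual.isSeqCompact_closedBall ℝ H1 0 R
    (x := fun n => StrongDual.toWeakDual (InnerProductSpace.toDual ℝ H1 (u n))) (fun n =>
      (mem_closedBall_zero_iff (a := InnerProductSpace.toDual ℝ H1 (u n)) (r := R)).2
        (((InnerProductSpace.toDual ℝ H1).norm_map (u n)).le.trans (h n)))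
  refine ⟨φ, hφ, (InnerProductSpace.toDual ℝ H1).symm (WeakDual.toStrongDual a), fun ℓ => ?_⟩
  have h1 := (WeakDual.eval_continuous ((InnerProductSpace.toDual ℝ H1).symm ℓ)).tendsto a
  have h2 := h1.comp ha
  have h3 : ∀ v : H1, ℓ v = ⟪v, (InnerProductSpace.toDual ℝ H1).symm ℓ⟫_ℝ := fun v => by
    rw [real_inner_comm, InnerProductSpace.toDual_symm_apply]
  rw [h3, InnerProductSpace.toDual_symm_apply]
  simp only [Function.comp_def, h3]
  exact h2

/-! ### Shifts -/

theorem shiftL2_ae (z : ℝ) (u : L2) : shiftL2 z u =ᵐ[volume] fun x => u (x + z) :=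
  Lp.coeFn_compMeasurePreserving u (measurePreserving_add_right volume z)

theorem norm_shiftL2 (z : ℝ) (u : L2) : ‖shiftL2 z u‖ = ‖u‖ :=
  Lp.norm_compMeasurePreserving u (measurePreserving_add_right volume z)

theorem shift_val (z : ℝ) (u : H1) : (shift z u).val = shiftL2 z u.val := rfl

theorem shift_der (z : ℝ) (u : H1) : (shift z u).der = shiftL2 z u.der := rfl

theorem norm_shift (z : ℝ) (u : H1) : ‖shift z u‖ = ‖u‖ := by
  have h : ‖shift z u‖ ^ 2 = ‖u‖ ^ 2 := by
    rw [H1.norm_sq_eq, H1.norm_sq_eq, shift_val, shift_der, norm_shiftL2, norm_shiftL2]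
  exact (pow_left_inj₀ (norm_nonneg _) (norm_nonneg _) two_ne_zero).1 h

theorem rep_shift (z : ℝ) (u : H1) (x : ℝ) : (shift z u).rep x = u.rep (x + z) := by
  refine congrFun (H1.rep_eq_of_ae (g := fun x => u.rep (x + z))
    (u.continuous_rep.comp (continuous_id.add continuous_const)) ?_) x
  refine (shiftL2_ae z u.val).trans ?_
  exact (measurePreserving_add_right volume z).quasiMeasurePreserving.ae_eq u.val_ae_eq_rep

theorem shift_sub (z : ℝ) (u v : H1) : shift z (u - v) = shift z u - shift z v :=
  H1.ext_rep (funext fun x => by simp only [rep_shift, H1.rep_sub])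

theorem shift_shift (z y : ℝ) (u : H1) : shift z (shift y u) = shift (z + y) u :=
  H1.ext_rep (funext fun x => by simp only [rep_shift, add_assoc])

theorem shift_zero (u : H1) : shift 0 u = u :=
  H1.ext_rep (funext fun x => by simp only [rep_shift, add_zero])

theorem shift_neg_shift (z : ℝ) (u : H1) : shift (-z) (shift z u) = u := by
  rw [shift_shift, neg_add_cancel, shift_zero]

theorem shift_shift_neg (z : ℝ) (u : H1) : shift z (shift (-z) u) = u := by
  rw [shift_shift, add_neg_cancel, shift_zero]

/-! ### Stepanov bounded potentials as forms on `H¹` -/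

theorem setLIntegral_le_stepanovNorm (W : ℝ → ℝ) (a : ℝ) {δ : ℝ} (hδ : δ ≤ 1) :
    ∫⁻ x in Ioc a (a + δ), ‖W x‖ₑ ≤ stepanovNorm W := by
  refine le_trans ?_ (le_iSup (fun t : ℝ => ∫⁻ x in Icc t (t + 1), ‖W x‖ₑ) a)
  exact lintegral_mono_set fun x hx => ⟨hx.1.le, hx.2.trans (by linarith)⟩

/-- Tile the line by intervals of length `δ`. On each tile the mass of `W` is at most its Stepanov
norm, and `u²` is bounded by `H1.sq_rep_le`; the bounds add up to global `L²` norms. -/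
theorem lintegral_enorm_mul_rep_sq_le (W : ℝ → ℝ) (u : H1) {δ : ℝ} (hδ : 0 < δ) (hδ1 : δ ≤ 1)
    (hW : AEStronglyMeasurable W volume) :
    ∫⁻ x, ‖W x‖ₑ * ENNReal.ofReal (u.rep x ^ 2)
      ≤ stepanovNorm W * ENNReal.ofReal ((2 / δ) * ‖u.val‖ ^ 2 + 2 * δ * ‖u.der‖ ^ 2) := by
  set h : ℝ → ℝ := fun t => (2 / δ) * u.rep t ^ 2 + 2 * δ * u.der t ^ 2 with hh
  have h1 : Integrable (fun t => (2 / δ) * u.rep t ^ 2) volume := u.integrable_rep_sq.const_mul _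
  have h2 : Integrable (fun t => 2 * δ * u.der t ^ 2) volume :=
    (L2_integrable_sq u.der).const_mul _
  have hi : Integrable h volume := h1.add h2
  have h0 : ∀ t, 0 ≤ h t := fun t => by positivity
  have hU : (⋃ n : ℤ, Ioc (n • δ) ((n + 1) • δ)) = univ := iUnion_Ioc_zsmul hδ
  have hD : Pairwise (Function.onFun Disjoint fun n : ℤ => Ioc (n • δ) ((n + 1) • δ)) :=
    pairwise_disjoint_Ioc_zsmul δ
  have hstep : ∀ n : ℤ, ((n + 1) • δ : ℝ) = n • δ + δ := fun n => by rw [add_smul, one_smul]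
  have hM : ∀ n : ℤ, MeasurableSet (Ioc (n • δ) ((n + 1) • δ)) := fun n => measurableSet_Ioc
  rw [← setLIntegral_univ, ← hU, lintegral_iUnion hM hD]
  have key : ∀ n : ℤ, ∫⁻ x in Ioc (n • δ) ((n + 1) • δ), ‖W x‖ₑ * ENNReal.ofReal (u.rep x ^ 2)
      ≤ stepanovNorm W * ∫⁻ x in Ioc (n • δ) ((n + 1) • δ), ENNReal.ofReal (h x) := by
    intro n
    rw [hstep]
    set I := Ioc (n • δ : ℝ) (n • δ + δ)
    rw [← ofReal_integral_eq_lintegral_ofReal hi.integrableOn (Eventually.of_forall h0),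
      integral_add h1.integrableOn h2.integrableOn, integral_const_mul, integral_const_mul]
    calc ∫⁻ x in I, ‖W x‖ₑ * ENNReal.ofReal (u.rep x ^ 2)
        ≤ ∫⁻ x in I, ‖W x‖ₑ * ENNReal.ofReal ((2 / δ) * (∫ t in I, u.rep t ^ 2)
            + 2 * δ * ∫ t in I, u.der t ^ 2) := by
          refine setLIntegral_mono' measurableSet_Ioc fun x hx => ?_
          exact mul_le_mul_right (ENNReal.ofReal_le_ofReal (u.sq_rep_le _ hδ hx)) _
      _ = (∫⁻ x in I, ‖W x‖ₑ) * ENNReal.ofReal ((2 / δ) * (∫ t in I, u.rep t ^ 2)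
            + 2 * δ * ∫ t in I, u.der t ^ 2) := lintegral_mul_const'' _ hW.restrict.enorm
      _ ≤ _ := mul_le_mul_left (setLIntegral_le_stepanovNorm W _ hδ1) _
  refine (ENNReal.tsum_le_tsum key).trans ?_
  rw [ENNReal.tsum_mul_left, ← lintegral_iUnion hM hD, hU, setLIntegral_univ,
    ← ofReal_integral_eq_lintegral_ofReal hi (Eventually.of_forall h0), integral_add h1 h2,
    integral_const_mul, integral_const_mul, u.integral_rep_sq, ← L2_norm_sq_eq]

theorem integrable_mul_rep_sq {W : ℝ → ℝ} (hW : AEStronglyMeasurable W volume)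
    (hN : stepanovNorm W < ⊤) (u : H1) : Integrable (fun x => W x * u.rep x ^ 2) volume := by
  refine ⟨hW.mul (u.continuous_rep.pow 2).aestronglyMeasurable, ?_⟩
  refine lt_of_le_of_lt ?_ ((lintegral_enorm_mul_rep_sq_le W u one_pos le_rfl hW).trans_lt
    (ENNReal.mul_lt_top hN ENNReal.ofReal_lt_top))
  refine lintegral_mono fun x => ?_
  rw [enorm_mul, Real.enorm_of_nonneg (sq_nonneg (u.rep x))]

theorem integrable_mul_rep_mul_rep {W : ℝ → ℝ} (hW : AEStronglyMeasurable W volume)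
    (hN : stepanovNorm W < ⊤) (u v : H1) :
    Integrable (fun x => W x * u.rep x * v.rep x) volume := by
  have h := (((integrable_mul_rep_sq hW hN (u + v)).sub (integrable_mul_rep_sq hW hN u)).sub
    (integrable_mul_rep_sq hW hN v)).div_const 2
  refine h.congr (Eventually.of_forall fun x => ?_)
  simp only [Pi.sub_apply, H1.rep_add]
  ring

theorem integral_abs_mul_rep_sq_le {W : ℝ → ℝ} (hW : AEStronglyMeasurable W volume)
    (hN : stepanovNorm W < ⊤) (u : H1) {δ : ℝ} (hδ : 0 < δ) (hδ1 : δ ≤ 1) :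
    ∫ x, |W x| * u.rep x ^ 2
      ≤ (stepanovNorm W).toReal * ((2 / δ) * ‖u.val‖ ^ 2 + 2 * δ * ‖u.der‖ ^ 2) := by
  have hm : AEStronglyMeasurable (fun x => |W x| * u.rep x ^ 2) volume :=
    hW.norm.mul (u.continuous_rep.pow 2).aestronglyMeasurable
  rw [integral_eq_lintegral_of_nonneg_ae (Eventually.of_forall fun x => by positivity) hm]
  refine ENNReal.toReal_le_of_le_ofReal (by positivity) ?_
  rw [ENNReal.ofReal_mul ENNReal.toReal_nonneg, ENNReal.ofReal_toReal hN.ne]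
  refine le_trans (le_of_eq ?_) (lintegral_enorm_mul_rep_sq_le W u hδ hδ1 hW)
  refine lintegral_congr fun x => ?_
  rw [ENNReal.ofReal_mul (abs_nonneg _), ← Real.norm_eq_abs, ofReal_norm]

theorem stepanovNorm_abs (W : ℝ → ℝ) : stepanovNorm (fun x => |W x|) = stepanovNorm W := by
  unfold stepanovNorm
  simp only [← Real.norm_eq_abs, enorm_norm]

theorem integral_abs_mul_rep_sq_le' {W : ℝ → ℝ} (hW : AEStronglyMeasurable W volume)
    (hN : stepanovNorm W < ⊤) (u : H1) :
    ∫ x, |W x| * u.rep x ^ 2 ≤ 2 * (stepanovNorm W).toReal * ‖u‖ ^ 2 := by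
  refine (integral_abs_mul_rep_sq_le hW hN u one_pos le_rfl).trans (le_of_eq ?_)
  rw [u.norm_sq_eq]; ring

/-- Young's inequality for `|u| |v|`, with weights that give the two quadratic terms the same bound.
-/
theorem abs_integral_mul_rep_mul_rep_le {W : ℝ → ℝ} (hW : AEStronglyMeasurable W volume)
    (hN : stepanovNorm W < ⊤) (u v : H1) :
    |∫ x, W x * u.rep x * v.rep x| ≤ 2 * (stepanovNorm W).toReal * ‖u‖ * ‖v‖ := by
  set N := (stepanovNorm W).toReal
  have hN0 : 0 ≤ N := ENNReal.toReal_nonneg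
  rcases eq_or_ne u 0 with rfl | hu
  · simp [H1.rep_zero]
  rcases eq_or_ne v 0 with rfl | hv
  · simp [H1.rep_zero]
  have hu' : 0 < ‖u‖ := norm_pos_iff.2 hu
  have hv' : 0 < ‖v‖ := norm_pos_iff.2 hv
  have hWa : AEStronglyMeasurable (fun x => |W x|) volume := hW.norm
  have hNa : stepanovNorm (fun x => |W x|) < ⊤ := by rwa [stepanovNorm_abs]
  have iu : Integrable (fun x => (‖v‖ / ‖u‖ / 2) * (|W x| * u.rep x ^ 2)) volume :=
    (integrable_mul_rep_sq hWa hNa u).const_mul _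
  have iv : Integrable (fun x => (‖u‖ / ‖v‖ / 2) * (|W x| * v.rep x ^ 2)) volume :=
    (integrable_mul_rep_sq hWa hNa v).const_mul _
  have h1 : |∫ x, W x * u.rep x * v.rep x| ≤ ∫ x, ((‖v‖ / ‖u‖ / 2) * (|W x| * u.rep x ^ 2)
      + (‖u‖ / ‖v‖ / 2) * (|W x| * v.rep x ^ 2)) := by
    rw [← Real.norm_eq_abs]
    refine norm_integral_le_of_norm_le (iu.add iv) (Eventually.of_forall fun x => ?_)
    rw [Real.norm_eq_abs, abs_mul, abs_mul]
    have h2 : |u.rep x| * |v.rep x| ≤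
        (‖v‖ / ‖u‖ / 2) * u.rep x ^ 2 + (‖u‖ / ‖v‖ / 2) * v.rep x ^ 2 := by
      have e : (‖v‖ / ‖u‖ / 2) * u.rep x ^ 2 + (‖u‖ / ‖v‖ / 2) * v.rep x ^ 2 -
          |u.rep x| * |v.rep x| =
          (‖v‖ * |u.rep x| - ‖u‖ * |v.rep x|) ^ 2 / (2 * ‖u‖ * ‖v‖) := by
        rw [← sq_abs (u.rep x), ← sq_abs (v.rep x)]
        field_simp
        ring
      have : 0 ≤ (‖v‖ * |u.rep x| - ‖u‖ * |v.rep x|) ^ 2 / (2 * ‖u‖ * ‖v‖) := by positivity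
      linarith
    have h3 := mul_le_mul_of_nonneg_left h2 (abs_nonneg (W x))
    linarith
  refine h1.trans ?_
  rw [integral_add iu iv, integral_const_mul, integral_const_mul]
  have h4 := mul_le_mul_of_nonneg_left (integral_abs_mul_rep_sq_le' hW hN u)
    (show 0 ≤ ‖v‖ / ‖u‖ / 2 by positivity)
  have h5 := mul_le_mul_of_nonneg_left (integral_abs_mul_rep_sq_le' hW hN v)
    (show 0 ≤ ‖u‖ / ‖v‖ / 2 by positivity)
  refine (add_le_add h4 h5).trans (le_of_eq ?_)
  change _ * (2 * N * _) + _ * (2 * N * _) = _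
  field_simp
  ring

theorem StepanovBounded.aestronglyMeasurable {V : ℝ → ℝ} (hV : StepanovBounded V) :
    AEStronglyMeasurable V volume := hV.1.aestronglyMeasurable

theorem schrodingerForm_eq (V : ℝ → ℝ) (u v : H1) :
    schrodingerForm V u v = ⟪u.der, v.der⟫_ℝ + ∫ x, V x * u.rep x * v.rep x := by
  rw [schrodingerForm, L2_inner_eq]
  congr 1
  refine integral_congr_ae ?_
  filter_upwards [u.val_ae_eq_rep, v.val_ae_eq_rep] with x h1 h2
  rw [h1, h2]

theorem schrodingerForm_comm (V : ℝ → ℝ) (u v : H1) :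
    schrodingerForm V u v = schrodingerForm V v u := by
  rw [schrodingerForm_eq, schrodingerForm_eq, real_inner_comm]
  congr 1
  refine integral_congr_ae (Eventually.of_forall fun x => ?_)
  simp only
  ring

theorem StepanovBounded.schrodingerForm_add_left {V : ℝ → ℝ} (hV : StepanovBounded V)
    (u u' v : H1) :
    schrodingerForm V (u + u') v = schrodingerForm V u v + schrodingerForm V u' v := by
  have h1 := integrable_mul_rep_mul_rep hV.aestronglyMeasurable hV.2
  simp only [schrodingerForm_eq, H1.der_add, H1.rep_add, mul_add, add_mul, inner_add_left]
  rw [integral_add (h1 u v) (h1 u' v)]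
  ring

theorem StepanovBounded.schrodingerForm_smul_left {V : ℝ → ℝ}
    (r : ℝ) (u v : H1) : schrodingerForm V (r • u) v = r * schrodingerForm V u v := by
  simp only [schrodingerForm_eq, H1.der_smul, H1.rep_smul, inner_smul_left, mul_add]
  rw [← integral_const_mul]
  congr 1
  congr 1
  ext x
  ring

theorem StepanovBounded.abs_schrodingerForm_le {V : ℝ → ℝ} (hV : StepanovBounded V) (u v : H1) :
    |schrodingerForm V u v| ≤ (1 + 2 * (stepanovNorm V).toReal) * ‖u‖ * ‖v‖ := by
  rw [schrodingerForm_eq]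
  refine (abs_add_le _ _).trans ?_
  have h1 := abs_real_inner_le_norm u.der v.der
  have h2 := mul_le_mul u.norm_der_le v.norm_der_le (norm_nonneg _) (norm_nonneg _)
  have h3 := abs_integral_mul_rep_mul_rep_le hV.aestronglyMeasurable hV.2 u v
  linarith

/-- The form of the Schrödinger operator as a bounded bilinear form on `H¹`. -/
def StepanovBounded.form {V : ℝ → ℝ} (hV : StepanovBounded V) : H1 →L[ℝ] H1 →L[ℝ] ℝ :=
  LinearMap.mkContinuous₂
    (LinearMap.mk₂ ℝ (schrodingerForm V) hV.schrodingerForm_add_left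
      (fun r u v => StepanovBounded.schrodingerForm_smul_left r u v)
      (fun u v v' => by
        simp only [schrodingerForm_comm V u]
        exact hV.schrodingerForm_add_left v v' u)
      (fun r u v => by
        simp only [schrodingerForm_comm V u]
        exact StepanovBounded.schrodingerForm_smul_left r v u))
    (1 + 2 * (stepanovNorm V).toReal) fun u v => hV.abs_schrodingerForm_le u v

theorem StepanovBounded.form_apply {V : ℝ → ℝ} (hV : StepanovBounded V) (u v : H1) :
    hV.form u v = schrodingerForm V u v := rfl

theorem StepanovBounded.exists_garding {V : ℝ → ℝ} (hV : StepanovBounded V) :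
    ∃ K : ℝ, 0 < K ∧ ∀ u : H1, ‖u‖ ^ 2 / 2 ≤ schrodingerForm V u u + K * ‖u.val‖ ^ 2 := by
  set N := (stepanovNorm V).toReal with hN
  have hN0 : 0 ≤ N := ENNReal.toReal_nonneg
  -- With this tile length the potential term absorbs at most half of `‖u'‖²`, and the rest goes
  -- into the multiple of `‖u‖₂²`.
  set δ := 1 / (4 * N + 1)
  have hδ : 0 < δ := by positivity
  have hδ1 : δ ≤ 1 := by
    rw [div_le_one (by positivity)]; linarith
  have hδN : N * (2 * δ) ≤ 1 / 2 := by
    have : N * (2 * δ) = 2 * N / (4 * N + 1) := by simp only [δ]; ring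
    rw [this, div_le_iff₀ (by positivity)]; linarith
  refine ⟨N * (2 / δ) + 1, by positivity, fun u => ?_⟩
  have h1 := integral_abs_mul_rep_sq_le hV.aestronglyMeasurable hV.2 u hδ hδ1
  have h2 : |∫ x, V x * u.rep x * u.rep x| ≤ ∫ x, |V x| * u.rep x ^ 2 := by
    refine (abs_integral_le_integral_abs).trans (le_of_eq ?_)
    congr 1; ext x
    rw [mul_assoc, ← pow_two, abs_mul, abs_of_nonneg (sq_nonneg (u.rep x))]
  have h3 := (abs_le.1 (h2.trans h1)).1
  have h4 := mul_le_mul_of_nonneg_right hδN (sq_nonneg ‖u.der‖)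
  rw [schrodingerForm_eq, real_inner_self_eq_norm_sq, u.norm_sq_eq]
  nlinarith [sq_nonneg ‖u.val‖]

theorem schrodingerForm_sub_potential {V V' : ℝ → ℝ} (hV : StepanovBounded V)
    (hV' : StepanovBounded V') (hN : stepanovNorm (fun x => V x - V' x) < ⊤) (u v : H1) :
    |schrodingerForm V u v - schrodingerForm V' u v| ≤
      2 * (stepanovNorm fun x => V x - V' x).toReal * ‖u‖ * ‖v‖ := by
  refine le_trans (le_of_eq ?_) (abs_integral_mul_rep_mul_rep_le
    (hV.aestronglyMeasurable.sub hV'.aestronglyMeasurable) hN u v)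
  rw [schrodingerForm_eq, schrodingerForm_eq, add_sub_add_left_eq_sub, ← integral_sub
    (integrable_mul_rep_mul_rep hV.aestronglyMeasurable hV.2 u v)
    (integrable_mul_rep_mul_rep hV'.aestronglyMeasurable hV'.2 u v)]
  congr 2; ext x
  simp only [Pi.sub_apply]
  ring

/-! ### Shifted potentials -/

theorem setLIntegral_Icc_add_right (g : ℝ → ℝ≥0∞) (z t : ℝ) :
    ∫⁻ x in Icc t (t + 1), g (x + z) = ∫⁻ x in Icc (t + z) (t + z + 1), g x := by
  have h := (measurePreserving_add_right (volume : Measure ℝ) z).setLIntegral_comp_preimage_emb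
    (MeasurableEquiv.addRight z).measurableEmbedding g (Icc (t + z) (t + z + 1))
  rw [← h]
  congr 2
  ext x
  simp only [mem_Icc, mem_preimage]
  constructor <;> rintro ⟨h1, h2⟩ <;> constructor <;> linarith

theorem stepanovNorm_shift (W : ℝ → ℝ) (z : ℝ) :
    stepanovNorm (fun x => W (x + z)) = stepanovNorm W := by
  unfold stepanovNorm
  simp only [setLIntegral_Icc_add_right (fun x => ‖W x‖ₑ)]
  exact (Equiv.addRight z).iSup_comp (g := fun t : ℝ => ∫⁻ x in Icc t (t + 1), ‖W x‖ₑ)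

theorem StepanovBounded.shift {V : ℝ → ℝ} (hV : StepanovBounded V) (z : ℝ) :
    StepanovBounded fun x => V (x + z) := by
  refine ⟨?_, by rw [stepanovNorm_shift]; exact hV.2⟩
  rw [locallyIntegrable_iff]
  intro k hk
  have h2 := hV.1.integrableOn_isCompact (hk.image (continuous_id.add (continuous_const (y := z))))
  have h := (measurePreserving_add_right (volume : Measure ℝ) z).integrableOn_image
    (MeasurableEquiv.addRight z).measurableEmbedding (f := V) (s := k)
  exact h.1 h2

theorem schrodingerForm_shift (V : ℝ → ℝ) (z : ℝ) (u v : H1) :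
    schrodingerForm (fun x => V (x + z)) (shift z u) (shift z v) = schrodingerForm V u v := by
  rw [schrodingerForm_eq, schrodingerForm_eq, L2_inner_eq, L2_inner_eq]
  congr 1
  · rw [← integral_add_right_eq_self (fun x => u.der x * v.der x) z]
    refine integral_congr_ae ?_
    filter_upwards [shiftL2_ae z u.der, shiftL2_ae z v.der] with x h1 h2
    rw [shift_der, shift_der, h1, h2]
  · rw [← integral_add_right_eq_self (fun x => V x * u.rep x * v.rep x) z]
    simp only [rep_shift]

/-! ### Square roots and spectral splittings of symmetric operators on real Hilbert spaces -/

section Hilbert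

variable {H : Type*} [NormedAddCommGroup H] [InnerProductSpace ℝ H]

/-- Symmetry of a bounded operator on a real Hilbert space. -/
def SymmOp (T : H →L[ℝ] H) : Prop := ∀ u v, ⟪T u, v⟫_ℝ = ⟪u, T v⟫_ℝ

theorem SymmOp.norm_le {X : H →L[ℝ] H} (hX : SymmOp X) {q : ℝ} (hq : 0 ≤ q)
    (h : ∀ u, |⟪X u, u⟫_ℝ| ≤ q * ‖u‖ ^ 2) : ‖X‖ ≤ q := by
  rw [ContinuousLinearMap.norm_eq_iSup_rayleighQuotient (𝕜 := ℝ) X (fun u v => hX u v)]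
  refine ciSup_le fun u => ?_
  rw [ContinuousLinearMap.rayleighQuotient, abs_div, abs_sq]
  exact div_le_of_le_mul₀ (by positivity) hq (h u)

/-- Lax–Milgram in operator form. -/
theorem exists_inverse_of_coercive [CompleteSpace H] {D : H →L[ℝ] H} {β : ℝ} (hβ : 0 < β)
    (h : ∀ u, β * ‖u‖ ^ 2 ≤ ⟪D u, u⟫_ℝ) :
    ∃ D' : H →L[ℝ] H, D * D' = 1 ∧ D' * D = 1 := by
  have hc : IsCoercive ((innerSL ℝ : H →L[ℝ] H →L[ℝ] ℝ).comp D) :=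
    ⟨β, hβ, fun u => by
      have := h u
      simp only [ContinuousLinearMap.comp_apply, innerSL_apply_apply]
      linarith⟩
  have hD : ∀ u, hc.continuousLinearEquivOfBilin u = D u := fun u => by
    refine ext_inner_right ℝ fun v => ?_
    rw [hc.continuousLinearEquivOfBilin_apply]
    rfl
  refine ⟨hc.continuousLinearEquivOfBilin.symm, ?_, ?_⟩
  · ext u
    change D (hc.continuousLinearEquivOfBilin.symm u) = u
    rw [← hD, ContinuousLinearEquiv.apply_symm_apply]
  · ext u
    change hc.continuousLinearEquivOfBilin.symm (D u) = u
    rw [← hD, ContinuousLinearEquiv.symm_apply_apply]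

/-- The equation says `(1 - Y)² = 1 - X`. The map `Y ↦ (X + Y²) / 2` is a contraction with constant
`q` on the ball of radius `q`. Symmetry and commutation with the commutant of `X` are closed
invariant conditions, so the fixed point inherits them. -/
theorem exists_half_sq_fixedPoint [CompleteSpace H] {X : H →L[ℝ] H} (hX : SymmOp X) {q : ℝ}
    (hq0 : 0 ≤ q) (hq1 : q < 1) (hXq : ‖X‖ ≤ q) :
    ∃ Y : H →L[ℝ] H, ‖Y‖ ≤ q ∧ SymmOp Y ∧ (∀ T, X * T = T * X → Y * T = T * Y) ∧
      (2 : ℝ) • Y = X + Y * Y := by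
  set Φ : (H →L[ℝ] H) → (H →L[ℝ] H) := fun Y => (2⁻¹ : ℝ) • (X + Y * Y) with hΦ
  set s : Set (H →L[ℝ] H) :=
    {Y | ‖Y‖ ≤ q ∧ SymmOp Y ∧ ∀ T, X * T = T * X → Y * T = T * Y} with hs
  have hcl : IsClosed s := by
    have : s = {Y | ‖Y‖ ≤ q} ∩ ((⋂ (u : H) (v : H), {Y | ⟪Y u, v⟫_ℝ = ⟪u, Y v⟫_ℝ}) ∩
        ⋂ (T : H →L[ℝ] H) (_ : X * T = T * X), {Y | Y * T = T * Y}) := by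
      ext Y
      simp only [hs, SymmOp, mem_inter_iff, mem_iInter, mem_ofPred_eq]
    rw [this]
    refine (isClosed_le continuous_norm continuous_const).inter ((isClosed_iInter fun u =>
      isClosed_iInter fun v => ?_).inter (isClosed_iInter fun T => isClosed_iInter fun _ => ?_))
    · have e : ∀ w : H, Continuous fun Y : H →L[ℝ] H => Y w := fun w =>
        (ContinuousLinearMap.apply ℝ H w).continuous
      exact isClosed_eq ((e u).inner continuous_const) (continuous_const.inner (e v))
    · exact isClosed_eq (continuous_id.mul continuous_const) (continuous_const.mul continuous_id)
  have hmaps : MapsTo Φ s s := by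
    rintro Y ⟨h1, h2, h3⟩
    refine ⟨?_, ?_, ?_⟩
    · have hYY : ‖Y * Y‖ ≤ q * 1 :=
        (norm_mul_le Y Y).trans (mul_le_mul h1 (h1.trans hq1.le) (norm_nonneg _) hq0)
      rw [hΦ, norm_smul]
      have := norm_add_le X (Y * Y)
      rw [Real.norm_of_nonneg (by norm_num)]
      linarith
    · intro u v
      simp only [hΦ, smul_apply, add_apply,
        mul_apply_eq_comp, inner_smul_left, inner_smul_right, inner_add_left,
        inner_add_right, hX u v, h2 (Y u) v, h2 u (Y v)]
      simp
    · intro T hT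
      simp only [hΦ, smul_mul_assoc, mul_smul_comm, add_mul, mul_add]
      rw [hT, mul_assoc, h3 T hT, ← mul_assoc, h3 T hT, mul_assoc]
  have hcontr : ContractingWith ⟨q, hq0⟩ (hmaps.restrict Φ s s) := by
    refine ⟨by exact_mod_cast hq1, LipschitzWith.of_dist_le_mul ?_⟩
    rintro ⟨Y, hY⟩ ⟨Z, hZ⟩
    rw [Subtype.dist_eq, Subtype.dist_eq, dist_eq_norm, dist_eq_norm]
    change ‖(2⁻¹ : ℝ) • (X + Y * Y) - (2⁻¹ : ℝ) • (X + Z * Z)‖ ≤ q * ‖Y - Z‖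
    have e : (2⁻¹ : ℝ) • (X + Y * Y) - (2⁻¹ : ℝ) • (X + Z * Z) =
        (2⁻¹ : ℝ) • (Y * (Y - Z) + (Y - Z) * Z) := by
      rw [← smul_sub]; congr 1; noncomm_ring
    rw [e, norm_smul, Real.norm_of_nonneg (by norm_num)]
    have h1 : ‖Y * (Y - Z)‖ ≤ q * ‖Y - Z‖ :=
      (norm_mul_le _ _).trans (mul_le_mul_of_nonneg_right hY.1 (norm_nonneg _))
    have h2 : ‖(Y - Z) * Z‖ ≤ ‖Y - Z‖ * q :=
      (norm_mul_le _ _).trans (mul_le_mul_of_nonneg_left hZ.1 (norm_nonneg _))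
    have h3 := norm_add_le (Y * (Y - Z)) ((Y - Z) * Z)
    linarith
  have h0 : (0 : H →L[ℝ] H) ∈ s := ⟨by simpa using hq0, fun u v => by simp, fun T _ => by simp⟩
  obtain ⟨Y, hYs, hfix, -⟩ := hcontr.exists_fixedPoint' hcl.isComplete hmaps h0 (edist_ne_top _ _)
  refine ⟨Y, hYs.1, hYs.2.1, hYs.2.2, ?_⟩
  have h4 : (2⁻¹ : ℝ) • (X + Y * Y) = Y := hfix
  nth_rewrite 1 [← h4]
  rw [smul_smul]; norm_num

/-- For `M` large, `C = M (1 - X)` with `‖X‖ < 1`, and the root is `√M (1 - Y)` with `(1 - Y)² = 1 -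
X`. It is coercive because `‖Y‖ < 1`. -/
theorem exists_sqrt_of_coercive [CompleteSpace H] {C : H →L[ℝ] H} (hC : SymmOp C) {α : ℝ}
    (hα : 0 < α) (h : ∀ u, α * ‖u‖ ^ 2 ≤ ⟪C u, u⟫_ℝ) :
    ∃ R : H →L[ℝ] H, SymmOp R ∧ (∃ β > 0, ∀ u, β * ‖u‖ ^ 2 ≤ ⟪R u, u⟫_ℝ) ∧ R * R = C ∧
      ∀ T, C * T = T * C → R * T = T * R := by
  set M := ‖C‖ + α with hM
  have hM0 : 0 < M := by positivity
  have hCM : ∀ u, ⟪C u, u⟫_ℝ ≤ M * ‖u‖ ^ 2 := fun u => by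
    have h1 := real_inner_le_norm (C u) u
    have h2 := mul_le_mul_of_nonneg_right (C.le_opNorm u) (norm_nonneg u)
    nlinarith [sq_nonneg ‖u‖]
  set X : H →L[ℝ] H := 1 - M⁻¹ • C with hXdef
  have hX : SymmOp X := fun u v => by
    simp only [hXdef, sub_apply, smul_apply,
      one_apply_eq_self, inner_sub_left, inner_sub_right, inner_smul_left,
      inner_smul_right, hC u v]
    simp
  set q := 1 - α / M with hq
  have hαM : α / M ≤ 1 := by
    rw [div_le_one hM0, hM]; linarith [norm_nonneg C]
  have hq0 : 0 ≤ q := by linarith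
  have hq1 : q < 1 := by
    have : 0 < α / M := by positivity
    linarith
  have hXq : ‖X‖ ≤ q := by
    refine hX.norm_le hq0 fun u => ?_
    have e : ⟪X u, u⟫_ℝ = ‖u‖ ^ 2 - M⁻¹ * ⟪C u, u⟫_ℝ := by
      simp only [hXdef, sub_apply, smul_apply,
        one_apply_eq_self, inner_sub_left, inner_smul_left,
        real_inner_self_eq_norm_sq]
      simp
    have h1 := mul_le_mul_of_nonneg_left (hCM u) (inv_nonneg.2 hM0.le)
    have h2 := mul_le_mul_of_nonneg_left (h u) (inv_nonneg.2 hM0.le)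
    rw [← mul_assoc, inv_mul_cancel₀ hM0.ne', one_mul] at h1
    rw [← mul_assoc, inv_mul_eq_div] at h2
    rw [e, abs_of_nonneg (by linarith), hq]
    linarith
  obtain ⟨Y, hY1, hY2, hY3, hY4⟩ := exists_half_sq_fixedPoint hX hq0 hq1 hXq
  have hsq : 0 < Real.sqrt M := Real.sqrt_pos.2 hM0
  refine ⟨Real.sqrt M • (1 - Y), ?_, ⟨Real.sqrt M * (1 - q), by
    exact mul_pos hsq (by linarith), fun u => ?_⟩, ?_, ?_⟩
  · intro u v
    simp only [sub_apply, smul_apply,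
      one_apply_eq_self, inner_sub_left, inner_sub_right, inner_smul_left,
      inner_smul_right, hY2 u v]
    simp
  · have e : ⟪(Real.sqrt M • (1 - Y)) u, u⟫_ℝ = Real.sqrt M * (‖u‖ ^ 2 - ⟪Y u, u⟫_ℝ) := by
      simp only [sub_apply, smul_apply,
        one_apply_eq_self, inner_sub_left, inner_smul_left,
        real_inner_self_eq_norm_sq]
      simp
    rw [e, mul_assoc]
    refine mul_le_mul_of_nonneg_left ?_ hsq.le
    have h1 := real_inner_le_norm (Y u) u
    have h2 := mul_le_mul_of_nonneg_right (Y.le_opNorm u) (norm_nonneg u)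
    have h3 := mul_le_mul_of_nonneg_right hY1 (sq_nonneg ‖u‖)
    nlinarith
  · rw [smul_mul_smul_comm, Real.mul_self_sqrt hM0.le]
    have e : (1 - Y) * (1 - Y) = 1 - X := by
      have : (1 - Y) * (1 - Y) = 1 - (2 : ℝ) • Y + Y * Y := by
        rw [two_smul]; noncomm_ring
      rw [this, hY4]; abel
    rw [e, hXdef, sub_sub_cancel, smul_smul, mul_inv_cancel₀ hM0.ne', one_smul]
  · intro T hT
    have hXT : X * T = T * X := by
      simp only [hXdef, sub_mul, mul_sub, one_mul, mul_one, smul_mul_assoc, mul_smul_comm, hT]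
    simp only [smul_mul_assoc, mul_smul_comm, sub_mul, mul_sub, one_mul, mul_one, hY3 T hXT]

theorem SymmOp.inverse {D D' : H →L[ℝ] H} (hD : SymmOp D) (h1 : D * D' = 1) : SymmOp D' := by
  have e : ∀ w, D (D' w) = w := fun w => congrArg (fun L : H →L[ℝ] H => L w) h1
  intro u v
  calc ⟪D' u, v⟫_ℝ = ⟪D' u, D (D' v)⟫_ℝ := by rw [e]
    _ = ⟪D (D' u), D' v⟫_ℝ := (hD _ _).symm
    _ = ⟪u, D' v⟫_ℝ := by rw [e]

/-- Take `R = √(T²)`, the modulus of `T`. It is invertible and commutes with `T`, and the subspaces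
are the kernels of `R - T` and `R + T`. The components of `u` are `R⁻¹(Ru ± Tu) / 2`, and the signs
come from `T = ±R` there. -/
theorem exists_symm_splitting [CompleteSpace H] {T : H →L[ℝ] H} (hT : SymmOp T) {a : ℝ}
    (ha : 0 < a) (hTa : ∀ u, a * ‖u‖ ≤ ‖T u‖) :
    ∃ Ep Em : Submodule ℝ H, IsClosed (Ep : Set H) ∧ IsClosed (Em : Set H) ∧ IsCompl Ep Em ∧
      (∀ u ∈ Ep, ∀ v ∈ Em, ⟪u, v⟫_ℝ = 0 ∧ ⟪T u, v⟫_ℝ = 0) ∧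
      (∀ u ∈ Ep, u ≠ 0 → 0 < ⟪T u, u⟫_ℝ) ∧ ∀ u ∈ Em, u ≠ 0 → ⟪T u, u⟫_ℝ < 0 := by
  have hTT : SymmOp (T * T) := fun u v => by
    simp only [mul_apply_eq_comp, hT (T u) v, hT u (T v)]
  obtain ⟨R, hR, ⟨β, hβ, hRβ⟩, hRR, hcomm⟩ := exists_sqrt_of_coercive hTT (pow_pos ha 2)
    fun u => by
      rw [mul_apply_eq_comp, hT (T u) u, real_inner_self_eq_norm_sq, ← mul_pow]
      exact pow_le_pow_left₀ (by positivity) (hTa u) 2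
  obtain ⟨R', hRR', hR'R⟩ := exists_inverse_of_coercive hβ hRβ
  have hRT : R * T = T * R := hcomm T (by rw [mul_assoc])
  have hR'T : R' * T = T * R' := by
    calc R' * T = R' * (T * (R * R')) := by rw [hRR', mul_one]
      _ = R' * (R * T) * R' := by rw [hRT]; noncomm_ring
      _ = (R' * R) * (T * R') := by noncomm_ring
      _ = T * R' := by rw [hR'R, one_mul]
  have app : ∀ {P Q : H →L[ℝ] H}, P = Q → ∀ w, P w = Q w := fun h w => by rw [h]
  have e1 : ∀ w, R (R' w) = w := app hRR'
  have e2 : ∀ w, R' (R w) = w := app hR'R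
  have e3 : ∀ w, R (T w) = T (R w) := app hRT
  have e4 : ∀ w, R' (T w) = T (R' w) := app hR'T
  have e5 : ∀ w, R (R w) = T (T w) := app hRR
  have pos : ∀ u, u ≠ 0 → 0 < ⟪R u, u⟫_ℝ := fun u hu =>
    lt_of_lt_of_le (mul_pos hβ (pow_pos (norm_pos_iff.2 hu) 2)) (hRβ u)
  have memP : ∀ u, u ∈ (R - T).ker ↔ R u = T u := fun u => by
    rw [LinearMap.mem_ker]
    exact sub_eq_zero
  have memM : ∀ u, u ∈ (R + T).ker ↔ R u = -T u := fun u => by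
    rw [LinearMap.mem_ker]
    exact add_eq_zero_iff_eq_neg
  have orth : ∀ u v, R u = T u → R v = -T v → ⟪R u, v⟫_ℝ = 0 := fun u v hu hv => by
    have h1 : ⟪R u, v⟫_ℝ = -⟪R u, v⟫_ℝ := by
      calc ⟪R u, v⟫_ℝ = ⟪T u, v⟫_ℝ := by rw [hu]
        _ = ⟪u, T v⟫_ℝ := hT u v
        _ = -⟪u, R v⟫_ℝ := by rw [hv, inner_neg_right, neg_neg]
        _ = -⟪R u, v⟫_ℝ := by rw [hR u v]
    linarith
  have orth' : ∀ u v, R u = T u → R v = -T v → ⟪u, v⟫_ℝ = 0 := fun u v hu hv => by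
    have h1 : R (R' u) = T (R' u) := by
      rw [← e4, ← hu, e2, e1]
    have h2 := orth (R' u) v h1 hv
    rwa [e1] at h2
  refine ⟨(R - T).ker, (R + T).ker, (R - T).isClosed_ker, (R + T).isClosed_ker, ?_, ?_, ?_, ?_⟩
  · refine IsCompl.of_eq ?_ ?_
    · rw [Submodule.eq_bot_iff]
      rintro u ⟨h1, h2⟩
      exact inner_self_eq_zero.1 (orth' u u ((memP u).1 h1) ((memM u).1 h2))
    · rw [eq_top_iff]
      intro u _
      have e6 : T (R' (T u)) = R u := by rw [← e4, ← e5, e2]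
      rw [Submodule.mem_sup]
      refine ⟨(2⁻¹ : ℝ) • R' (R u + T u), ?_, (2⁻¹ : ℝ) • R' (R u - T u), ?_, ?_⟩
      · rw [memP]
        simp only [map_smul, map_add, e1, e2, e6, add_comm]
      · rw [memM]
        simp only [map_smul, map_sub, e1, e2, e6, ← smul_neg, neg_sub]
      · rw [← smul_add, ← map_add]
        have : R u + T u + (R u - T u) = (2 : ℝ) • R u := by rw [two_smul]; abel
        rw [this, map_smul, e2, smul_smul]
        norm_num
  · intro u hu v hv
    rw [memP] at hu
    rw [memM] at hv
    exact ⟨orth' u v hu hv, by rw [← hu]; exact orth u v hu hv⟩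
  · intro u hu hu0
    rw [← (memP u).1 hu]
    exact pos u hu0
  · intro u hu hu0
    have h1 := pos u hu0
    rw [(memM u).1 hu, inner_neg_left] at h1
    linarith

/-- Simultaneous splitting of two forms. With `D = √(A + lS)`, the form of `A` becomes that of `T =
D⁻¹AD⁻¹` in the variable `Du`; the splitting of `T` is pulled back by `D`. Its pieces are orthogonal
for `A + lS` and for `A`, hence for `S` because `l ≠ 0`. -/
theorem exists_pencil_splitting [CompleteSpace H] {A S : H →L[ℝ] H} (hA : SymmOp A)
    (hS : SymmOp S) {l α a : ℝ} (hl : l ≠ 0) (hα : 0 < α) (ha : 0 < a)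
    (hC : ∀ u, α * ‖u‖ ^ 2 ≤ ⟪A u, u⟫_ℝ + l * ⟪S u, u⟫_ℝ) (hAa : ∀ u, a * ‖u‖ ≤ ‖A u‖) :
    ∃ Ep Em : Submodule ℝ H, IsClosed (Ep : Set H) ∧ IsClosed (Em : Set H) ∧ IsCompl Ep Em ∧
      (∀ u ∈ Ep, ∀ v ∈ Em, ⟪S u, v⟫_ℝ = 0 ∧ ⟪A u, v⟫_ℝ = 0) ∧
      (∀ u ∈ Ep, u ≠ 0 → 0 < ⟪A u, u⟫_ℝ) ∧ ∀ u ∈ Em, u ≠ 0 → ⟪A u, u⟫_ℝ < 0 := by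
  have hCs : SymmOp (A + l • S) := fun u v => by
    simp only [add_apply, smul_apply, inner_add_left,
      inner_add_right, inner_smul_left, inner_smul_right, hA u v, hS u v]
    simp
  have hCi : ∀ u v, ⟪(A + l • S) u, v⟫_ℝ = ⟪A u, v⟫_ℝ + l * ⟪S u, v⟫_ℝ := fun u v => by
    simp only [add_apply, smul_apply, inner_add_left,
      inner_smul_left]
    simp
  obtain ⟨D, hD, ⟨β, hβ, hDβ⟩, hDD, -⟩ := exists_sqrt_of_coercive hCs hα
    fun u => by rw [hCi]; exact hC u
  obtain ⟨D', hDD', hD'D⟩ := exists_inverse_of_coercive hβ hDβ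
  have hD' := hD.inverse hDD'
  have e1 : ∀ w, D (D' w) = w := fun w => congrArg (fun L : H →L[ℝ] H => L w) hDD'
  have e2 : ∀ w, D' (D w) = w := fun w => congrArg (fun L : H →L[ℝ] H => L w) hD'D
  have e3 : ∀ w, D (D w) = (A + l • S) w := fun w => congrArg (fun L : H →L[ℝ] H => L w) hDD
  have hT : SymmOp (D' * (A * D')) := fun u v => by
    simp only [mul_apply_eq_comp]
    rw [hD', hA, hD']
  have hK : 0 < ‖D‖ + 1 := by positivity
  have hDle : ∀ w, ‖D w‖ ≤ (‖D‖ + 1) * ‖w‖ := fun w =>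
    (D.le_opNorm w).trans (mul_le_mul_of_nonneg_right (by linarith) (norm_nonneg _))
  obtain ⟨Fp, Fm, hp, hm, hc, ho, hpos, hneg⟩ := exists_symm_splitting hT
    (a := a / ((‖D‖ + 1) * (‖D‖ + 1))) (by positivity) fun u => by
      simp only [mul_apply_eq_comp]
      have h1 := hDle (D' (A (D' u)))
      rw [e1] at h1
      have h2 := hAa (D' u)
      have h3 := hDle (D' u)
      rw [e1] at h3
      rw [div_mul_eq_mul_div, div_le_iff₀ (by positivity)]
      calc a * ‖u‖ ≤ a * ((‖D‖ + 1) * ‖D' u‖) := mul_le_mul_of_nonneg_left h3 ha.le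
        _ = (‖D‖ + 1) * (a * ‖D' u‖) := by ring
        _ ≤ (‖D‖ + 1) * ((‖D‖ + 1) * ‖D' (A (D' u))‖) :=
            mul_le_mul_of_nonneg_left (h2.trans h1) hK.le
        _ = _ := by ring
  have hTD : ∀ u v, ⟪(D' * (A * D')) (D u), D v⟫_ℝ = ⟪A u, v⟫_ℝ := fun u v => by
    simp only [mul_apply_eq_comp]
    rw [e2, hD', e2]
  have hne : ∀ u, u ≠ 0 → D u ≠ 0 := fun u hu h => hu (by rw [← e2 u, h, map_zero])
  refine ⟨Fp.comap (D : H →ₗ[ℝ] H), Fm.comap (D : H →ₗ[ℝ] H), hp.preimage D.continuous,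
    hm.preimage D.continuous, IsCompl.of_eq ?_ ?_, ?_, ?_, ?_⟩
  · rw [Submodule.eq_bot_iff]
    rintro u ⟨h1, h2⟩
    have h3 : D u ∈ Fp ⊓ Fm := ⟨h1, h2⟩
    rw [hc.inf_eq_bot, Submodule.mem_bot] at h3
    rw [← e2 u, h3, map_zero]
  · rw [eq_top_iff]
    intro u _
    have h1 : D u ∈ Fp ⊔ Fm := by rw [hc.sup_eq_top]; trivial
    obtain ⟨y, hy, z, hz, hyz⟩ := Submodule.mem_sup.1 h1
    rw [Submodule.mem_sup]
    refine ⟨D' y, ?_, D' z, ?_, ?_⟩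
    · change D (D' y) ∈ Fp
      rwa [e1]
    · change D (D' z) ∈ Fm
      rwa [e1]
    · rw [← map_add, hyz, e2]
  · intro u hu v hv
    have h1 := ho (D u) hu (D v) hv
    rw [hTD, hD, e3, ← hCs, hCi] at h1
    refine ⟨?_, h1.2⟩
    rw [h1.2, zero_add] at h1
    exact (mul_eq_zero.1 h1.1).resolve_left hl
  · intro u hu hu0
    rw [← hTD]
    exact hpos (D u) hu (hne u hu0)
  · intro u hu hu0
    rw [← hTD]
    exact hneg (D u) hu (hne u hu0)

theorem SymmOp.sq_inner_le {A : H →L[ℝ] H} (hA : SymmOp A) {E : Submodule ℝ H}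
    (h : ∀ u ∈ E, 0 ≤ ⟪A u, u⟫_ℝ) {u w : H} (hu : u ∈ E) (hw : w ∈ E) :
    ⟪A u, w⟫_ℝ ^ 2 ≤ ⟪A u, u⟫_ℝ * ⟪A w, w⟫_ℝ := by
  have h1 : ∀ t : ℝ, 0 ≤ ⟪A w, w⟫_ℝ * (t * t) + (2 * ⟪A u, w⟫_ℝ) * t + ⟪A u, u⟫_ℝ := fun t => by
    have h2 := h (u + t • w) (E.add_mem hu (E.smul_mem t hw))
    simp only [map_add, map_smul, inner_add_left, inner_add_right, inner_smul_left,
      inner_smul_right, RCLike.conj_to_real] at h2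
    have h3 : ⟪A w, u⟫_ℝ = ⟪A u, w⟫_ℝ := by rw [hA w u, real_inner_comm]
    rw [h3] at h2
    linarith
  have h2 := discrim_le_zero h1
  rw [discrim] at h2
  linarith

/-- Semidefiniteness improves to coercivity because `A` is bounded below. Let `w` be the `Ep`
component of `Au`. Form orthogonality gives `⟪Au, w⟫ = ‖Au‖²`, and Cauchy–Schwarz for the form gives
`‖Au‖⁴ ≤ ⟪Au, u⟫ ⟪Aw, w⟫ ≤ K ⟪Au, u⟫ ‖Au‖²`. -/
theorem SymmOp.exists_coercive [CompleteSpace H] {A : H →L[ℝ] H} (hA : SymmOp A) {a : ℝ}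
    (ha : 0 < a) (hAa : ∀ u, a * ‖u‖ ≤ ‖A u‖) {Ep Em : Submodule ℝ H}
    (hp : IsClosed (Ep : Set H)) (hm : IsClosed (Em : Set H)) (hc : IsCompl Ep Em)
    (ho : ∀ u ∈ Ep, ∀ v ∈ Em, ⟪A u, v⟫_ℝ = 0) (hpos : ∀ u ∈ Ep, 0 ≤ ⟪A u, u⟫_ℝ) :
    ∃ α > 0, ∀ u ∈ Ep, α * ‖u‖ ^ 2 ≤ ⟪A u, u⟫_ℝ := by
  have ht : Submodule.IsTopCompl Ep Em := Submodule.IsCompl.isTopCompl_of_isClosed hc hp hm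
  set P := Submodule.projectionL Ep Em ht
  set K := ‖A‖ * ‖P‖ ^ 2 + 1
  have hK : 0 < K := by positivity
  refine ⟨a ^ 2 / K, by positivity, fun u hu => ?_⟩
  have hw1 : P (A u) ∈ Ep := Submodule.projectionL_apply_mem ht _
  have hw2 : A u - P (A u) ∈ Em := by
    rw [← Submodule.projectionL_eq_self_sub_projectionL ht]
    exact Submodule.projectionL_apply_mem ht.symm _
  have h1 : ⟪A u, P (A u)⟫_ℝ = ‖A u‖ ^ 2 := by
    have := ho u hu _ hw2
    rw [inner_sub_right, real_inner_self_eq_norm_sq] at this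
    linarith
  have h2 := hA.sq_inner_le hpos hu hw1
  have h3 : ⟪A (P (A u)), P (A u)⟫_ℝ ≤ K * ‖A u‖ ^ 2 := by
    refine (real_inner_le_norm _ _).trans ?_
    have h4 := A.le_opNorm (P (A u))
    have h5 := P.le_opNorm (A u)
    calc ‖A (P (A u))‖ * ‖P (A u)‖ ≤ ‖A‖ * ‖P (A u)‖ * ‖P (A u)‖ :=
          mul_le_mul_of_nonneg_right h4 (norm_nonneg _)
      _ = ‖A‖ * ‖P (A u)‖ ^ 2 := by ring
      _ ≤ ‖A‖ * (‖P‖ * ‖A u‖) ^ 2 :=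
          mul_le_mul_of_nonneg_left (pow_le_pow_left₀ (norm_nonneg _) h5 2) (norm_nonneg _)
      _ ≤ K * ‖A u‖ ^ 2 := by
          simp only [K]; nlinarith [sq_nonneg ‖A u‖]
  rcases eq_or_ne u 0 with rfl | hu0
  · simp
  have hAu : 0 < ‖A u‖ := lt_of_lt_of_le (mul_pos ha (norm_pos_iff.2 hu0)) (hAa u)
  have h6 : ‖A u‖ ^ 2 * ‖A u‖ ^ 2 ≤ (K * ⟪A u, u⟫_ℝ) * ‖A u‖ ^ 2 := by
    rw [h1] at h2
    have := mul_le_mul_of_nonneg_left h3 (hpos u hu)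
    nlinarith
  have h7 := le_of_mul_le_mul_right h6 (by positivity)
  have h8 : (a * ‖u‖) ^ 2 ≤ ‖A u‖ ^ 2 := pow_le_pow_left₀ (by positivity) (hAa u) 2
  rw [div_mul_eq_mul_div, div_le_iff₀ hK]
  nlinarith

end Hilbert

/-! ### The spectral splitting of `H¹` -/

/-- The operator on `H¹` which represents the form of the Schrödinger operator. -/
def StepanovBounded.op {V : ℝ → ℝ} (hV : StepanovBounded V) : H1 →L[ℝ] H1 :=
  InnerProductSpace.continuousLinearMapOfBilin hV.form

theorem StepanovBounded.inner_op {V : ℝ → ℝ} (hV : StepanovBounded V) (u v : H1) :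
    ⟪hV.op u, v⟫_ℝ = schrodingerForm V u v :=
  InnerProductSpace.continuousLinearMapOfBilin_apply hV.form u v

theorem StepanovBounded.symmOp_op {V : ℝ → ℝ} (hV : StepanovBounded V) : SymmOp hV.op :=
  fun u v => by
    rw [hV.inner_op, schrodingerForm_comm, ← hV.inner_op, real_inner_comm]

/-- The operator on `H¹` which represents the inner product of `L²`. -/
def massOp : H1 →L[ℝ] H1 := (ContinuousLinearMap.adjoint H1.valL).comp H1.valL

theorem inner_massOp (u v : H1) : ⟪massOp u, v⟫_ℝ = ⟪u.val, v.val⟫_ℝ := by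
  rw [massOp, ContinuousLinearMap.comp_apply, ContinuousLinearMap.adjoint_inner_left]
  rfl

theorem symmOp_massOp : SymmOp massOp := fun u v => by
  rw [inner_massOp, real_inner_comm, ← inner_massOp, real_inner_comm]

/-- The resolvent condition only solves equations with right-hand side in `L²`, whereas here a
general functional on `H¹` is prescribed. It is first solved for the coercive operator shifted by
`K`; the error is then an `L²` function, which the resolvent at `0` removes. -/
theorem StepanovBounded.op_bijective {V : ℝ → ℝ} (hV : StepanovBounded V)
    (h0 : (0 : ℝ) ∉ schrodingerSpectrum V) : Function.Bijective hV.op := by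
  have hres : (0 : ℝ) ∈ schrodingerResolventSet V := not_notMem.1 h0
  constructor
  · rw [injective_iff_map_eq_zero]
    intro u hu
    refine (hres.1 0).unique (y₁ := u) (y₂ := 0) ?_ ?_
    · intro v
      rw [← hV.inner_op, hu]
      simp
    · intro v
      rw [← hV.inner_op, map_zero]
      simp
  · intro h
    obtain ⟨K, hK, hG⟩ := hV.exists_garding
    obtain ⟨D', hD, -⟩ := exists_inverse_of_coercive (D := hV.op + K • massOp)
      (β := 1 / 2) (by norm_num) fun u => by
        have := hG u
        rw [add_apply, smul_apply, inner_add_left, inner_smul_left, hV.inner_op, inner_massOp,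
          real_inner_self_eq_norm_sq, RCLike.conj_to_real]
        linarith
    have h1 : (hV.op + K • massOp) (D' h) = h := congrArg (fun L : H1 →L[ℝ] H1 => L h) hD
    obtain ⟨u, hu, -⟩ := hres.1 (K • (D' h).val)
    refine ⟨D' h + u, ext_inner_right ℝ fun v => ?_⟩
    have h2 : schrodingerForm V u v = K * ⟪(D' h).val, v.val⟫_ℝ := by
      rw [hu v, zero_smul, zero_add, inner_smul_left, RCLike.conj_to_real]
    nth_rewrite 2 [← h1]
    rw [map_add, inner_add_left, hV.inner_op u v, h2, add_apply, smul_apply, inner_add_left,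
      inner_smul_left, inner_massOp, RCLike.conj_to_real]

theorem StepanovBounded.exists_norm_op_ge {V : ℝ → ℝ} (hV : StepanovBounded V)
    (h0 : (0 : ℝ) ∉ schrodingerSpectrum V) : ∃ a > 0, ∀ u, a * ‖u‖ ≤ ‖hV.op u‖ := by
  have hb := hV.op_bijective h0
  set e : H1 ≃L[ℝ] H1 := ContinuousLinearEquiv.ofBijective hV.op
    (LinearMap.ker_eq_bot.2 hb.1) (LinearMap.range_eq_top.2 hb.2)
  refine ⟨1 / (‖(e.symm : H1 →L[ℝ] H1)‖ + 1), by positivity, fun u => ?_⟩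
  have h1 := (e.symm : H1 →L[ℝ] H1).le_opNorm (hV.op u)
  have h2 : (e.symm : H1 →L[ℝ] H1) (hV.op u) = u := e.symm_apply_apply u
  rw [h2] at h1
  rw [one_div_mul_eq_div, div_le_iff₀ (by positivity)]
  nlinarith [norm_nonneg (hV.op u)]

/-- The pair is chosen by `Classical.epsilon`, so existence suffices. The pencil consists of the
Schrödinger form and the `L²` inner product, and Gårding's inequality makes their combination
coercive. -/
theorem StepanovBounded.isSpectralSplitting {V : ℝ → ℝ} (hV : StepanovBounded V)
    (h0 : (0 : ℝ) ∉ schrodingerSpectrum V) :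
    IsSpectralSplitting V (spectralSplitting V).1 (spectralSplitting V).2 := by
  obtain ⟨a, ha, hAa⟩ := hV.exists_norm_op_ge h0
  obtain ⟨K, hK, hG⟩ := hV.exists_garding
  obtain ⟨Ep, Em, h1, h2, h3, h4, h5, h6⟩ := exists_pencil_splitting hV.symmOp_op symmOp_massOp
    hK.ne' (α := 1 / 2) (by norm_num) ha (fun u => by
      have := hG u
      rw [hV.inner_op, inner_massOp, real_inner_self_eq_norm_sq]
      linarith) hAa
  simp only [inner_massOp, hV.inner_op] at h4 h5 h6
  exact Classical.epsilon_spec (p := fun E : Submodule ℝ H1 × Submodule ℝ H1 =>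
    IsSpectralSplitting V E.1 E.2) ⟨(Ep, Em), h1, h2, h3, fun u hu v hv => (h4 u hu v hv).1,
      fun u hu v hv => (h4 u hu v hv).2, h5, h6⟩

theorem IsSpectralSplitting.exists_coercive {V : ℝ → ℝ} {Ep Em : Submodule ℝ H1}
    (h : IsSpectralSplitting V Ep Em) (hV : StepanovBounded V)
    (h0 : (0 : ℝ) ∉ schrodingerSpectrum V) :
    ∃ α > 0, (∀ u ∈ Ep, α * ‖u‖ ^ 2 ≤ schrodingerForm V u u) ∧
      ∀ u ∈ Em, α * ‖u‖ ^ 2 ≤ -schrodingerForm V u u := by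
  obtain ⟨a, ha, hAa⟩ := hV.exists_norm_op_ge h0
  have hA' : SymmOp (-hV.op) := fun u v => by
    simp only [neg_apply, inner_neg_left, inner_neg_right, hV.symmOp_op u v]
  obtain ⟨α, hα, h1⟩ := hV.symmOp_op.exists_coercive ha hAa h.closed_pos h.closed_neg h.isCompl
    (fun u hu v hv => by rw [hV.inner_op]; exact h.form_orthogonal u hu v hv) fun u hu => by
      rw [hV.inner_op]
      rcases eq_or_ne u 0 with rfl | hu0
      · rw [← hV.inner_op]; simp
      · exact (h.form_pos u hu hu0).le
  obtain ⟨β, hβ, h2⟩ := hA'.exists_coercive ha (fun u => by simpa using hAa u) h.closed_neg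
    h.closed_pos h.isCompl.symm (fun u hu v hv => by
      rw [neg_apply, inner_neg_left, hV.inner_op, schrodingerForm_comm,
        h.form_orthogonal v hv u hu, neg_zero]) fun u hu => by
      rw [neg_apply, inner_neg_left, hV.inner_op]
      rcases eq_or_ne u 0 with rfl | hu0
      · rw [← hV.inner_op]; simp
      · linarith [h.form_neg u hu hu0]
  refine ⟨min α β, lt_min hα hβ, fun u hu => ?_, fun u hu => ?_⟩
  · have := h1 u hu
    rw [hV.inner_op] at this
    exact (mul_le_mul_of_nonneg_right (min_le_left _ _) (sq_nonneg _)).trans this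
  · have := h2 u hu
    rw [neg_apply, inner_neg_left, hV.inner_op] at this
    exact (mul_le_mul_of_nonneg_right (min_le_right _ _) (sq_nonneg _)).trans this

/-- A bounded projection onto `E` that diagonalizes the form `χ (Lu, v)`, which is negative on `E`
and positive on the complement. -/
structure FormDichotomy (χ : ℝ) (V : ℝ → ℝ) (E : Submodule ℝ H1) (P : H1 →L[ℝ] H1) (α : ℝ) :
    Prop where
  pos : 0 < α
  closed : IsClosed (E : Set H1)
  mem : ∀ u, P u ∈ E
  orthogonal : ∀ u v, schrodingerForm V (P u) (v - P v) = 0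
  neg_on : ∀ w ∈ E, χ * schrodingerForm V w w ≤ -(α * ‖w‖ ^ 2)
  pos_on : ∀ u, α * ‖u - P u‖ ^ 2 ≤ χ * schrodingerForm V (u - P u) (u - P u)

theorem exists_formDichotomy {χ : ℝ} (hχ : χ = 1 ∨ χ = -1) {V : ℝ → ℝ} (hV : StepanovBounded V)
    (h0 : (0 : ℝ) ∉ schrodingerSpectrum V) :
    ∃ P α, FormDichotomy χ V (nehariSubspace χ V) P α := by
  have hs := hV.isSpectralSplitting h0
  obtain ⟨α, hα, h1, h2⟩ := hs.exists_coercive hV h0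
  have ht := Submodule.IsCompl.isTopCompl_of_isClosed hs.isCompl hs.closed_pos hs.closed_neg
  have hP : ∀ u, u - Submodule.projectionL _ _ ht u ∈ (spectralSplitting V).2 := fun u => by
    rw [← Submodule.projectionL_eq_self_sub_projectionL ht]
    exact Submodule.projectionL_apply_mem ht.symm _
  have hM : ∀ u, u - Submodule.projectionL _ _ ht.symm u ∈ (spectralSplitting V).1 := fun u => by
    rw [← Submodule.projectionL_eq_self_sub_projectionL ht.symm]
    exact Submodule.projectionL_apply_mem ht _
  rcases hχ with rfl | rfl
  · have e : nehariSubspace 1 V = (spectralSplitting V).2 := by simp [nehariSubspace]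
    rw [e]
    refine ⟨Submodule.projectionL _ _ ht.symm, α, hα, hs.closed_neg,
      Submodule.projectionL_apply_mem ht.symm,
      fun u v => ?_, fun w hw => ?_, fun u => ?_⟩
    · rw [schrodingerForm_comm]
      exact hs.form_orthogonal _ (hM v) _ (Submodule.projectionL_apply_mem ht.symm u)
    · linarith [h2 w hw]
    · linarith [h1 _ (hM u)]
  · have e : nehariSubspace (-1) V = (spectralSplitting V).1 := by
      rw [nehariSubspace, if_neg (by norm_num)]
    rw [e]
    refine ⟨Submodule.projectionL _ _ ht, α, hα, hs.closed_pos,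
      Submodule.projectionL_apply_mem ht,
      fun u v => ?_, fun w hw => ?_, fun u => ?_⟩
    · exact hs.form_orthogonal _ (Submodule.projectionL_apply_mem ht u) _ (hP v)
    · linarith [h1 w hw]
    · linarith [h2 _ (hP u)]

/-! ### Pointwise properties of the nonlinearity -/

/-- The properties of `f(x, ·)` for fixed `x`, with the Lipschitz constant `μ n` of `f_u(x, ·)`
on `[-n, n]`. -/
structure NL (θ : ℝ) (μ : ℕ → ℝ) (g : ℝ → ℝ) : Prop where
  contDiff : ContDiff ℝ 1 g
  zero : g 0 = 0
  deriv_zero : deriv g 0 = 0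
  lipschitz : ∀ (n : ℕ) (u v : ℝ), |u| ≤ n → |v| ≤ n →
    |deriv g u - deriv g v| ≤ μ n * |u - v|
  sign : ∀ u, u ≠ 0 → 0 < g u * u
  superlinear : ∀ u, g u * u ≤ θ * (deriv g u * u ^ 2)

namespace NL

variable {θ : ℝ} {μ : ℕ → ℝ} {g : ℝ → ℝ}

theorem mul_self_nonneg (h : NL θ μ g) (u : ℝ) : 0 ≤ g u * u := by
  rcases eq_or_ne u 0 with rfl | hu
  · simp
  · exact (h.sign u hu).le

theorem deriv_nonneg (h : NL θ μ g) (hθ : 0 < θ) (u : ℝ) : 0 ≤ deriv g u := by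
  rcases eq_or_ne u 0 with rfl | hu
  · rw [h.deriv_zero]
  · have h1 := (h.sign u hu).trans_le (h.superlinear u)
    have h2 := pos_of_mul_pos_right h1 hθ.le
    exact (pos_of_mul_pos_left h2 (sq_nonneg u)).le

theorem abs_deriv_le (h : NL θ μ g) {n : ℕ} {u : ℝ} (hu : |u| ≤ n) :
    |deriv g u| ≤ μ n * |u| := by
  have := h.lipschitz n u 0 hu (by simp)
  rwa [h.deriv_zero, sub_zero, sub_zero] at this

theorem differentiable (h : NL θ μ g) : Differentiable ℝ g := h.contDiff.differentiable (by simp)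

theorem continuous (h : NL θ μ g) : Continuous g := h.contDiff.continuous

theorem continuous_deriv (h : NL θ μ g) : Continuous (deriv g) :=
  h.contDiff.continuous_deriv le_rfl

theorem abs_sub_le (h : NL θ μ g) {n : ℕ} (hμ : 0 ≤ μ n) {r u v : ℝ} (hr : r ≤ n) (hu : |u| ≤ r)
    (hv : |v| ≤ r) : |g u - g v| ≤ μ n * r * |u - v| := by
  have := (convex_Icc (-r) r).norm_image_sub_le_of_norm_deriv_le (f := g) (C := μ n * r)
    (fun x _ => h.differentiable x) (fun x hx => ?_) (abs_le.1 hv) (abs_le.1 hu)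
  · simpa only [Real.norm_eq_abs] using this
  · have hx' : |x| ≤ r := abs_le.2 hx
    exact (h.abs_deriv_le (hx'.trans hr)).trans (mul_le_mul_of_nonneg_left hx' hμ)

theorem abs_le (h : NL θ μ g) {n : ℕ} (hμ : 0 ≤ μ n) {u : ℝ} (hu : |u| ≤ n) :
    |g u| ≤ μ n * u ^ 2 := by
  have := h.abs_sub_le hμ hu le_rfl (show |(0 : ℝ)| ≤ |u| by simp)
  rw [h.zero, sub_zero, sub_zero, mul_assoc, ← pow_two, sq_abs] at this
  exact this

theorem abs_le' (h : NL θ μ g) {n : ℕ} (hμ : 0 ≤ μ n) {u : ℝ} (hu : |u| ≤ n) :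
    |g u| ≤ μ n * n * |u| := by
  refine (h.abs_le hμ hu).trans ?_
  rw [← sq_abs, pow_two, mul_assoc]
  exact mul_le_mul_of_nonneg_left (mul_le_mul_of_nonneg_right hu (abs_nonneg _)) hμ

theorem hasDerivAt_primitive (h : NL θ μ g) (u : ℝ) :
    HasDerivAt (fun u => ∫ s in (0 : ℝ)..u, g s) (g u) u :=
  intervalIntegral.integral_hasDerivAt_right (h.continuous.intervalIntegrable _ _)
    (h.continuous.stronglyMeasurableAtFilter _ _) h.continuous.continuousAt

theorem abs_primitive_sub_le (h : NL θ μ g) {n : ℕ} (hμ : 0 ≤ μ n) {r u v : ℝ} (hr : r ≤ n)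
    (hu : |u| ≤ r) (hv : |v| ≤ r) :
    |(∫ s in (0 : ℝ)..u, g s) - ∫ s in (0 : ℝ)..v, g s| ≤ μ n * r ^ 2 * |u - v| := by
  have := (convex_Icc (-r) r).norm_image_sub_le_of_norm_hasDerivWithin_le (C := μ n * r ^ 2)
    (f := fun u => ∫ s in (0 : ℝ)..u, g s) (f' := g)
    (fun x _ => (h.hasDerivAt_primitive x).hasDerivWithinAt) (fun x hx => ?_) (_root_.abs_le.1 hv)
    (_root_.abs_le.1 hu)
  · simpa only [Real.norm_eq_abs] using this
  · have hx' : |x| ≤ r := _root_.abs_le.2 hx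
    refine (h.abs_le hμ (hx'.trans hr)).trans (mul_le_mul_of_nonneg_left ?_ hμ)
    rw [← sq_abs]
    exact pow_le_pow_left₀ (abs_nonneg _) hx' 2

theorem abs_primitive_le (h : NL θ μ g) {n : ℕ} (hμ : 0 ≤ μ n) {u : ℝ} (hu : |u| ≤ n) :
    |∫ s in (0 : ℝ)..u, g s| ≤ μ n * n * u ^ 2 := by
  have := h.abs_primitive_sub_le hμ hu le_rfl (show |(0 : ℝ)| ≤ |u| by simp)
  rw [intervalIntegral.integral_same, sub_zero, sub_zero] at this
  refine this.trans ?_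
  rw [sq_abs, mul_assoc, mul_assoc]
  refine mul_le_mul_of_nonneg_left ?_ hμ
  rw [mul_comm]
  exact mul_le_mul_of_nonneg_right hu (sq_nonneg u)

theorem monotone (h : NL θ μ g) (hθ : 0 < θ) : Monotone g :=
  monotone_of_deriv_nonneg h.differentiable (h.deriv_nonneg hθ)

theorem primitive_nonneg (h : NL θ μ g) (hθ : 0 < θ) (u : ℝ) : 0 ≤ ∫ s in (0 : ℝ)..u, g s := by
  have hm := h.monotone hθ
  rcases le_total 0 u with hu | hu
  · exact intervalIntegral.integral_nonneg hu fun s hs => h.zero ▸ hm hs.1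
  · rw [intervalIntegral.integral_symm, ← intervalIntegral.integral_neg]
    exact intervalIntegral.integral_nonneg hu fun s hs =>
      neg_nonneg.2 (by have := hm hs.2; rwa [h.zero] at this)

/-- Two applications of the mean value inequality along the segment from `a` to `a + b`. The second
order coefficient `κ` is left free, so that it can be frozen at a point other than `a`. -/
theorem abs_taylor_le (h : NL θ μ g) {a b κ η : ℝ} (hη : 0 ≤ η)
    (hd : ∀ t ∈ Icc (0 : ℝ) 1, |deriv g (a + t * b) - κ| ≤ η) :
    |(∫ s in (0 : ℝ)..(a + b), g s) - (∫ s in (0 : ℝ)..a, g s) - g a * b - κ / 2 * b ^ 2|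
      ≤ η * b ^ 2 := by
  have hlin : ∀ t : ℝ, HasDerivAt (fun t : ℝ => a + t * b) b t := fun t => by
    simpa using ((hasDerivAt_id t).mul_const b).const_add a
  have h1 : ∀ t ∈ Icc (0 : ℝ) 1, |g (a + t * b) - g a - κ * (t * b)| ≤ η * |b| := by
    intro t ht
    have hder : ∀ s ∈ Icc (0 : ℝ) 1,
        HasDerivWithinAt (fun s => g (a + s * b) - g a - κ * (s * b))
          ((deriv g (a + s * b) - κ) * b) (Icc 0 1) s := fun s _ => by
      have e1 := (h.differentiable (a + s * b)).hasDerivAt.comp s (hlin s)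
      have e2 := ((hasDerivAt_id s).mul_const b).const_mul κ
      have := (e1.sub_const (g a)).sub e2
      exact this.hasDerivWithinAt.congr_deriv (by ring)
    have := (convex_Icc (0 : ℝ) 1).norm_image_sub_le_of_norm_hasDerivWithin_le (C := η * |b|)
      hder (fun s hs => by
        rw [Real.norm_eq_abs, abs_mul]
        exact mul_le_mul_of_nonneg_right (hd s hs) (abs_nonneg _))
      (left_mem_Icc.2 zero_le_one) ht
    simp only [zero_mul, add_zero, sub_self, mul_zero, sub_zero, Real.norm_eq_abs] at this
    refine this.trans (mul_le_of_le_one_right (by positivity) ?_)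
    rw [abs_of_nonneg ht.1]; exact ht.2
  have hder : ∀ s ∈ Icc (0 : ℝ) 1,
      HasDerivWithinAt (fun s => (∫ y in (0 : ℝ)..(a + s * b), g y) - g a * (s * b)
        - κ / 2 * (s * b) ^ 2) ((g (a + s * b) - g a - κ * (s * b)) * b) (Icc 0 1) s :=
    fun s _ => by
      have e1 := (h.hasDerivAt_primitive (a + s * b)).comp s (hlin s)
      have e2 := ((hasDerivAt_id s).mul_const b).const_mul (g a)
      have e3 := (((hasDerivAt_id s).mul_const b).pow 2).const_mul (κ / 2)
      have := (e1.sub e2).sub e3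
      exact this.hasDerivWithinAt.congr_deriv (by simp only [id]; ring)
  have := (convex_Icc (0 : ℝ) 1).norm_image_sub_le_of_norm_hasDerivWithin_le (C := η * b ^ 2)
    hder (fun s hs => by
      rw [Real.norm_eq_abs, abs_mul, ← sq_abs b, pow_two |b|, ← mul_assoc η]
      exact mul_le_mul_of_nonneg_right (h1 s hs) (abs_nonneg _))
    (left_mem_Icc.2 zero_le_one) (right_mem_Icc.2 zero_le_one)
  simp only [zero_mul, add_zero, mul_zero, sub_zero, one_mul, Real.norm_eq_abs, abs_one,
    mul_one, ne_eq, OfNat.ofNat_ne_zero, not_false_eq_true, zero_pow] at this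
  refine le_trans (le_of_eq ?_) this
  congr 1
  ring

/-- The first two terms equal `(g(v)/v) ((sv + w)² - w²)`, and `0 ≤ g(v)/v ≤ θ g'(v)`. The factor `1
- θ` is the strict concavity gained from superlinearity. -/
theorem second_variation_le (h : NL θ μ g) (s v w : ℝ) :
    s ^ 2 * (g v * v) + 2 * s * (g v * w) - deriv g v * (s * v + w) ^ 2
      ≤ -(1 - θ) * (deriv g v * (s * v + w) ^ 2) := by
  rcases eq_or_ne v 0 with rfl | hv
  · simp [h.zero, h.deriv_zero]
  have h1 : 0 ≤ g v / v := by
    have : g v / v = g v * v / v ^ 2 := by field_simp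
    rw [this]
    exact div_nonneg (h.mul_self_nonneg v) (sq_nonneg v)
  have h2 : g v / v ≤ θ * deriv g v := by
    have : g v / v = g v * v / v ^ 2 := by field_simp
    rw [this, div_le_iff₀ (by positivity)]
    linarith [h.superlinear v]
  have h3 : s ^ 2 * (g v * v) + 2 * s * (g v * w) = g v / v * ((s * v + w) ^ 2 - w ^ 2) := by
    field_simp
    ring
  have h4 := mul_le_mul_of_nonneg_right h2 (sq_nonneg (s * v + w))
  have h5 := mul_nonneg h1 (sq_nonneg w)
  rw [h3]
  nlinarith

end NL

/-! ### Superposition operators and the functional -/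

theorem aestronglyMeasurable_comp_simpleFunc {g : ℝ → ℝ → ℝ}
    (hm : ∀ u : ℝ, AEStronglyMeasurable (fun x => g x u) volume) (s : SimpleFunc ℝ ℝ) :
    AEStronglyMeasurable (fun x => g x (s x)) volume := by
  have h : (fun x => g x (s x)) =
      fun x => ∑ y ∈ s.range, (s ⁻¹' {y}).indicator (fun x => g x y) x := by
    ext x
    rw [Finset.sum_eq_single (s x)]
    · rw [indicator_of_mem (by simp)]
    · intro y _ hy
      rw [indicator_of_notMem (by simpa using hy.symm)]
    · intro h
      exact absurd (s.mem_range_self x) h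
  rw [h]
  exact Finset.aestronglyMeasurable_fun_sum _ fun y _ =>
    (hm y).indicator (s.measurableSet_fiber y)

/-- Simple functions approximate `u` pointwise, and continuity in the second variable passes
measurability to the limit. -/
theorem aestronglyMeasurable_comp {g : ℝ → ℝ → ℝ} (hc : ∀ᵐ x : ℝ, Continuous (g x))
    (hm : ∀ u : ℝ, AEStronglyMeasurable (fun x => g x u) volume) {u : ℝ → ℝ}
    (hu : Measurable u) : AEStronglyMeasurable (fun x => g x (u x)) volume := by
  refine aestronglyMeasurable_of_tendsto_ae atTop (fun n => aestronglyMeasurable_comp_simpleFunc hm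
    (SimpleFunc.approxOn u hu univ 0 (mem_univ 0) n)) ?_
  filter_upwards [hc] with x hx
  exact (hx.tendsto (u x)).comp (SimpleFunc.tendsto_approxOn hu (mem_univ 0) (by simp))

/-- Nonlinearities with the bounds that are uniform over the envelope. -/
structure Admissible (θ : ℝ) (μ : ℕ → ℝ) (f : ℝ → ℝ → ℝ) : Prop where
  theta_pos : 0 < θ
  theta_lt : θ < 1
  mu_nonneg : ∀ n, 0 ≤ μ n
  meas_primitive : ∀ u : ℝ, AEStronglyMeasurable (fun x => primitive f x u) volume
  meas : ∀ u : ℝ, AEStronglyMeasurable (fun x => f x u) volume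
  meas_partialU : ∀ u : ℝ, AEStronglyMeasurable (fun x => partialU f x u) volume
  nl : ∀ᵐ x : ℝ, NL θ μ (f x)

theorem shift_ae {p : ℝ → Prop} (h : ∀ᵐ x : ℝ, p x) (z : ℝ) : ∀ᵐ x : ℝ, p (x + z) :=
  (measurePreserving_add_right volume z).quasiMeasurePreserving.ae h

theorem shift_aestronglyMeasurable {g : ℝ → ℝ} (h : AEStronglyMeasurable g volume) (z : ℝ) :
    AEStronglyMeasurable (fun x => g (x + z)) volume :=
  h.comp_measurePreserving (measurePreserving_add_right volume z)

namespace Admissible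

variable {θ : ℝ} {μ : ℕ → ℝ} {f : ℝ → ℝ → ℝ}

theorem shift (hf : Admissible θ μ f) (z : ℝ) : Admissible θ μ fun x u => f (x + z) u where
  theta_pos := hf.theta_pos
  theta_lt := hf.theta_lt
  mu_nonneg := hf.mu_nonneg
  meas_primitive u := shift_aestronglyMeasurable (hf.meas_primitive u) z
  meas u := shift_aestronglyMeasurable (hf.meas u) z
  meas_partialU u := shift_aestronglyMeasurable (hf.meas_partialU u) z
  nl := shift_ae hf.nl z

theorem aestronglyMeasurable_comp (hf : Admissible θ μ f) (u : H1) :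
    AEStronglyMeasurable (fun x => f x (u.rep x)) volume :=
  StepanovNLS.aestronglyMeasurable_comp (hf.nl.mono fun _ h => h.continuous) hf.meas
    u.continuous_rep.measurable

theorem aestronglyMeasurable_partialU_comp (hf : Admissible θ μ f) (u : H1) :
    AEStronglyMeasurable (fun x => partialU f x (u.rep x)) volume :=
  StepanovNLS.aestronglyMeasurable_comp (hf.nl.mono fun _ h => h.continuous_deriv)
    hf.meas_partialU u.continuous_rep.measurable

theorem aestronglyMeasurable_primitive_comp (hf : Admissible θ μ f) (u : H1) :
    AEStronglyMeasurable (fun x => primitive f x (u.rep x)) volume :=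
  StepanovNLS.aestronglyMeasurable_comp (hf.nl.mono fun x h =>
    (show Differentiable ℝ (primitive f x) from
      fun u => (h.hasDerivAt_primitive u).differentiableAt).continuous)
    hf.meas_primitive u.continuous_rep.measurable

theorem memLp_comp (hf : Admissible θ μ f) (u : H1) :
    MemLp (fun x => f x (u.rep x)) 2 volume := by
  obtain ⟨n, hn⟩ := exists_nat_ge (2 * ‖u‖)
  refine u.memLp_rep.of_le_mul (c := μ n * n) (hf.aestronglyMeasurable_comp u) ?_
  filter_upwards [hf.nl] with x hx
  exact hx.abs_le' (hf.mu_nonneg n) ((u.abs_rep_le x).trans hn)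

theorem integrable_primitive_comp (hf : Admissible θ μ f) (u : H1) :
    Integrable (fun x => primitive f x (u.rep x)) volume := by
  obtain ⟨n, hn⟩ := exists_nat_ge (2 * ‖u‖)
  refine (u.integrable_rep_sq.const_mul (μ n * n)).mono'
    (hf.aestronglyMeasurable_primitive_comp u) ?_
  filter_upwards [hf.nl] with x hx
  exact hx.abs_primitive_le (hf.mu_nonneg n) ((u.abs_rep_le x).trans hn)

theorem integrable_comp_mul (hf : Admissible θ μ f) (u v : H1) :
    Integrable (fun x => f x (u.rep x) * v.rep x) volume :=
  (hf.memLp_comp u).integrable_mul v.memLp_rep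

theorem integrable_partialU_mul (hf : Admissible θ μ f) (p v w : H1) :
    Integrable (fun x => partialU f x (p.rep x) * (v.rep x * w.rep x)) volume := by
  obtain ⟨n, hn⟩ := exists_nat_ge (2 * ‖p‖)
  refine (v.integrable_rep_mul w).bdd_mul (c := μ n * n)
    (hf.aestronglyMeasurable_partialU_comp p) ?_
  filter_upwards [hf.nl] with x hx
  have h1 := (p.abs_rep_le x).trans hn
  exact (hx.abs_deriv_le h1).trans (mul_le_mul_of_nonneg_left h1 (hf.mu_nonneg n))

theorem integrable_partialU_sq (hf : Admissible θ μ f) (p v : H1) :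
    Integrable (fun x => partialU f x (p.rep x) * v.rep x ^ 2) volume := by
  simpa only [pow_two] using hf.integrable_partialU_mul p v v

/-- The functional `v ↦ ∫ f(x, u) v dx`. -/
def compL (hf : Admissible θ μ f) (u : H1) : StrongDual ℝ H1 :=
  (innerSL ℝ ((hf.memLp_comp u).toLp _)).comp H1.valL

theorem compL_apply (hf : Admissible θ μ f) (u v : H1) :
    hf.compL u v = ∫ x, f x (u.rep x) * v.rep x := by
  change ⟪(hf.memLp_comp u).toLp _, v.val⟫_ℝ = _
  rw [L2_inner_eq]
  refine integral_congr_ae ?_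
  filter_upwards [(hf.memLp_comp u).coeFn_toLp, v.val_ae_eq_rep] with x h1 h2
  rw [h1, h2]

end Admissible

/-- The derivative of `J` at `u` in the direction `v`. -/
def dJ (χ : ℝ) (V : ℝ → ℝ) (f : ℝ → ℝ → ℝ) (u v : H1) : ℝ :=
  χ * schrodingerForm V u v - ∫ x, f x (u.rep x) * v.rep x

/-- The derivative of `J` as an element of the dual space. -/
def Admissible.dJL {θ : ℝ} {μ : ℕ → ℝ} {f : ℝ → ℝ → ℝ} (hf : Admissible θ μ f) (χ : ℝ)
    {V : ℝ → ℝ} (hV : StepanovBounded V) (u : H1) : StrongDual ℝ H1 :=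
  χ • hV.form u - hf.compL u

theorem Admissible.dJL_apply {θ : ℝ} {μ : ℕ → ℝ} {f : ℝ → ℝ → ℝ} (hf : Admissible θ μ f) (χ : ℝ)
    {V : ℝ → ℝ} (hV : StepanovBounded V) (u v : H1) : hf.dJL χ hV u v = dJ χ V f u v := by
  rw [dJ, ← hf.compL_apply]
  rfl

theorem primitive_shift (f : ℝ → ℝ → ℝ) (z x u : ℝ) :
    primitive (fun x u => f (x + z) u) x u = primitive f (x + z) u := rfl

theorem dJ_shift (χ : ℝ) (V : ℝ → ℝ) (f : ℝ → ℝ → ℝ) (z : ℝ) (u v : H1) :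
    dJ χ (fun x => V (x + z)) (fun x u => f (x + z) u) (shift z u) (shift z v) =
      dJ χ V f u v := by
  rw [dJ, dJ, schrodingerForm_shift]
  congr 1
  rw [← integral_add_right_eq_self (fun x => f x (u.rep x) * v.rep x) z]
  simp only [rep_shift]

theorem functionalJ_eq {χ : ℝ} (hχ : χ = 1 ∨ χ = -1) (V : ℝ → ℝ) (f : ℝ → ℝ → ℝ) (u : H1) :
    functionalJ χ V f u =
      χ * schrodingerForm V u u / 2 - ∫ x, primitive f x (u.rep x) := by
  have h : ∫ x, primitive f x (u.val x) = ∫ x, primitive f x (u.rep x) := by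
    refine integral_congr_ae ?_
    filter_upwards [u.val_ae_eq_rep] with x hx
    rw [hx]
  rw [functionalJ, energy, h]
  rcases hχ with rfl | rfl <;> ring

theorem functionalJ_shift {χ : ℝ} (hχ : χ = 1 ∨ χ = -1) (V : ℝ → ℝ) (f : ℝ → ℝ → ℝ) (z : ℝ)
    (u : H1) : functionalJ χ (fun x => V (x + z)) (fun x u => f (x + z) u) (shift z u) =
      functionalJ χ V f u := by
  rw [functionalJ_eq hχ, functionalJ_eq hχ, schrodingerForm_shift,
    ← integral_add_right_eq_self (fun x => primitive f x (u.rep x)) z]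
  simp only [rep_shift, primitive_shift]

/-- The quadratic part is frozen at a free point `p`. The choice `p = 0`, where `f_u` vanishes,
gives differentiability. With `p` a fixed almost critical point, one negative quadratic form
controls all expansions nearby, with an error governed by the Lipschitz bound on `f_u`. -/
theorem Admissible.abs_expansion_le {θ : ℝ} {μ : ℕ → ℝ} {f : ℝ → ℝ → ℝ} (hf : Admissible θ μ f)
    {χ : ℝ} (hχ : χ = 1 ∨ χ = -1) {V : ℝ → ℝ} (hV : StepanovBounded V) (p u v : H1) {n : ℕ}
    (hn : 2 * (‖u‖ + ‖v‖ + ‖p‖) ≤ n) :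
    |functionalJ χ V f (u + v) - functionalJ χ V f u - dJ χ V f u v -
      (χ * schrodingerForm V v v - ∫ x, partialU f x (p.rep x) * v.rep x ^ 2) / 2| ≤
      2 * μ n * (‖u - p‖ + ‖v‖) * ‖v‖ ^ 2 := by
  set η := 2 * μ n * (‖u - p‖ + ‖v‖)
  have hμ := hf.mu_nonneg n
  have hη : 0 ≤ η := by positivity
  have hQ : schrodingerForm V (u + v) (u + v) =
      schrodingerForm V u u + 2 * schrodingerForm V u v + schrodingerForm V v v := by
    simp only [← hV.form_apply, map_add, add_apply]
    rw [hV.form_apply v u, schrodingerForm_comm, ← hV.form_apply]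
    ring
  have i1 := hf.integrable_primitive_comp (u + v)
  have i2 := hf.integrable_primitive_comp u
  have i3 := hf.integrable_comp_mul u v
  have i4 := hf.integrable_partialU_sq p v
  have i5 : Integrable (fun x => primitive f x ((u + v).rep x) - primitive f x (u.rep x)) volume :=
    i1.sub i2
  have i6 : Integrable (fun x => primitive f x ((u + v).rep x) - primitive f x (u.rep x) -
      f x (u.rep x) * v.rep x) volume := i5.sub i3
  have e : functionalJ χ V f (u + v) - functionalJ χ V f u - dJ χ V f u v -
      (χ * schrodingerForm V v v - ∫ x, partialU f x (p.rep x) * v.rep x ^ 2) / 2 =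
      -∫ x, (primitive f x ((u + v).rep x) - primitive f x (u.rep x) - f x (u.rep x) * v.rep x -
        partialU f x (p.rep x) * v.rep x ^ 2 / 2) := by
    rw [integral_sub i6 (i4.div_const 2), integral_sub i5 i3, integral_sub i1 i2,
      integral_div, functionalJ_eq hχ, functionalJ_eq hχ, dJ, hQ]
    ring
  rw [e, abs_neg, ← Real.norm_eq_abs]
  have h1 : ‖∫ x, (primitive f x ((u + v).rep x) - primitive f x (u.rep x) -
      f x (u.rep x) * v.rep x - partialU f x (p.rep x) * v.rep x ^ 2 / 2)‖ ≤
      ∫ x, η * v.rep x ^ 2 := by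
    refine norm_integral_le_of_norm_le (v.integrable_rep_sq.const_mul η) ?_
    filter_upwards [hf.nl] with x hx
    have hu := u.abs_rep_le x
    have hv := v.abs_rep_le x
    have hp := p.abs_rep_le x
    have hup := (u - p).abs_rep_le x
    rw [H1.rep_sub] at hup
    have hnu := norm_nonneg u
    have hnv := norm_nonneg v
    have hnp := norm_nonneg p
    have h2 := hx.abs_taylor_le (a := u.rep x) (b := v.rep x) (κ := partialU f x (p.rep x)) hη
      fun t ht => by
        have h3 : |t * v.rep x| ≤ |v.rep x| := by
          rw [abs_mul, abs_of_nonneg ht.1]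
          exact mul_le_of_le_one_left (abs_nonneg _) ht.2
        have h4 := abs_add_le (u.rep x) (t * v.rep x)
        have h5 := abs_add_le (u.rep x - p.rep x) (t * v.rep x)
        refine (hx.lipschitz n _ _ (by linarith) (by linarith)).trans ?_
        have h6 : u.rep x + t * v.rep x - p.rep x = u.rep x - p.rep x + t * v.rep x := by ring
        have h7 : |u.rep x - p.rep x + t * v.rep x| ≤ 2 * (‖u - p‖ + ‖v‖) := by linarith
        rw [h6]
        refine (mul_le_mul_of_nonneg_left h7 hμ).trans (le_of_eq ?_)
        simp only [η]; ring
    rw [H1.rep_add, Real.norm_eq_abs]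
    refine le_trans (le_of_eq ?_) h2
    simp only [primitive]
    congr 1
    ring
  refine h1.trans ?_
  rw [integral_const_mul]
  exact mul_le_mul_of_nonneg_left v.integral_rep_sq_le hη

theorem Admissible.partialU_zero {θ : ℝ} {μ : ℕ → ℝ} {f : ℝ → ℝ → ℝ} (hf : Admissible θ μ f)
    (v : H1) : ∫ x, partialU f x ((0 : H1).rep x) * v.rep x ^ 2 = 0 := by
  refine integral_eq_zero_of_ae ?_
  filter_upwards [hf.nl] with x hx
  rw [H1.rep_zero, partialU, hx.deriv_zero]
  simp

theorem abs_sign {χ : ℝ} (hχ : χ = 1 ∨ χ = -1) : |χ| = 1 := by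
  rcases hχ with rfl | rfl <;> simp

theorem Admissible.hasFDerivAt {θ : ℝ} {μ : ℕ → ℝ} {f : ℝ → ℝ → ℝ} (hf : Admissible θ μ f)
    {χ : ℝ} (hχ : χ = 1 ∨ χ = -1) {V : ℝ → ℝ} (hV : StepanovBounded V) (u : H1) :
    HasFDerivAt (functionalJ χ V f) (hf.dJL χ hV u) u := by
  obtain ⟨n, hn⟩ := exists_nat_ge (2 * (‖u‖ + 1))
  have hμ := hf.mu_nonneg n
  set K := 1 + 2 * (stepanovNorm V).toReal
  have hK : 0 ≤ K := by positivity
  rw [hasFDerivAt_iff_isLittleO_nhds_zero]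
  have h1 : (fun h : H1 => functionalJ χ V f (u + h) - functionalJ χ V f u - hf.dJL χ hV u h)
      =O[𝓝 0] fun h : H1 => ‖h‖ ^ 2 := by
    refine Asymptotics.IsBigO.of_bound (2 * μ n * (‖u‖ + 1) + K / 2) ?_
    filter_upwards [Metric.ball_mem_nhds (0 : H1) one_pos] with h hh
    have hh1 : ‖h‖ ≤ 1 := (mem_ball_zero_iff.1 hh).le
    have h2 := hf.abs_expansion_le hχ hV 0 u h (n := n) (by rw [norm_zero]; linarith)
    rw [hf.partialU_zero, sub_zero, sub_zero] at h2
    have h3 : |χ * schrodingerForm V h h| ≤ K * ‖h‖ ^ 2 := by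
      rw [abs_mul, abs_sign hχ, one_mul]
      refine (hV.abs_schrodingerForm_le h h).trans (le_of_eq ?_)
      rw [mul_assoc, ← pow_two]
    rw [hf.dJL_apply, Real.norm_eq_abs, Real.norm_eq_abs, abs_of_nonneg (sq_nonneg ‖h‖)]
    have h4 : 2 * μ n * (‖u‖ + ‖h‖) * ‖h‖ ^ 2 ≤ 2 * μ n * (‖u‖ + 1) * ‖h‖ ^ 2 :=
      mul_le_mul_of_nonneg_right (mul_le_mul_of_nonneg_left (by linarith) (by positivity))
        (sq_nonneg _)
    rw [_root_.abs_le] at h2 h3 ⊢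
    constructor <;> linarith [h2.1, h2.2, h3.1, h3.2]
  refine h1.trans_isLittleO ?_
  simpa using (Asymptotics.isLittleO_norm_pow_id (E' := H1) (n := 2) one_lt_two)

theorem Admissible.fderiv_apply {θ : ℝ} {μ : ℕ → ℝ} {f : ℝ → ℝ → ℝ} (hf : Admissible θ μ f)
    {χ : ℝ} (hχ : χ = 1 ∨ χ = -1) {V : ℝ → ℝ} (hV : StepanovBounded V) (u v : H1) :
    fderiv ℝ (functionalJ χ V f) u v = dJ χ V f u v := by
  rw [(hf.hasFDerivAt hχ hV u).fderiv, hf.dJL_apply]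

theorem Admissible.isCriticalPoint {θ : ℝ} {μ : ℕ → ℝ} {f : ℝ → ℝ → ℝ} (hf : Admissible θ μ f)
    {χ : ℝ} (hχ : χ = 1 ∨ χ = -1) {V : ℝ → ℝ} (hV : StepanovBounded V) {u : H1}
    (h : ∀ v, dJ χ V f u v = 0) : IsCriticalPoint (functionalJ χ V f) u := by
  have e : hf.dJL χ hV u = 0 := by
    ext v
    rw [hf.dJL_apply, h v]
    rfl
  have := hf.hasFDerivAt hχ hV u
  rwa [e] at this

theorem Admissible.continuous_functionalJ {θ : ℝ} {μ : ℕ → ℝ} {f : ℝ → ℝ → ℝ}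
    (hf : Admissible θ μ f) {χ : ℝ} (hχ : χ = 1 ∨ χ = -1) {V : ℝ → ℝ} (hV : StepanovBounded V) :
    Continuous (functionalJ χ V f) :=
  continuous_iff_continuousAt.2 fun u => (hf.hasFDerivAt hχ hV u).continuousAt

/-- The constants in the standing assumptions can be chosen uniformly. -/
theorem StandingAssumptions.exists_admissible {χ : ℝ} {V : ℝ → ℝ} {f : ℝ → ℝ → ℝ}
    (h : StandingAssumptions χ V f) : ∃ θ μ, Admissible θ μ f := by
  obtain ⟨θ, hθ, hsup⟩ := h.superlinear
  choose! μ hμ hlip using h.partialU_lipschitz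
  -- Integer radii suffice, and there are countably many of them, so a single null set serves all.
  have h1 : ∀ᵐ x : ℝ, ∀ n : ℕ, ∀ u v : ℝ, |u| ≤ (n + 1 : ℝ) → |v| ≤ (n + 1 : ℝ) →
      |partialU f x u - partialU f x v| ≤ μ (n + 1) * |u - v| :=
    ae_all_iff.2 fun n => hlip (n + 1) (by positivity)
  -- The index is moved by one because the Lipschitz constant is available only for positive radii,
  -- while `n = 0` must be covered.
  refine ⟨θ, fun n => μ (n + 1), hθ.1, hθ.2, fun n => (hμ (n + 1) (by positivity)).le,
    h.ap_primitive.1.2, h.ap_self.1.2, h.ap_partialU.1.2, ?_⟩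
  filter_upwards [h.contDiff, h.self_zero, h.partialU_zero, hsup, h1] with x h2 h3 h4 h5 h6
  refine ⟨h2, h3, h4, fun n u v hu hv => h6 n u v (by linarith) (by linarith),
    fun u hu => (h5 u hu).1, fun u => ?_⟩
  rcases eq_or_ne u 0 with rfl | hu
  · simp
  · exact (h5 u hu).2

/-! ### Points of the Nehari manifold near approximate critical points -/

/-- Uniform midpoint concavity makes maximizing sequences Cauchy, so no weak compactness is needed.
The boundary condition puts the maximum in the interior of the ball. -/
theorem exists_max_of_midpoint_concave {H : Type*} [NormedAddCommGroup H] [InnerProductSpace ℝ H]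
    [CompleteSpace H] {X : Submodule ℝ H} (hX : IsClosed (X : Set H)) {Φ : H → ℝ}
    (hΦ : Continuous Φ) {ρ κ K : ℝ} (hρ : 0 < ρ) (hκ : 0 < κ)
    (hconc : ∀ a ∈ X, ∀ b ∈ X, ‖a‖ ≤ ρ → ‖b‖ ≤ ρ →
      Φ a + Φ b + κ * ‖a - b‖ ^ 2 ≤ 2 * Φ ((2⁻¹ : ℝ) • (a + b)))
    (hK : ∀ a ∈ X, ‖a‖ ≤ ρ → Φ a ≤ K) (hbd : ∀ a ∈ X, ‖a‖ = ρ → Φ a < Φ 0) :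
    ∃ a ∈ X, ‖a‖ < ρ ∧ ∀ b ∈ X, ‖b‖ ≤ ρ → Φ b ≤ Φ a := by
  set S : Set H := {a | a ∈ X ∧ ‖a‖ ≤ ρ} with hS
  have hSc : IsClosed S := hX.inter (isClosed_le continuous_norm continuous_const)
  have h0 : (0 : H) ∈ S := ⟨X.zero_mem, by simpa using hρ.le⟩
  have hne : (Φ '' S).Nonempty := ⟨_, mem_image_of_mem Φ h0⟩
  have hba : BddAbove (Φ '' S) := ⟨K, by rintro _ ⟨a, ha, rfl⟩; exact hK a ha.1 ha.2⟩
  set M := sSup (Φ '' S)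
  have hM : ∀ a ∈ S, Φ a ≤ M := fun a ha => le_csSup hba (mem_image_of_mem Φ ha)
  have hex : ∀ n : ℕ, ∃ a ∈ S, M - 1 / ((n : ℝ) + 1) < Φ a := fun n => by
    obtain ⟨_, ⟨a, ha, rfl⟩, h⟩ := exists_lt_of_lt_csSup hne
      (show M - 1 / ((n : ℝ) + 1) < M by
        have : 0 < 1 / ((n : ℝ) + 1) := by positivity
        linarith)
    exact ⟨a, ha, h⟩
  choose a haS ha using hex
  have hcau : CauchySeq a := by
    refine cauchySeq_of_le_tendsto_0 (fun N : ℕ => Real.sqrt (2 / κ * (1 / ((N : ℝ) + 1))))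
      (fun n m N hn hm => ?_) ?_
    · rw [dist_eq_norm]
      refine Real.le_sqrt_of_sq_le ?_
      have h1 := hconc _ (haS n).1 _ (haS m).1 (haS n).2 (haS m).2
      have hmid : (2⁻¹ : ℝ) • (a n + a m) ∈ S := by
        refine ⟨X.smul_mem _ (X.add_mem (haS n).1 (haS m).1), ?_⟩
        rw [norm_smul, Real.norm_of_nonneg (by norm_num)]
        linarith [norm_add_le (a n) (a m), (haS n).2, (haS m).2]
      have h2 := hM _ hmid
      have h3 := ha n
      have h4 := ha m
      have h5 : 1 / ((n : ℝ) + 1) ≤ 1 / ((N : ℝ) + 1) :=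
        one_div_le_one_div_of_le (by positivity) (by exact_mod_cast Nat.succ_le_succ hn)
      have h6 : 1 / ((m : ℝ) + 1) ≤ 1 / ((N : ℝ) + 1) :=
        one_div_le_one_div_of_le (by positivity) (by exact_mod_cast Nat.succ_le_succ hm)
      have h7 : κ * ‖a n - a m‖ ^ 2 ≤ 2 * (1 / ((N : ℝ) + 1)) := by linarith
      rw [div_mul_eq_mul_div, le_div_iff₀ hκ]
      linarith
    · have h := (tendsto_one_div_add_atTop_nhds_zero_nat (𝕜 := ℝ)).const_mul (2 / κ)
      rw [mul_zero] at h
      simpa using h.sqrt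
  obtain ⟨b, hb⟩ := cauchySeq_tendsto_of_complete hcau
  have hbS : b ∈ S := hSc.mem_of_tendsto hb (Eventually.of_forall haS)
  have hΦb : M ≤ Φ b := by
    have h1 := (hΦ.tendsto b).comp hb
    have h2 := (tendsto_const_nhds (x := M)).sub (tendsto_one_div_add_atTop_nhds_zero_nat (𝕜 := ℝ))
    rw [sub_zero] at h2
    exact le_of_tendsto_of_tendsto' h2 h1 fun n => (ha n).le
  refine ⟨b, hbS.1, lt_of_le_of_ne hbS.2 fun h => ?_, fun c hc hcρ => (hM c ⟨hc, hcρ⟩).trans hΦb⟩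
  have h1 := hbd b hbS.1 h
  have h2 := hM 0 h0
  linarith

variable {θ : ℝ} {μ : ℕ → ℝ} {f : ℝ → ℝ → ℝ} {χ : ℝ} {V : ℝ → ℝ}

theorem Admissible.partialU_integral_le (hf : Admissible θ μ f) {n : ℕ} {v : H1}
    (hn : 2 * ‖v‖ ≤ n) (w : H1) :
    ∫ x, partialU f x (v.rep x) * w.rep x ^ 2 ≤ μ n * n * ‖w‖ ^ 2 := by
  have h1 : ∫ x, partialU f x (v.rep x) * w.rep x ^ 2 ≤ ∫ x, μ n * n * w.rep x ^ 2 := by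
    refine integral_mono_ae (hf.integrable_partialU_sq v w) (w.integrable_rep_sq.const_mul _) ?_
    filter_upwards [hf.nl] with x hx
    have h2 := (v.abs_rep_le x).trans hn
    refine mul_le_mul_of_nonneg_right ?_ (sq_nonneg _)
    exact (le_abs_self _).trans ((hx.abs_deriv_le h2).trans
      (mul_le_mul_of_nonneg_left h2 (hf.mu_nonneg n)))
  refine h1.trans ?_
  rw [integral_const_mul]
  exact mul_le_mul_of_nonneg_left w.integral_rep_sq_le
    (mul_nonneg (hf.mu_nonneg n) (Nat.cast_nonneg n))

/-- The second derivative of `J` at `v` as a quadratic form. -/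
def secondVariation (χ : ℝ) (V : ℝ → ℝ) (f : ℝ → ℝ → ℝ) (v ξ : H1) : ℝ :=
  χ * schrodingerForm V ξ ξ - ∫ x, partialU f x (v.rep x) * ξ.rep x ^ 2

/-- Expressing the form at `v` through `dJ` leaves exactly the integrand of
`NL.second_variation_le`. For an almost critical `v` only the form on `w` and the negative integral
matter. -/
theorem Admissible.secondVariation_le (hf : Admissible θ μ f) (hV : StepanovBounded V)
    (v w : H1) (s : ℝ) :
    secondVariation χ V f v (s • v + w) ≤
      s ^ 2 * dJ χ V f v v + 2 * s * dJ χ V f v w + χ * schrodingerForm V w w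
        - (1 - θ) * ∫ x, partialU f x (v.rep x) * (s • v + w).rep x ^ 2 := by
  have hQ : schrodingerForm V (s • v + w) (s • v + w) = s ^ 2 * schrodingerForm V v v +
      2 * s * schrodingerForm V v w + schrodingerForm V w w := by
    have h1 : schrodingerForm V w v = schrodingerForm V v w := schrodingerForm_comm _ _ _
    simp only [← hV.form_apply, map_add, map_smul, add_apply, smul_apply, smul_eq_mul] at h1 ⊢
    rw [h1]
    ring
  have i1 : Integrable (fun x => s ^ 2 * (f x (v.rep x) * v.rep x)) volume :=
    (hf.integrable_comp_mul v v).const_mul _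
  have i2 : Integrable (fun x => 2 * s * (f x (v.rep x) * w.rep x)) volume :=
    (hf.integrable_comp_mul v w).const_mul _
  have i12 : Integrable (fun x => s ^ 2 * (f x (v.rep x) * v.rep x) +
      2 * s * (f x (v.rep x) * w.rep x)) volume := i1.add i2
  have i3 := hf.integrable_partialU_sq v (s • v + w)
  have key : ∫ x, (s ^ 2 * (f x (v.rep x) * v.rep x) + 2 * s * (f x (v.rep x) * w.rep x) -
      partialU f x (v.rep x) * (s • v + w).rep x ^ 2) ≤
      ∫ x, -(1 - θ) * (partialU f x (v.rep x) * (s • v + w).rep x ^ 2) := by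
    refine integral_mono_ae (i12.sub i3) (i3.const_mul _) ?_
    filter_upwards [hf.nl] with x hx
    have := hx.second_variation_le s (v.rep x) (w.rep x)
    simp only [H1.rep_add, H1.rep_smul]
    exact this
  rw [integral_sub i12 i3, integral_add i1 i2, integral_const_mul, integral_const_mul,
    integral_const_mul] at key
  rw [secondVariation, hQ, dJ, dJ]
  linarith

/-- The form controls the `w` direction. The `v` direction is controlled by the integral term,
through `(sv + w)² ≥ s²v²/2 - w²`. All constants depend on `v` only through `R` and `D`. -/
theorem Admissible.exists_secondVariation_neg (hf : Admissible θ μ f)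
    (hV : StepanovBounded V) {E : Submodule ℝ H1} {P : H1 →L[ℝ] H1} {α : ℝ}
    (hE : FormDichotomy χ V E P α) {R D : ℝ} (hR : 0 ≤ R) (hD : 0 < D) :
    ∃ β > 0, ∃ ε₀ > 0, ∀ v : H1, ‖v‖ ≤ R → D ≤ ∫ x, partialU f x (v.rep x) * v.rep x ^ 2 →
      (∀ ξ, |dJ χ V f v ξ| ≤ ε₀ * ‖ξ‖) → ∀ (s : ℝ), ∀ w ∈ E,
        secondVariation χ V f v (s • v + w) ≤ -(β * ‖s • v + w‖ ^ 2) := by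
  have hα := hE.pos
  obtain ⟨n, hn⟩ := exists_nat_ge (2 * R)
  set C := μ n * n with hC
  have hC0 : 0 ≤ C := mul_nonneg (hf.mu_nonneg n) (Nat.cast_nonneg n)
  set τ := 1 - θ with hτ
  have hτ0 : 0 < τ := by linarith [hf.theta_lt]
  have hτ1 : τ ≤ 1 := by linarith [hf.theta_pos]
  -- Only the fraction `η` of the negative integral is used, so that the loss `C‖w‖²` costs at most
  -- `α‖w‖²/4`.
  set η := min 1 (α / (4 * (C + 1)))
  have hη0 : 0 < η := lt_min one_pos (by positivity)
  have hη1 : η ≤ 1 := min_le_left _ _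
  have hηC : η * C ≤ α / 4 := by
    have h1 : η ≤ α / (4 * (C + 1)) := min_le_right _ _
    rw [le_div_iff₀ (by positivity)] at h1
    nlinarith
  set γ := τ * η * D / 4
  have hγ : 0 < γ := by positivity
  -- The integral yields a gain `2γs²`. The almost critical terms use at most `γs²` and `α‖w‖²/4` of
  -- the available negativity; what remains, `γs²` and `α‖w‖²/2`, dominates `β‖sv + w‖²`.
  set ε₀ := min (α / 4) (γ / (R + 1))
  have hε0 : 0 < ε₀ := lt_min (by positivity) (by positivity)
  set β := min (α / 4) (γ / (2 * (R ^ 2 + 1)))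
  have hβ : 0 < β := lt_min (by positivity) (by positivity)
  refine ⟨β, hβ, ε₀, hε0, fun v hv hDv hε s w hw => ?_⟩
  refine (hf.secondVariation_le hV v w s).trans ?_
  have h1 : s ^ 2 * dJ χ V f v v ≤ s ^ 2 * (ε₀ * R) := by
    refine mul_le_mul_of_nonneg_left ?_ (sq_nonneg s)
    exact (le_abs_self _).trans ((hε v).trans (mul_le_mul_of_nonneg_left hv hε0.le))
  have h2 : 2 * (s * dJ χ V f v w) ≤ ε₀ * (s ^ 2 + ‖w‖ ^ 2) := by
    have h3 : s * dJ χ V f v w ≤ |s| * (ε₀ * ‖w‖) := by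
      refine (le_abs_self _).trans ?_
      rw [abs_mul]
      exact mul_le_mul_of_nonneg_left (hε w) (abs_nonneg s)
    have h4 : 2 * (|s| * ‖w‖) ≤ s ^ 2 + ‖w‖ ^ 2 := by
      rw [← sq_abs s]
      nlinarith [sq_nonneg (|s| - ‖w‖)]
    have h5 := mul_le_mul_of_nonneg_left h4 hε0.le
    linarith
  have h3 := hE.neg_on w hw
  set I := ∫ x, partialU f x (v.rep x) * (s • v + w).rep x ^ 2
  have hI0 : 0 ≤ I := by
    refine integral_nonneg_of_ae ?_
    filter_upwards [hf.nl] with x hx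
    exact mul_nonneg (hx.deriv_nonneg hf.theta_pos _) (sq_nonneg _)
  have hI : s ^ 2 / 2 * D - C * ‖w‖ ^ 2 ≤ I := by
    have i1 : Integrable (fun x => s ^ 2 / 2 * (partialU f x (v.rep x) * v.rep x ^ 2)) volume :=
      (hf.integrable_partialU_sq v v).const_mul _
    have i2 := hf.integrable_partialU_sq v w
    have h4 : ∫ x, (s ^ 2 / 2 * (partialU f x (v.rep x) * v.rep x ^ 2) -
        partialU f x (v.rep x) * w.rep x ^ 2) ≤ I := by
      refine integral_mono_ae (i1.sub i2) (hf.integrable_partialU_sq v (s • v + w)) ?_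
      filter_upwards [hf.nl] with x hx
      have h5 : 0 ≤ partialU f x (v.rep x) := hx.deriv_nonneg hf.theta_pos _
      simp only [H1.rep_add, H1.rep_smul]
      have h6 : s ^ 2 / 2 * v.rep x ^ 2 - w.rep x ^ 2 ≤ (s * v.rep x + w.rep x) ^ 2 := by
        nlinarith [sq_nonneg (s * v.rep x + 2 * w.rep x)]
      have := mul_le_mul_of_nonneg_left h6 h5
      linarith
    rw [integral_sub i1 i2, integral_const_mul] at h4
    have h7 := hf.partialU_integral_le (n := n) (v := v) (by linarith) w
    have h8 := mul_le_mul_of_nonneg_left hDv (show 0 ≤ s ^ 2 / 2 by positivity)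
    linarith
  have hτI : τ * (η * (s ^ 2 / 2 * D - C * ‖w‖ ^ 2)) ≤ τ * I := by
    refine mul_le_mul_of_nonneg_left ?_ hτ0.le
    exact (mul_le_mul_of_nonneg_left hI hη0.le).trans (mul_le_of_le_one_left hI0 hη1)
  have h4 : τ * (η * (C * ‖w‖ ^ 2)) ≤ α / 4 * ‖w‖ ^ 2 := by
    have h5 : η * (C * ‖w‖ ^ 2) ≤ α / 4 * ‖w‖ ^ 2 := by
      rw [← mul_assoc]; exact mul_le_mul_of_nonneg_right hηC (sq_nonneg _)
    have h6 : 0 ≤ η * (C * ‖w‖ ^ 2) := by positivity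
    nlinarith
  have hεα : ε₀ * ‖w‖ ^ 2 ≤ α / 4 * ‖w‖ ^ 2 :=
    mul_le_mul_of_nonneg_right (min_le_left _ _) (sq_nonneg _)
  have hεγ : ε₀ * (R + 1) * s ^ 2 ≤ γ * s ^ 2 := by
    refine mul_le_mul_of_nonneg_right ?_ (sq_nonneg _)
    have h5 : ε₀ ≤ γ / (R + 1) := min_le_right _ _
    rwa [le_div_iff₀ (by positivity)] at h5
  have hξ : ‖s • v + w‖ ^ 2 ≤ 2 * (R ^ 2 * s ^ 2) + 2 * ‖w‖ ^ 2 := by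
    have h5 : ‖s • v + w‖ ≤ R * |s| + ‖w‖ := by
      refine (norm_add_le _ _).trans ?_
      rw [norm_smul, Real.norm_eq_abs, mul_comm R]
      linarith [mul_le_mul_of_nonneg_left hv (abs_nonneg s)]
    have h6 := pow_le_pow_left₀ (norm_nonneg _) h5 2
    rw [← sq_abs s]
    nlinarith [sq_nonneg (R * |s| - ‖w‖)]
  have hβ1 : β * ‖w‖ ^ 2 ≤ α / 4 * ‖w‖ ^ 2 :=
    mul_le_mul_of_nonneg_right (min_le_left _ _) (sq_nonneg _)
  have hβ2 : 2 * (β * R ^ 2 * s ^ 2) ≤ γ * s ^ 2 := by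
    have h5 : β ≤ γ / (2 * (R ^ 2 + 1)) := min_le_right _ _
    rw [le_div_iff₀ (by positivity)] at h5
    have h6 : 2 * (β * R ^ 2) ≤ γ := by nlinarith
    have := mul_le_mul_of_nonneg_right h6 (sq_nonneg s)
    linarith
  have hβξ := mul_le_mul_of_nonneg_left hξ hβ.le
  have hγs : τ * (η * (s ^ 2 / 2 * D)) = 2 * (γ * s ^ 2) := by
    simp only [γ]; ring
  rw [← hτ]
  clear_value I β γ ε₀ η τ C
  linarith

/-- Maximize `J` over a small ball of `v + X`, where `X = E + ℝv`. The maximum `v + ξ` is critical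
in all directions of `X`, which contains `E` and `v + ξ` itself; it is nonzero because of `D`. It is
therefore a Nehari point, and `J(v + ξ) ≤ J(v) + ε‖ξ‖`. -/
theorem Admissible.nehariLevel_le (hf : Admissible θ μ f) (hχ : χ = 1 ∨ χ = -1)
    (hV : StepanovBounded V) {P : H1 →L[ℝ] H1} {α : ℝ}
    (hE : FormDichotomy χ V (nehariSubspace χ V) P α) (hm : 0 < nehariLevel χ V f)
    {R D δ : ℝ} (hR : 0 ≤ R) (hD : 0 < D) (hδ : 0 < δ) :
    ∃ ε > 0, ∀ v : H1, ‖v‖ ≤ R → D ≤ ∫ x, partialU f x (v.rep x) * v.rep x ^ 2 →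
      (∀ ξ, |dJ χ V f v ξ| ≤ ε * ‖ξ‖) → nehariLevel χ V f ≤ functionalJ χ V f v + δ := by
  set J := functionalJ χ V f
  -- The infimum of a set unbounded below is `0` by convention, which contradicts `0 < m`.
  have hbdd : BddBelow (J '' nehariManifold χ V f) := by
    by_contra h
    rw [nehariLevel, Real.sInf_of_not_bddBelow h] at hm
    exact lt_irrefl _ hm
  obtain ⟨β, hβ, ε₀, hε₀, hneg⟩ := hf.exists_secondVariation_neg (χ := χ) hV hE hR hD
  obtain ⟨n, hn⟩ := exists_nat_ge (2 * (2 * R + 3))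
  have hμ := hf.mu_nonneg n
  set C := μ n * n
  have hC : 0 ≤ C := mul_nonneg hμ (Nat.cast_nonneg n)
  -- The second entry makes the Taylor remainder small against `β`; the third excludes `v = -ξ`,
  -- which would make `∫ f_u(x, v) v²` smaller than `D`.
  set ρ := min 1 (min (β / (16 * (μ n + 1))) (D / (2 * (C + 1))))
  have hρ : 0 < ρ := lt_min one_pos (lt_min (by positivity) (by positivity))
  have hρ1 : ρ ≤ 1 := min_le_left _ _
  have hρβ : 16 * μ n * ρ ≤ β := by
    have h1 : ρ ≤ β / (16 * (μ n + 1)) := (min_le_right _ _).trans (min_le_left _ _)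
    rw [le_div_iff₀ (by positivity)] at h1
    nlinarith
  have hρD : ρ * C < D := by
    have h1 : ρ ≤ D / (2 * (C + 1)) := (min_le_right _ _).trans (min_le_right _ _)
    rw [le_div_iff₀ (by positivity)] at h1
    nlinarith
  -- The bound `βρ/8` makes the linear term `ερ` smaller than `βρ²/4`, so that `J` on the sphere of
  -- radius `ρ` stays below `J(v)`.
  refine ⟨min ε₀ (min (β * ρ / 8) δ), lt_min hε₀ (lt_min (by positivity) hδ),
    fun v hv hDv hdJ => ?_⟩
  set ε := min ε₀ (min (β * ρ / 8) δ)
  have hεβ : ε ≤ β * ρ / 8 := (min_le_right _ _).trans (min_le_left _ _)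
  have hεδ : ε ≤ δ := (min_le_right _ _).trans (min_le_right _ _)
  have hε0 : 0 < ε := lt_min hε₀ (lt_min (by positivity) hδ)
  set X : Submodule ℝ H1 := nehariSubspace χ V ⊔ Submodule.span ℝ {v}
  have hX : IsClosed (X : Set H1) := Submodule.isClosed_sup_finiteDimensional _ _ hE.closed
  have hvX : v ∈ X := Submodule.mem_sup_right (Submodule.mem_span_singleton_self v)
  have hq : ∀ ξ ∈ X, secondVariation χ V f v ξ ≤ -(β * ‖ξ‖ ^ 2) := by
    intro ξ hξ
    obtain ⟨w, hw, y, hy, rfl⟩ := Submodule.mem_sup.1 hξ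
    obtain ⟨s, rfl⟩ := Submodule.mem_span_singleton.1 hy
    rw [add_comm]
    exact hneg v hv hDv (fun ξ => (hdJ ξ).trans (mul_le_mul_of_nonneg_right (min_le_left _ _)
      (norm_nonneg _))) s w hw
  have hup : ∀ ξ ∈ X, ‖ξ‖ ≤ ρ → J (v + ξ) ≤ J v + ε * ‖ξ‖ - β / 4 * ‖ξ‖ ^ 2 := by
    intro ξ hξ hξρ
    have h1 := (abs_le.1 (hf.abs_expansion_le hχ hV v v ξ (n := n) (by linarith))).2
    rw [sub_self, norm_zero, zero_add] at h1
    have h2 := hq ξ hξ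
    rw [secondVariation] at h2
    have h3 := (le_abs_self _).trans (hdJ ξ)
    have h4 : 2 * μ n * ‖ξ‖ * ‖ξ‖ ^ 2 ≤ β / 8 * ‖ξ‖ ^ 2 := by
      refine mul_le_mul_of_nonneg_right ?_ (sq_nonneg _)
      have := mul_le_mul_of_nonneg_left hξρ hμ
      linarith
    have h5 : 0 ≤ β * ‖ξ‖ ^ 2 := by positivity
    linarith
  obtain ⟨ξ, hξX, hξρ, hmax⟩ := exists_max_of_midpoint_concave hX (Φ := fun ξ => J (v + ξ))
    ((hf.continuous_functionalJ hχ hV).comp (continuous_const.add continuous_id))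
    (κ := β / 8) (K := J v + ε * ρ) hρ (by positivity) (by
      intro a ha b hb haρ hbρ
      -- Expand about the midpoint `c` in the directions `d` and `-d`: the linear terms cancel, and
      -- the quadratic part, frozen at `v`, is negative on `X`.
      set c := v + (2⁻¹ : ℝ) • (a + b) with hc
      set d := (2⁻¹ : ℝ) • (a - b) with hd
      have hab : ‖(2⁻¹ : ℝ) • (a + b)‖ ≤ ρ := by
        rw [norm_smul, Real.norm_of_nonneg (by norm_num)]
        linarith [norm_add_le a b]
      have hdn : ‖d‖ = ‖a - b‖ / 2 := by
        rw [hd, norm_smul, Real.norm_of_nonneg (by norm_num)]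
        ring
      have hdρ : ‖d‖ ≤ ρ := by
        rw [hdn]; linarith [norm_sub_le a b]
      have hcn : ‖c‖ ≤ R + ρ := (norm_add_le _ _).trans (add_le_add hv hab)
      have hcv : c - v = (2⁻¹ : ℝ) • (a + b) := add_sub_cancel_left _ _
      have e1 : c + d = v + a := by
        rw [hc, hd, add_assoc, ← smul_add]
        congr 1
        rw [show a + b + (a - b) = (2 : ℝ) • a by rw [two_smul]; abel, smul_smul]
        norm_num
      have e2 : c + -d = v + b := by
        rw [hc, hd, add_assoc, ← smul_neg, ← smul_add]
        congr 1
        rw [show a + b + -(a - b) = (2 : ℝ) • b by rw [two_smul]; abel, smul_smul]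
        norm_num
      have h1 := (abs_le.1 (hf.abs_expansion_le hχ hV v c d (n := n) (by linarith))).2
      have h2 := (abs_le.1 (hf.abs_expansion_le hχ hV v c (-d) (n := n)
        (by rw [norm_neg]; linarith))).2
      have h3 : dJ χ V f c (-d) = -dJ χ V f c d := by
        rw [← hf.dJL_apply χ hV, ← hf.dJL_apply χ hV, map_neg]
      have h4 : schrodingerForm V (-d) (-d) = schrodingerForm V d d := by
        simp only [← hV.form_apply, map_neg, neg_apply, neg_neg]
      simp only [H1.rep_neg, neg_sq] at h2
      rw [e2, h3, h4, norm_neg, hcv] at h2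
      rw [e1, hcv] at h1
      have h5 := hq d (X.smul_mem _ (X.sub_mem ha hb))
      rw [secondVariation] at h5
      have h6 : 2 * μ n * (‖(2⁻¹ : ℝ) • (a + b)‖ + ‖d‖) * ‖d‖ ^ 2 ≤ β / 4 * ‖d‖ ^ 2 := by
        refine mul_le_mul_of_nonneg_right ?_ (sq_nonneg _)
        have := mul_le_mul_of_nonneg_left (add_le_add hab hdρ) hμ
        linarith
      have h7 : ‖a - b‖ ^ 2 = 4 * ‖d‖ ^ 2 := by rw [hdn]; ring
      change J (v + a) + J (v + b) + β / 8 * ‖a - b‖ ^ 2 ≤ 2 * J c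
      rw [h7]
      change J (v + a) - J c - _ - _ ≤ _ at h1
      change J (v + b) - J c - _ - _ ≤ _ at h2
      linarith)
    (fun a ha haρ => by
      have h1 := hup a ha haρ
      have h2 := mul_le_mul_of_nonneg_left haρ hε0.le
      have h3 : 0 ≤ β / 4 * ‖a‖ ^ 2 := by positivity
      linarith)
    (fun a ha haρ => by
      have h1 := hup a ha haρ.le
      rw [haρ] at h1
      have h2 := mul_le_mul_of_nonneg_right hεβ hρ.le
      have h3 : 0 < β * ρ ^ 2 := by positivity
      rw [add_zero]
      nlinarith)
  have hcrit : ∀ y ∈ X, fderiv ℝ J (v + ξ) y = 0 := by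
    intro y hy
    have hd := hf.hasFDerivAt hχ hV (v + ξ)
    have hline : HasDerivAt (fun t : ℝ => v + ξ + t • y) y 0 := by
      simpa using ((hasDerivAt_id (0 : ℝ)).smul_const y).const_add (v + ξ)
    have hcomp : HasDerivAt (fun t : ℝ => J (v + ξ + t • y)) (hf.dJL χ hV (v + ξ) y) 0 := by
      have hd' : HasFDerivAt J (hf.dJL χ hV (v + ξ)) (v + ξ + (0 : ℝ) • y) := by
        rw [zero_smul, add_zero]; exact hd
      exact hd'.comp_hasDerivAt (0 : ℝ) hline
    have hloc : IsLocalMax (fun t : ℝ => J (v + ξ + t • y)) 0 := by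
      have hcont : Continuous fun t : ℝ => ‖ξ + t • y‖ := by fun_prop
      have h1 : ∀ᶠ t : ℝ in 𝓝 0, ‖ξ + t • y‖ < ρ :=
        hcont.continuousAt.eventually_lt continuousAt_const (by simpa using hξρ)
      filter_upwards [h1] with t ht
      rw [zero_smul, add_zero, add_assoc]
      exact hmax _ (X.add_mem hξX (X.smul_mem t hy)) ht.le
    rw [hd.fderiv]
    exact hloc.hasDerivAt_eq_zero hcomp
  have hne : v + ξ ≠ 0 := by
    intro h
    have h1 : ‖v‖ < ρ := by
      rw [eq_neg_of_add_eq_zero_left h, norm_neg]; exact hξρ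
    have h2 := hf.partialU_integral_le (n := n) (v := v) (by linarith) v
    have h3 : ‖v‖ ^ 2 ≤ ρ := by nlinarith [norm_nonneg v]
    have h4 := mul_le_mul_of_nonneg_left h3 hC
    linarith
  have hmem : v + ξ ∈ nehariManifold χ V f :=
    ⟨hne, hcrit _ (X.add_mem hvX hξX), fun y hy => hcrit y (Submodule.mem_sup_left hy)⟩
  have h1 : nehariLevel χ V f ≤ J (v + ξ) := csInf_le hbdd (mem_image_of_mem J hmem)
  have h2 := hup ξ hξX hξρ.le
  have h3 : ε * ‖ξ‖ ≤ δ := by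
    have := mul_le_mul hεδ (hξρ.le.trans hρ1) (norm_nonneg _) hδ.le
    linarith
  have h4 : 0 ≤ β / 4 * ‖ξ‖ ^ 2 := by positivity
  linarith

/-! ### Limits of shifted equations -/

theorem Caratheodory.aemeasurable_iSup {g : ℝ → ℝ → ℝ} (hg : Caratheodory g) {R : ℝ}
    (hR : 0 ≤ R) : AEMeasurable (fun x => ⨆ u ∈ Icc (-R) R, ‖g x u‖ₑ) volume := by
  -- Clamped rationals are dense in `[-R, R]`, so the supremum becomes countable for `g x`
  -- continuous.
  set cl : ℝ → ℝ := fun y => max (-R) (min y R) with hcl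
  have hclc : Continuous cl := continuous_const.max (continuous_id.min continuous_const)
  have h1 : AEMeasurable (fun x => ⨆ q : ℚ, ‖g x (cl q)‖ₑ) volume :=
    AEMeasurable.iSup fun q => (hg.2 _).enorm
  refine h1.congr ?_
  filter_upwards [hg.1] with x hx
  refine le_antisymm (iSup_le fun q => ?_) (iSup₂_le fun u hu => ?_)
  · refine le_iSup₂ (f := fun u (_ : u ∈ Icc (-R) R) => ‖g x u‖ₑ) (cl q) ?_
    exact ⟨le_max_left _ _, max_le (by linarith) (min_le_right _ _)⟩
  · have hcont : Continuous fun y => ‖g x (cl y)‖ₑ := (hx.comp hclc).enorm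
    have hu' : cl u = u := by
      rw [hcl]
      simp only
      rw [min_eq_left hu.2, max_eq_right hu.1]
    have hclosed : IsClosed {y | ‖g x (cl y)‖ₑ ≤ ⨆ q : ℚ, ‖g x (cl q)‖ₑ} :=
      isClosed_le hcont continuous_const
    have := (Rat.denseRange_cast (𝕜 := ℝ)).induction_on
      (p := fun y => ‖g x (cl y)‖ₑ ≤ ⨆ q : ℚ, ‖g x (cl q)‖ₑ) u hclosed
      fun q => le_iSup (fun q : ℚ => ‖g x (cl q)‖ₑ) q
    rwa [hu'] at this

/-- A Borel–Cantelli argument: pass to a subsequence along which the seminorm of radius `k + 1` is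
at most `2⁻ᵏ`. On each unit cell the suprema then have a finite sum almost everywhere, so they tend
to zero. -/
theorem exists_subseq_ae_tendsto {h : ℕ → ℝ → ℝ → ℝ} (hc : ∀ k, Caratheodory (h k))
    (hlim : ∀ R > 0, Tendsto (fun k => stepanovSeminorm R (h k)) atTop (𝓝 0)) :
    ∃ φ : ℕ → ℕ, StrictMono φ ∧
      ∀ᵐ x : ℝ, ∀ u : ℝ, Tendsto (fun k => h (φ k) x u) atTop (𝓝 0) := by
  have hev : ∀ n : ℕ, ∀ᶠ k in atTop,
      stepanovSeminorm ((n : ℝ) + 1) (h k) ≤ (2⁻¹ : ℝ≥0∞) ^ n := fun n =>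
    (hlim (n + 1) (by positivity)).eventually_le_const (ENNReal.pow_pos (by simp) n)
  obtain ⟨φ, hφ, hφb⟩ := extraction_forall_of_eventually hev
  refine ⟨φ, hφ, ?_⟩
  -- Starting the sequence at `N` ensures that the fixed radius `N + 1` never exceeds the radius `k
  -- + N + 1` of the estimate.
  set S : ℕ → ℕ → ℝ → ℝ≥0∞ := fun N k x =>
    ⨆ u ∈ Icc (-((N : ℝ) + 1)) ((N : ℝ) + 1), ‖h (φ (k + N)) x u‖ₑ with hS
  have hSm : ∀ N k, AEMeasurable (S N k) volume := fun N k =>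
    (hc _).aemeasurable_iSup (by positivity)
  have hSint : ∀ (N k : ℕ) (t : ℝ), ∫⁻ x in Icc t (t + 1), S N k x ≤ (2⁻¹ : ℝ≥0∞) ^ k := by
    intro N k t
    have h1 : ∫⁻ x in Icc t (t + 1), S N k x ≤
        stepanovSeminorm (((k + N : ℕ) : ℝ) + 1) (h (φ (k + N))) := by
      refine le_trans (lintegral_mono fun x => ?_) (le_iSup (fun t : ℝ => ∫⁻ x in Icc t (t + 1),
        ⨆ u ∈ Icc (-(((k + N : ℕ) : ℝ) + 1)) (((k + N : ℕ) : ℝ) + 1), ‖h (φ (k + N)) x u‖ₑ) t)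
      refine biSup_mono fun u hu => ?_
      have hk : (0 : ℝ) ≤ k := Nat.cast_nonneg k
      push_cast
      exact ⟨by linarith [hu.1], by linarith [hu.2]⟩
    refine h1.trans ((hφb (k + N)).trans ?_)
    exact pow_le_pow_right_of_le_one' (by simp) (Nat.le_add_right k N)
  have hae : ∀ N : ℕ, ∀ᵐ x : ℝ, Tendsto (fun k => S N k x) atTop (𝓝 0) := by
    intro N
    have hcell : ∀ m : ℤ, ∀ᵐ x : ℝ ∂(volume.restrict (Icc (m : ℝ) (m + 1))),
        Tendsto (fun k => S N k x) atTop (𝓝 0) := by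
      intro m
      have h1 : ∫⁻ x in Icc (m : ℝ) (m + 1), ∑' k, S N k x ≠ ⊤ := by
        rw [lintegral_tsum fun k => (hSm N k).restrict]
        refine ne_top_of_le_ne_top ?_ (ENNReal.tsum_le_tsum fun k => hSint N k m)
        rw [ENNReal.tsum_geometric]
        simp
      filter_upwards [ae_lt_top' (AEMeasurable.tsum fun k => (hSm N k).restrict) h1]
        with x hx
      exact ENNReal.tendsto_atTop_zero_of_tsum_ne_top hx.ne
    have h2 := (ae_restrict_iUnion_iff (μ := volume) (fun m : ℤ => Icc (m : ℝ) (m + 1))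
      (fun x => Tendsto (fun k => S N k x) atTop (𝓝 0))).2 hcell
    rwa [iUnion_Icc_intCast, Measure.restrict_univ] at h2
  filter_upwards [ae_all_iff.2 hae] with x hx u
  obtain ⟨N, hN⟩ := exists_nat_ge |u|
  have hu : u ∈ Icc (-((N : ℝ) + 1)) ((N : ℝ) + 1) := by
    rw [mem_Icc, ← abs_le]; linarith
  refine (tendsto_add_atTop_iff_nat N).1 ?_
  rw [tendsto_zero_iff_norm_tendsto_zero]
  have h3 : Tendsto (fun k => ‖h (φ (k + N)) x u‖ₑ) atTop (𝓝 0) :=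
    tendsto_of_tendsto_of_tendsto_of_le_of_le tendsto_const_nhds (hx N) (fun _ => zero_le)
      fun k => le_iSup₂ (f := fun u (_ : u ∈ Icc (-((N : ℝ) + 1)) ((N : ℝ) + 1)) =>
        ‖h (φ (k + N)) x u‖ₑ) u hu
  have h4 := (ENNReal.tendsto_toReal ENNReal.zero_ne_top).comp h3
  simpa [Function.comp_def] using h4

theorem NL.eq_integral_deriv {θ : ℝ} {μ : ℕ → ℝ} {g : ℝ → ℝ} (h : NL θ μ g) (u : ℝ) :
    ∫ s in (0 : ℝ)..u, deriv g s = g u := by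
  rw [intervalIntegral.integral_deriv_eq_sub (fun x _ => h.differentiable x)
    (h.continuous_deriv.intervalIntegrable _ _), h.zero, sub_zero]

theorem tendsto_intervalIntegral_of_bounded {g : ℕ → ℝ → ℝ} {G : ℝ → ℝ} {u C : ℝ}
    (hc : ∀ k, Continuous (g k)) (hb : ∀ k s, |s| ≤ |u| → |g k s| ≤ C)
    (hlim : ∀ s, Tendsto (fun k => g k s) atTop (𝓝 (G s))) :
    Tendsto (fun k => ∫ s in (0 : ℝ)..u, g k s) atTop (𝓝 (∫ s in (0 : ℝ)..u, G s)) := by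
  refine intervalIntegral.tendsto_integral_filter_of_dominated_convergence (fun _ => C)
    (Eventually.of_forall fun k => (hc k).aestronglyMeasurable)
    (Eventually.of_forall fun k => Eventually.of_forall fun s hs => hb k s ?_)
    intervalIntegrable_const (Eventually.of_forall fun s _ => hlim s)
  rw [mem_uIoc] at hs
  rcases hs with hs | hs
  · rw [abs_of_pos hs.1, abs_of_pos (hs.1.trans_le hs.2)]; exact hs.2
  · rw [abs_of_nonpos hs.2, abs_of_neg (hs.1.trans_le hs.2)]; linarith [hs.1]

/-- The limit of nonlinearities with convergent derivatives. -/
theorem NL.limit {θ : ℝ} {μ : ℕ → ℝ} (hθ : 0 < θ) (hμ : ∀ n, 0 ≤ μ n) {g : ℕ → ℝ → ℝ}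
    (hg : ∀ k, NL θ μ (g k)) {h : ℝ → ℝ} (hh : Continuous h)
    (hlim : ∀ u, Tendsto (fun k => deriv (g k) u) atTop (𝓝 (h u)))
    (hlow : ∀ q : ℚ, q ≠ 0 → ∃ δ > 0, ∀ k, δ ≤ ∫ s in (0 : ℝ)..q, g k s) :
    NL θ μ (fun u => ∫ s in (0 : ℝ)..u, h s) ∧
      (∀ u, Tendsto (fun k => g k u) atTop (𝓝 (∫ s in (0 : ℝ)..u, h s))) ∧
      ∀ u, Tendsto (fun k => ∫ s in (0 : ℝ)..u, g k s) atTop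
        (𝓝 (∫ s in (0 : ℝ)..u, ∫ y in (0 : ℝ)..s, h y)) := by
  set G : ℝ → ℝ := fun u => ∫ s in (0 : ℝ)..u, h s with hG
  have hGd : ∀ u, HasDerivAt G (h u) u := fun u =>
    intervalIntegral.integral_hasDerivAt_right (hh.intervalIntegrable _ _)
      (hh.stronglyMeasurableAtFilter _ _) hh.continuousAt
  have hGderiv : deriv G = h := funext fun u => (hGd u).deriv
  have hbound : ∀ (u : ℝ) (n : ℕ), |u| ≤ n → ∀ k s, |s| ≤ |u| →
      |deriv (g k) s| ≤ μ n * n ∧ |g k s| ≤ μ n * n * n := by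
    intro u n hn k s hs
    have hsn := hs.trans hn
    exact ⟨((hg k).abs_deriv_le hsn).trans (mul_le_mul_of_nonneg_left hsn (hμ n)),
      ((hg k).abs_le' (hμ n) hsn).trans (mul_le_mul_of_nonneg_left hsn
        (mul_nonneg (hμ n) (Nat.cast_nonneg n)))⟩
  have hf : ∀ u, Tendsto (fun k => g k u) atTop (𝓝 (G u)) := fun u => by
    obtain ⟨n, hn⟩ := exists_nat_ge |u|
    have := tendsto_intervalIntegral_of_bounded (u := u) (fun k => (hg k).continuous_deriv)
      (fun k s hs => (hbound u n hn k s hs).1) hlim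
    simpa only [NL.eq_integral_deriv (hg _)] using this
  have hF : ∀ u, Tendsto (fun k => ∫ s in (0 : ℝ)..u, g k s) atTop
      (𝓝 (∫ s in (0 : ℝ)..u, G s)) := fun u => by
    obtain ⟨n, hn⟩ := exists_nat_ge |u|
    exact tendsto_intervalIntegral_of_bounded (u := u) (fun k => (hg k).continuous)
      (fun k s hs => (hbound u n hn k s hs).2) hf
  have hmono : Monotone G := fun a b hab =>
    le_of_tendsto_of_tendsto' (hf a) (hf b) fun k => (hg k).monotone hθ hab
  have hGc : Continuous G := continuous_iff_continuousAt.2 fun u => (hGd u).continuousAt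
  have hG0 : G 0 = 0 := intervalIntegral.integral_same
  -- A strict sign may be lost in the limit. It is recovered from the lower bounds on the
  -- primitives: were `G u` zero or of the wrong sign, monotonicity would contradict positivity of
  -- the primitive at a rational between `0` and `u`.
  have hpos : ∀ q : ℚ, q ≠ 0 → 0 < ∫ s in (0 : ℝ)..q, G s := fun q hq => by
    obtain ⟨δ, hδ, hle⟩ := hlow q hq
    exact hδ.trans_le (ge_of_tendsto' (hF q) hle)
  refine ⟨⟨?_, hG0, ?_, ?_, ?_, ?_⟩, hf, hF⟩
  · rw [contDiff_one_iff_deriv, hGderiv]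
    exact ⟨fun u => (hGd u).differentiableAt, hh⟩
  · rw [hGderiv]
    refine tendsto_nhds_unique (hlim 0) ?_
    simp only [(hg _).deriv_zero]
    exact tendsto_const_nhds
  · intro n u v hu hv
    rw [hGderiv]
    exact le_of_tendsto' ((hlim u).sub (hlim v)).abs fun k => (hg k).lipschitz n u v hu hv
  · intro u hu
    rcases lt_or_gt_of_ne hu with h0 | h0
    · obtain ⟨q, hq1, hq2⟩ := exists_rat_btwn h0
      have hq0 : q ≠ 0 := by
        rintro rfl
        simp at hq2
      refine mul_pos_of_neg_of_neg ?_ h0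
      by_contra hcon
      have h1 := hpos q hq0
      rw [intervalIntegral.integral_symm] at h1
      have h2 : 0 ≤ ∫ s in (q : ℝ)..0, G s := intervalIntegral.integral_nonneg hq2.le
        fun s hs => (not_lt.1 hcon).trans (hmono (hq1.le.trans hs.1))
      linarith
    · obtain ⟨q, hq1, hq2⟩ := exists_rat_btwn h0
      have hq0 : q ≠ 0 := by
        rintro rfl
        simp at hq1
      refine mul_pos ?_ h0
      by_contra hcon
      have h1 := hpos q hq0
      have h2 : 0 ≤ ∫ s in (0 : ℝ)..q, -G s := intervalIntegral.integral_nonneg hq1.le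
        fun s hs => neg_nonneg.2 ((hmono (hs.2.trans hq2.le)).trans (not_lt.1 hcon))
      rw [intervalIntegral.integral_neg] at h2
      linarith
  · intro u
    rw [hGderiv]
    exact le_of_tendsto_of_tendsto' ((hf u).mul_const u)
      (((hlim u).mul_const (u ^ 2)).const_mul θ) fun k => (hg k).superlinear u

/-- `(V', f')` is the limit of the shifts of `(V, f)` along `z`, in the Stepanov norm for the
potential and almost everywhere for the nonlinearity. -/
structure ShiftLimit (θ : ℝ) (μ : ℕ → ℝ) (V : ℝ → ℝ) (f : ℝ → ℝ → ℝ) (z : ℕ → ℝ) (V' : ℝ → ℝ)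
    (f' : ℝ → ℝ → ℝ) : Prop where
  bounded : StepanovBounded V'
  admissible : Admissible θ μ f'
  potential : Tendsto (fun k => stepanovNorm (fun x => V (x + z k) - V' x)) atTop (𝓝 0)
  primitive : ∀ᵐ x : ℝ, ∀ u : ℝ,
    Tendsto (fun k => primitive f (x + z k) u) atTop (𝓝 (primitive f' x u))
  self : ∀ᵐ x : ℝ, ∀ u : ℝ, Tendsto (fun k => f (x + z k) u) atTop (𝓝 (f' x u))
  partialU : ∀ᵐ x : ℝ, ∀ u : ℝ,
    Tendsto (fun k => partialU f (x + z k) u) atTop (𝓝 (partialU f' x u))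

theorem shiftLimit_zero {θ : ℝ} {μ : ℕ → ℝ} {V : ℝ → ℝ} {f : ℝ → ℝ → ℝ}
    (hV : StepanovBounded V) (hf : Admissible θ μ f) :
    ShiftLimit θ μ V f (fun _ => 0) V f where
  bounded := hV
  admissible := hf
  potential := by
    simp only [add_zero, sub_self]
    simp [stepanovNorm]
  primitive := by simp
  self := by simp
  partialU := by simp

theorem stepanovSeminorm_congr {R : ℝ} {g h : ℝ → ℝ → ℝ} (H : ∀ᵐ x : ℝ, ∀ u, g x u = h x u) :
    stepanovSeminorm R g = stepanovSeminorm R h := by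
  unfold stepanovSeminorm
  refine iSup_congr fun t => lintegral_congr_ae (ae_restrict_of_ae ?_)
  filter_upwards [H] with x hx
  simp only [hx]

theorem Caratheodory.shift_sub {g g' : ℝ → ℝ → ℝ} (hg : Caratheodory g) (hg' : Caratheodory g')
    (z : ℝ) : Caratheodory fun x u => g (x + z) u - g' x u := by
  refine ⟨?_, fun u => (shift_aestronglyMeasurable (hg.2 u) z).sub (hg'.2 u)⟩
  filter_upwards [shift_ae hg.1 z, hg'.1] with x h1 h2
  exact h1.sub h2

/-- Subsequences are extracted for the potential, for `f_u` in the seminorms, and for `f_u` almost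
everywhere. The limit nonlinearity is the primitive of the limit of `f_u`; convergence of `f` and
`F` then follows by integration in `u`. -/
theorem StandingAssumptions.exists_shiftLimit {χ : ℝ} {V : ℝ → ℝ} {f : ℝ → ℝ → ℝ}
    (hyp : StandingAssumptions χ V f) {θ : ℝ} {μ : ℕ → ℝ} (hf : Admissible θ μ f) (z : ℕ → ℝ) :
    ∃ φ : ℕ → ℕ, StrictMono φ ∧ ∃ V' f', InEnvelope V f V' f' ∧
      ShiftLimit θ μ V f (z ∘ φ) V' f' := by
  obtain ⟨φ₁, hφ₁, V', hV', hVlim⟩ := hyp.potential.2 z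
  obtain ⟨φ₂, hφ₂, g, hg, -, hglim⟩ := hyp.ap_partialU.2.2 (z ∘ φ₁)
  obtain ⟨φ₃, hφ₃, hae⟩ := exists_subseq_ae_tendsto
    (fun k => hyp.ap_partialU.1.shift_sub hg ((z ∘ φ₁) (φ₂ k))) hglim
  set φ := φ₁ ∘ φ₂ ∘ φ₃
  set f' : ℝ → ℝ → ℝ := fun x u => ∫ s in (0 : ℝ)..u, g x s with hf'
  have hVlim' : Tendsto (fun k => stepanovNorm fun x => V (x + (z ∘ φ) k) - V' x) atTop (𝓝 0) :=
    hVlim.comp (hφ₂.comp hφ₃).tendsto_atTop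
  choose! δ hδ hδF using hyp.primitive_lower
  have hnl : ∀ᵐ x : ℝ, ∀ k, NL θ μ (f (x + (z ∘ φ) k)) :=
    ae_all_iff.2 fun k => shift_ae hf.nl _
  -- The exceptional null set in the lower bound depends on `u`, so only rational `u` are used.
  have hlow : ∀ᵐ x : ℝ, ∀ (q : ℚ) (k : ℕ), q ≠ 0 →
      δ q ≤ StepanovNLS.primitive f (x + (z ∘ φ) k) q :=
    ae_all_iff.2 fun q => ae_all_iff.2 fun k => by
      by_cases hq : q = 0
      · exact Eventually.of_forall fun x h => absurd hq h
      · filter_upwards [shift_ae (hδF q (by exact_mod_cast hq)) ((z ∘ φ) k)] with x hx _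
        exact hx
  have hpu : ∀ᵐ x : ℝ, ∀ u, StepanovNLS.partialU f' x u = g x u := by
    filter_upwards [hg.1] with x hx u
    exact (intervalIntegral.integral_hasDerivAt_right (hx.intervalIntegrable _ _)
      (hx.stronglyMeasurableAtFilter _ _) hx.continuousAt).deriv
  have hlim : ∀ᵐ x : ℝ, NL θ μ (f' x) ∧
      (∀ u, Tendsto (fun k => f (x + (z ∘ φ) k) u) atTop (𝓝 (f' x u))) ∧
      (∀ u, Tendsto (fun k => StepanovNLS.primitive f (x + (z ∘ φ) k) u) atTop
        (𝓝 (StepanovNLS.primitive f' x u))) ∧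
      ∀ u, Tendsto (fun k => StepanovNLS.partialU f (x + (z ∘ φ) k) u) atTop
        (𝓝 (StepanovNLS.partialU f' x u)) := by
    filter_upwards [hae, hnl, hlow, hpu, hg.1] with x h1 h2 h3 h4 h5
    have h6 : ∀ u, Tendsto (fun k => StepanovNLS.partialU f (x + (z ∘ φ) k) u) atTop
        (𝓝 (g x u)) := fun u => by
      have := (h1 u).add_const (g x u)
      simp only [sub_add_cancel, zero_add] at this
      exact this
    obtain ⟨a, b, c⟩ := NL.limit hf.theta_pos hf.mu_nonneg h2 h5 h6 fun q hq =>
      ⟨δ q, hδ q (by exact_mod_cast hq), fun k => h3 q k hq⟩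
    exact ⟨a, b, c, fun u => by rw [h4]; exact h6 u⟩
  have hadm : Admissible θ μ f' :=
    { theta_pos := hf.theta_pos
      theta_lt := hf.theta_lt
      mu_nonneg := hf.mu_nonneg
      meas_primitive := fun u => aestronglyMeasurable_of_tendsto_ae atTop
        (fun k => shift_aestronglyMeasurable (hf.meas_primitive u) ((z ∘ φ) k))
        (hlim.mono fun x h => h.2.2.1 u)
      meas := fun u => aestronglyMeasurable_of_tendsto_ae atTop
        (fun k => shift_aestronglyMeasurable (hf.meas u) ((z ∘ φ) k))
        (hlim.mono fun x h => h.2.1 u)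
      meas_partialU := fun u => aestronglyMeasurable_of_tendsto_ae atTop
        (fun k => shift_aestronglyMeasurable (hf.meas_partialU u) ((z ∘ φ) k))
        (hlim.mono fun x h => h.2.2.2 u)
      nl := hlim.mono fun x h => h.1 }
  refine ⟨φ, hφ₁.comp (hφ₂.comp hφ₃), V', f', ⟨hV', hadm.meas,
    hadm.nl.mono fun x h => h.contDiff, hadm.nl.mono fun x h => h.zero, z ∘ φ, hVlim',
    fun R hR => ?_⟩, ⟨hV', hadm, hVlim', hlim.mono fun x h => h.2.2.1,
    hlim.mono fun x h => h.2.1, hlim.mono fun x h => h.2.2.2⟩⟩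
  have h1 := (hglim R hR).comp hφ₃.tendsto_atTop
  refine h1.congr fun k => stepanovSeminorm_congr ?_
  filter_upwards [hpu] with x hx u
  rw [hx]
  rfl

/-! ### Convergence of integrals -/

theorem abs_integral_mul_rep_le {g : ℝ → ℝ} (hg : MemLp g 2 volume) (φ : H1) :
    |∫ x, g x * φ.rep x| ≤ Real.sqrt (∫ x, g x ^ 2) * ‖φ‖ := by
  have h1 : ∫ x, g x * φ.rep x = ⟪hg.toLp g, φ.val⟫_ℝ := by
    rw [L2_inner_eq]
    refine integral_congr_ae ?_
    filter_upwards [hg.coeFn_toLp, φ.val_ae_eq_rep] with x h1 h2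
    rw [h1, h2]
  have h2 : ‖hg.toLp g‖ = Real.sqrt (∫ x, g x ^ 2) := by
    rw [← Real.sqrt_sq (norm_nonneg (hg.toLp g)), L2_norm_sq_eq]
    congr 1
    refine integral_congr_ae ?_
    filter_upwards [hg.coeFn_toLp] with x h1
    rw [h1]
  rw [h1, ← h2]
  exact (abs_real_inner_le_norm _ _).trans
    (mul_le_mul_of_nonneg_left φ.norm_val_le (norm_nonneg _))

theorem tendsto_integral_sq_of_dominated {g : ℕ → ℝ → ℝ} {C : ℝ} (w : H1)
    (hm : ∀ n, AEStronglyMeasurable (g n) volume)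
    (hb : ∀ n, ∀ᵐ x : ℝ, |g n x| ≤ C * |w.rep x|)
    (hlim : ∀ᵐ x : ℝ, Tendsto (fun n => g n x) atTop (𝓝 0)) :
    Tendsto (fun n => Real.sqrt (∫ x, g n x ^ 2)) atTop (𝓝 0) := by
  have h : Tendsto (fun n => ∫ x, g n x ^ 2) atTop (𝓝 (∫ _ : ℝ, (0 : ℝ))) := by
    refine tendsto_integral_of_dominated_convergence (fun x => C ^ 2 * w.rep x ^ 2)
      (fun n => (hm n).pow 2) (w.integrable_rep_sq.const_mul _) (fun n => ?_) ?_
    · filter_upwards [hb n] with x hx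
      rw [Real.norm_eq_abs, abs_pow, ← sq_abs (w.rep x), ← mul_pow]
      exact pow_le_pow_left₀ (abs_nonneg _) hx 2
    · filter_upwards [hlim] with x hx
      simpa using hx.pow 2
  rw [integral_zero] at h
  simpa using h.sqrt

/-- There is no common dominating function. By Young, `|h| ≤ η G² + φ²/(4η)`, so the positive part
of `|h| - η G²` is dominated by a fixed integrable function, and the discarded part contributes at
most `ηK`. -/
theorem tendsto_integral_abs_zero {h G : ℕ → ℝ → ℝ} {K : ℝ} (φ : H1)
    (hm : ∀ n, AEStronglyMeasurable (h n) volume) (hh : ∀ n, Integrable (h n) volume)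
    (hG : ∀ n, Integrable (fun x => G n x ^ 2) volume) (hK : ∀ n, ∫ x, G n x ^ 2 ≤ K)
    (hb : ∀ n, ∀ᵐ x : ℝ, |h n x| ≤ G n x * |φ.rep x|)
    (hlim : ∀ᵐ x : ℝ, Tendsto (fun n => h n x) atTop (𝓝 0)) :
    Tendsto (fun n => ∫ x, |h n x|) atTop (𝓝 0) := by
  have hK0 : 0 ≤ K := (integral_nonneg fun x => sq_nonneg (G 0 x)).trans (hK 0)
  refine Metric.tendsto_atTop.2 fun ε hε => ?_
  set η := ε / (2 * (K + 1))
  have hη : 0 < η := by positivity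
  set p : ℕ → ℝ → ℝ := fun n x => max (|h n x| - η * G n x ^ 2) 0 with hp
  have hpm : ∀ n, AEStronglyMeasurable (p n) volume := fun n =>
    ((hm n).norm.sub ((hG n).aestronglyMeasurable.const_mul η)).sup aestronglyMeasurable_const
  have hplim : Tendsto (fun n => ∫ x, p n x) atTop (𝓝 (∫ _ : ℝ, (0 : ℝ))) := by
    refine tendsto_integral_of_dominated_convergence (fun x => 1 / (4 * η) * φ.rep x ^ 2)
      hpm (φ.integrable_rep_sq.const_mul _) (fun n => ?_) ?_
    · filter_upwards [hb n] with x hx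
      rw [Real.norm_eq_abs, abs_of_nonneg (le_max_right _ _)]
      refine max_le ?_ (by positivity)
      have h1 : G n x * |φ.rep x| - η * G n x ^ 2 ≤ 1 / (4 * η) * φ.rep x ^ 2 := by
        rw [← sq_abs (φ.rep x)]
        have h2 : 1 / (4 * η) * |φ.rep x| ^ 2 - (G n x * |φ.rep x| - η * G n x ^ 2) =
            (|φ.rep x| - 2 * η * G n x) ^ 2 / (4 * η) := by
          field_simp
          ring
        have h3 : 0 ≤ (|φ.rep x| - 2 * η * G n x) ^ 2 / (4 * η) := by positivity
        linarith
      linarith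
    · filter_upwards [hlim] with x hx
      have h1 : Tendsto (fun n => |h n x|) atTop (𝓝 0) := by simpa using hx.abs
      refine tendsto_of_tendsto_of_tendsto_of_le_of_le tendsto_const_nhds h1
        (fun n => le_max_right _ _) fun n => max_le ?_ (abs_nonneg _)
      have : 0 ≤ η * G n x ^ 2 := by positivity
      linarith
  rw [integral_zero] at hplim
  obtain ⟨N, hN⟩ := Metric.tendsto_atTop.1 hplim (ε / 2) (by positivity)
  refine ⟨N, fun n hn => ?_⟩
  have h1 := hN n hn
  rw [Real.dist_eq, sub_zero] at h1 ⊢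
  have hpi : Integrable (p n) volume := by
    refine (hh n).abs.mono' (hpm n) (Eventually.of_forall fun x => ?_)
    rw [Real.norm_eq_abs, abs_of_nonneg (le_max_right _ _)]
    refine max_le ?_ (abs_nonneg _)
    have : 0 ≤ η * G n x ^ 2 := by positivity
    linarith
  have h2 : ∫ x, |h n x| ≤ ∫ x, (p n x + η * G n x ^ 2) := by
    refine integral_mono (hh n).abs (hpi.add ((hG n).const_mul η)) fun x => ?_
    have : |h n x| - η * G n x ^ 2 ≤ p n x := le_max_left _ _
    simp only
    linarith
  rw [integral_add hpi ((hG n).const_mul η), integral_const_mul] at h2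
  have h3 : η * ∫ x, G n x ^ 2 < ε / 2 := by
    refine (mul_le_mul_of_nonneg_left (hK n) hη.le).trans_lt ?_
    have : ε / 2 = η * (K + 1) := by simp only [η]; field_simp
    rw [this]
    exact mul_lt_mul_of_pos_left (by linarith) hη
  rw [abs_of_nonneg (integral_nonneg fun x => abs_nonneg _)]
  linarith [le_abs_self (∫ x, p n x)]

/-! ### Palais–Smale sequences below the Nehari level -/

/-- Pointwise `f² ≤ C f u ≤ C θ f_u u²`. Smallness of the quantity bounded below by `D` thus makes
the nonlinear term small in `L²`. -/
theorem Admissible.integral_comp_sq_le (hf : Admissible θ μ f) {n : ℕ} {v : H1}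
    (hn : 2 * ‖v‖ ≤ n) : ∫ x, f x (v.rep x) ^ 2 ≤
      μ n * n * (θ * ∫ x, partialU f x (v.rep x) * v.rep x ^ 2) := by
  rw [← integral_const_mul, ← integral_const_mul]
  refine integral_mono_ae (hf.memLp_comp v).integrable_sq
    (((hf.integrable_partialU_sq v v).const_mul θ).const_mul (μ n * n)) ?_
  filter_upwards [hf.nl] with x hx
  have h1 := hx.abs_le' (hf.mu_nonneg n) ((v.abs_rep_le x).trans hn)
  have h2 := hx.superlinear (v.rep x)
  have h3 : 0 ≤ μ n * n := mul_nonneg (hf.mu_nonneg n) (Nat.cast_nonneg n)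
  have h4 : f x (v.rep x) ^ 2 ≤ μ n * n * (f x (v.rep x) * v.rep x) := by
    rw [← abs_of_nonneg (hx.mul_self_nonneg (v.rep x)), abs_mul, ← sq_abs]
    nlinarith [abs_nonneg (f x (v.rep x))]
  exact h4.trans (mul_le_mul_of_nonneg_left h2 h3)

/-- Test the derivative with `y - w`, where `w = Pv` and `y = v - Pv`: the form becomes the sum of
two coercive terms. -/
theorem Admissible.norm_sq_le (hf : Admissible θ μ f)
    (hV : StepanovBounded V) {E : Submodule ℝ H1} {P : H1 →L[ℝ] H1} {α : ℝ}
    (hE : FormDichotomy χ V E P α) {v : H1} {ε : ℝ} (hε : ∀ ξ, |dJ χ V f v ξ| ≤ ε * ‖ξ‖) :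
    α * ‖v‖ ^ 2 ≤ 2 * (ε + Real.sqrt (∫ x, f x (v.rep x) ^ 2)) * ((1 + 2 * ‖P‖) * ‖v‖) := by
  set w := P v
  set y := v - P v
  have hv : v = w + y := by simp only [w, y]; abel
  have hyw : ‖y - w‖ ≤ (1 + 2 * ‖P‖) * ‖v‖ := by
    have h1 : y - w = v - (2 : ℝ) • P v := by simp only [w, y, two_smul]; abel
    rw [h1]
    refine (norm_sub_le _ _).trans ?_
    rw [norm_smul, Real.norm_of_nonneg (by norm_num)]
    linarith [P.le_opNorm v]
  have hQ : schrodingerForm V v (y - w) =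
      schrodingerForm V y y - schrodingerForm V w w := by
    have h1 := hE.orthogonal v v
    change schrodingerForm V w y = 0 at h1
    have h2 : schrodingerForm V y w = 0 := by rw [schrodingerForm_comm]; exact h1
    rw [hv]
    simp only [← hV.form_apply, map_add, map_sub, add_apply] at h1 h2 ⊢
    linarith
  have h1 := hE.neg_on w (hE.mem v)
  have h2 := hE.pos_on v
  have h3 := (le_abs_self _).trans (hε (y - w))
  rw [dJ, hQ] at h3
  have h4 := (le_abs_self _).trans (abs_integral_mul_rep_le (hf.memLp_comp v) (y - w))
  have h5 : α * (‖y‖ ^ 2 + ‖w‖ ^ 2) ≤ (ε + Real.sqrt (∫ x, f x (v.rep x) ^ 2)) * ‖y - w‖ := by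
    linarith
  have h6 : ‖v‖ ^ 2 ≤ 2 * (‖y‖ ^ 2 + ‖w‖ ^ 2) := by
    have h7 : ‖v‖ ≤ ‖w‖ + ‖y‖ := by
      nth_rewrite 1 [hv]; exact norm_add_le _ _
    nlinarith [norm_nonneg v, sq_nonneg (‖w‖ - ‖y‖)]
  have h7 : 0 ≤ ε + Real.sqrt (∫ x, f x (v.rep x) ^ 2) ∨ v = 0 := by
    by_cases hv0 : v = 0
    · exact Or.inr hv0
    · left
      have h8 := (abs_nonneg _).trans (hε v)
      have h9 := nonneg_of_mul_nonneg_left h8 (norm_pos_iff.2 hv0)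
      positivity
  rcases h7 with h7 | h7
  · have h8 := mul_le_mul_of_nonneg_left hyw h7
    have h9 := mul_le_mul_of_nonneg_left h6 hE.pos.le
    linarith
  · rw [h7]; simp

/-- If `∫ f_u(x, v_n) v_n²` stayed away from zero along a subsequence, `Admissible.nehariLevel_le`
would give `m` at most the level `e` plus an arbitrarily small error. So it tends to zero, and with
it `f(x, v_n)` in `L²`; coercivity concludes. -/
theorem Admissible.tendsto_zero_of_level_lt (hf : Admissible θ μ f) (hχ : χ = 1 ∨ χ = -1)
    (hV : StepanovBounded V) {P : H1 →L[ℝ] H1} {α : ℝ}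
    (hE : FormDichotomy χ V (nehariSubspace χ V) P α) (hm : 0 < nehariLevel χ V f)
    {v : ℕ → H1} {R : ℝ} (hR : ∀ n, ‖v n‖ ≤ R) {ε : ℕ → ℝ} (hε : Tendsto ε atTop (𝓝 0))
    (hdJ : ∀ᶠ n in atTop, ∀ ξ, |dJ χ V f (v n) ξ| ≤ ε n * ‖ξ‖) {e : ℝ}
    (hJ : Tendsto (fun n => functionalJ χ V f (v n)) atTop (𝓝 e)) (he : e < nehariLevel χ V f) :
    Tendsto v atTop (𝓝 0) := by
  have hR0 : 0 ≤ R := (norm_nonneg _).trans (hR 0)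
  set D : ℕ → ℝ := fun n => ∫ x, partialU f x ((v n).rep x) * (v n).rep x ^ 2
  have hD0 : ∀ n, 0 ≤ D n := fun n => by
    refine integral_nonneg_of_ae ?_
    filter_upwards [hf.nl] with x hx
    exact mul_nonneg (hx.deriv_nonneg hf.theta_pos _) (sq_nonneg _)
  have hD : Tendsto D atTop (𝓝 0) := by
    refine tendsto_order.2 ⟨fun a ha => Eventually.of_forall fun n => ha.trans_le (hD0 n),
      fun a ha => ?_⟩
    obtain ⟨ε₁, hε₁, h⟩ := hf.nehariLevel_le hχ hV hE hm hR0 ha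
      (show 0 < (nehariLevel χ V f - e) / 2 by linarith)
    filter_upwards [hdJ, hε.eventually_lt_const hε₁,
      hJ.eventually_lt_const (show e < e + (nehariLevel χ V f - e) / 2 by linarith)]
      with n h1 h2 h3
    by_contra hcon
    have := h (v n) (hR n) (not_lt.1 hcon) fun ξ =>
      (h1 ξ).trans (mul_le_mul_of_nonneg_right h2.le (norm_nonneg _))
    linarith
  obtain ⟨k, hk⟩ := exists_nat_ge (2 * R)
  have hs : Tendsto (fun n => Real.sqrt (∫ x, f x ((v n).rep x) ^ 2)) atTop (𝓝 0) := by
    have h1 : Tendsto (fun n => ∫ x, f x ((v n).rep x) ^ 2) atTop (𝓝 0) := by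
      have h2 := (hD.const_mul θ).const_mul (μ k * k)
      rw [mul_zero, mul_zero] at h2
      exact tendsto_of_tendsto_of_tendsto_of_le_of_le tendsto_const_nhds h2
        (fun n => integral_nonneg fun x => sq_nonneg _) fun n =>
          hf.integral_comp_sq_le (by linarith [hR n])
    simpa using h1.sqrt
  have hsq : Tendsto (fun n => ‖v n‖ ^ 2) atTop (𝓝 0) := by
    have h1 := (((hε.add hs).const_mul (2 / α)).abs).mul_const ((1 + 2 * ‖P‖) * R)
    rw [add_zero, mul_zero, abs_zero, zero_mul] at h1
    refine tendsto_of_tendsto_of_tendsto_of_le_of_le' tendsto_const_nhds h1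
      (Eventually.of_forall fun n => sq_nonneg _) ?_
    filter_upwards [hdJ] with n hn
    have h2 := hf.norm_sq_le hV hE hn
    set A := ε n + Real.sqrt (∫ x, f x ((v n).rep x) ^ 2)
    have h3 : ‖v n‖ ^ 2 ≤ (2 / α * A) * ((1 + 2 * ‖P‖) * ‖v n‖) := by
      have e1 : (2 / α * A) * ((1 + 2 * ‖P‖) * ‖v n‖) =
          (2 * A * ((1 + 2 * ‖P‖) * ‖v n‖)) / α := by ring
      rw [e1, le_div_iff₀ hE.pos]
      linarith
    refine h3.trans (mul_le_mul (le_abs_self _) ?_ (by positivity) (abs_nonneg _))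
    exact mul_le_mul_of_nonneg_left (hR n) (by positivity)
  rw [tendsto_zero_iff_norm_tendsto_zero]
  have := hsq.sqrt
  simpa [Real.sqrt_sq (norm_nonneg _)] using this

/-! ### Weak limits of almost critical sequences of shifted functionals -/

theorem tendsto_integral_zero_of_le {h : ℕ → ℝ → ℝ} {w : ℕ → H1} {R C : ℝ}
    (hR : ∀ n, ‖w n‖ ≤ R) (w₀ φ : H1) (hm : ∀ n, AEStronglyMeasurable (h n) volume)
    (hb : ∀ n, ∀ᵐ x : ℝ, |h n x| ≤ C * (|(w n).rep x| + |w₀.rep x|) * |φ.rep x|)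
    (hlim : ∀ᵐ x : ℝ, Tendsto (fun n => h n x) atTop (𝓝 0)) :
    Tendsto (fun n => ∫ x, h n x) atTop (𝓝 0) := by
  set G : ℕ → ℝ → ℝ := fun n x => C * (|(w n).rep x| + |w₀.rep x|) with hG
  have hGm : ∀ n, MemLp (G n) 2 volume := fun n =>
    ((w n).memLp_rep.norm.add w₀.memLp_rep.norm).const_mul C
  have hGφ : ∀ n, Integrable (fun x => G n x * |φ.rep x|) volume := fun n =>
    (hGm n).integrable_mul φ.memLp_rep.norm
  have h1 : Tendsto (fun n => ∫ x, |h n x|) atTop (𝓝 0) := by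
    refine tendsto_integral_abs_zero (G := G) (K := 2 * C ^ 2 * (R ^ 2 + ‖w₀‖ ^ 2)) φ hm
      (fun n => (hGφ n).mono' (hm n) (hb n)) (fun n => (hGm n).integrable_sq) (fun n => ?_) hb hlim
    have h2 : ∫ x, G n x ^ 2 ≤ ∫ x, 2 * C ^ 2 * ((w n).rep x ^ 2 + w₀.rep x ^ 2) := by
      refine integral_mono (hGm n).integrable_sq
        (((w n).integrable_rep_sq.add w₀.integrable_rep_sq).const_mul _) fun x => ?_
      simp only [hG]
      rw [mul_pow, ← sq_abs ((w n).rep x), ← sq_abs (w₀.rep x)]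
      nlinarith [mul_nonneg (sq_nonneg C) (sq_nonneg (|(w n).rep x| - |w₀.rep x|))]
    rw [integral_const_mul, integral_add (w n).integrable_rep_sq w₀.integrable_rep_sq] at h2
    refine h2.trans (mul_le_mul_of_nonneg_left (add_le_add ?_ w₀.integral_rep_sq_le)
      (by positivity))
    exact (w n).integral_rep_sq_le.trans (pow_le_pow_left₀ (norm_nonneg _) (hR n) 2)
  exact squeeze_zero_norm (fun n => norm_integral_le_integral_norm _) h1

theorem tendsto_comp_of_abs_sub_le {g : ℕ → ℝ → ℝ} {a : ℕ → ℝ} {b c L : ℝ}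
    (hL : ∀ k, |g k (a k) - g k b| ≤ L * |a k - b|) (ha : Tendsto a atTop (𝓝 b))
    (hg : Tendsto (fun k => g k b) atTop (𝓝 c)) : Tendsto (fun k => g k (a k)) atTop (𝓝 c) := by
  have h1 : Tendsto (fun k => L * |a k - b|) atTop (𝓝 0) := by
    simpa using ((ha.sub_const b).abs).const_mul L
  simpa using (squeeze_zero_norm hL h1).add hg

namespace ShiftLimit

variable {z : ℕ → ℝ} {V' : ℝ → ℝ} {f' : ℝ → ℝ → ℝ}

theorem exists_form_bound (h : ShiftLimit θ μ V f z V' f') (hV : StepanovBounded V) :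
    ∃ δ : ℕ → ℝ, Tendsto δ atTop (𝓝 0) ∧ ∀ᶠ n in atTop, ∀ u v : H1,
      |schrodingerForm (fun x => V (x + z n)) u v - schrodingerForm V' u v| ≤
        δ n * ‖u‖ * ‖v‖ := by
  refine ⟨fun n => 2 * (stepanovNorm fun x => V (x + z n) - V' x).toReal, ?_, ?_⟩
  · simpa using ((ENNReal.tendsto_toReal ENNReal.zero_ne_top).comp h.potential).const_mul 2
  · filter_upwards [h.potential.eventually_lt_const ENNReal.zero_lt_top] with n hn u v
    exact schrodingerForm_sub_potential (hV.shift (z n)) h.bounded hn u v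

theorem tendsto_form (h : ShiftLimit θ μ V f z V' f') (hV : StepanovBounded V) {u v : ℕ → H1}
    {R a : ℝ} (hu : ∀ n, ‖u n‖ ≤ R) (hv : ∀ n, ‖v n‖ ≤ R)
    (ha : Tendsto (fun n => schrodingerForm V' (u n) (v n)) atTop (𝓝 a)) :
    Tendsto (fun n => schrodingerForm (fun x => V (x + z n)) (u n) (v n)) atTop (𝓝 a) := by
  obtain ⟨δ, hδ, hb⟩ := h.exists_form_bound hV
  have h1 : Tendsto (fun n => |δ n| * R * R) atTop (𝓝 0) := by
    simpa using (hδ.abs.mul_const R).mul_const R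
  have h2 : Tendsto (fun n => schrodingerForm (fun x => V (x + z n)) (u n) (v n) -
      schrodingerForm V' (u n) (v n)) atTop (𝓝 0) := by
    refine squeeze_zero_norm' ?_ h1
    filter_upwards [hb] with n hn
    refine (hn _ _).trans ?_
    have hR : 0 ≤ R := (norm_nonneg _).trans (hu n)
    have := le_abs_self (δ n)
    gcongr
    exacts [hu n, hv n]
  simpa using h2.add ha

theorem ae_tendsto_comp (h : ShiftLimit θ μ V f z V' f') (hf : Admissible θ μ f) {w : ℕ → H1}
    {w₀ : H1} (hw : ∀ x, Tendsto (fun n => (w n).rep x) atTop (𝓝 (w₀.rep x))) {N : ℕ}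
    (hN : ∀ n, 2 * ‖w n‖ ≤ N) (hN0 : 2 * ‖w₀‖ ≤ N) :
    ∀ᵐ x : ℝ, Tendsto (fun n => f (x + z n) ((w n).rep x)) atTop (𝓝 (f' x (w₀.rep x))) := by
  filter_upwards [h.self, ae_all_iff.2 fun k => (hf.shift (z k)).nl] with x h1 h2
  exact tendsto_comp_of_abs_sub_le (fun k => (h2 k).abs_sub_le (hf.mu_nonneg N) le_rfl
    (((w k).abs_rep_le x).trans (hN k)) ((w₀.abs_rep_le x).trans hN0)) (hw x) (h1 _)

theorem ae_tendsto_primitive_comp (h : ShiftLimit θ μ V f z V' f') (hf : Admissible θ μ f)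
    {w : ℕ → H1} {w₀ : H1} (hw : ∀ x, Tendsto (fun n => (w n).rep x) atTop (𝓝 (w₀.rep x)))
    {N : ℕ} (hN : ∀ n, 2 * ‖w n‖ ≤ N) (hN0 : 2 * ‖w₀‖ ≤ N) :
    ∀ᵐ x : ℝ, Tendsto (fun n => StepanovNLS.primitive f (x + z n) ((w n).rep x)) atTop
      (𝓝 (StepanovNLS.primitive f' x (w₀.rep x))) := by
  filter_upwards [h.primitive, ae_all_iff.2 fun k => (hf.shift (z k)).nl] with x h1 h2
  exact tendsto_comp_of_abs_sub_le (fun k => (h2 k).abs_primitive_sub_le (hf.mu_nonneg N) le_rfl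
    (((w k).abs_rep_le x).trans (hN k)) ((w₀.abs_rep_le x).trans hN0)) (hw x) (h1 _)

theorem tendsto_integral_comp_mul (h : ShiftLimit θ μ V f z V' f') (hf : Admissible θ μ f)
    {w : ℕ → H1} {w₀ : H1} (hw : ∀ x, Tendsto (fun n => (w n).rep x) atTop (𝓝 (w₀.rep x)))
    {N : ℕ} (hN : ∀ n, 2 * ‖w n‖ ≤ N) (hN0 : 2 * ‖w₀‖ ≤ N) (φ : H1) :
    Tendsto (fun n => ∫ x, f (x + z n) ((w n).rep x) * φ.rep x) atTop
      (𝓝 (∫ x, f' x (w₀.rep x) * φ.rep x)) := by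
  have i1 := fun n => (hf.shift (z n)).integrable_comp_mul (w n) φ
  have i2 := h.admissible.integrable_comp_mul w₀ φ
  have h1 : Tendsto (fun n => ∫ x, (f (x + z n) ((w n).rep x) * φ.rep x -
      f' x (w₀.rep x) * φ.rep x)) atTop (𝓝 0) := by
    refine tendsto_integral_zero_of_le (C := μ N * N) (R := N / 2) (w := w)
      (fun n => by linarith [hN n]) w₀ φ
      (fun n => ((i1 n).sub i2).aestronglyMeasurable) (fun n => ?_) ?_
    · filter_upwards [(hf.shift (z n)).nl, h.admissible.nl] with x h1 h2
      rw [← sub_mul, abs_mul]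
      refine mul_le_mul_of_nonneg_right ((abs_sub _ _).trans ?_) (abs_nonneg _)
      rw [mul_add]
      exact add_le_add (h1.abs_le' (hf.mu_nonneg N) (((w n).abs_rep_le x).trans (hN n)))
        (h2.abs_le' (hf.mu_nonneg N) ((w₀.abs_rep_le x).trans hN0))
    · filter_upwards [h.ae_tendsto_comp hf hw hN hN0] with x hx
      simpa using (hx.mul_const (φ.rep x)).sub_const (f' x (w₀.rep x) * φ.rep x)
  have h2 := h1.add_const (∫ x, f' x (w₀.rep x) * φ.rep x)
  rw [zero_add] at h2
  refine h2.congr fun n => ?_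
  rw [integral_sub (i1 n) i2, sub_add_cancel]

/-- Weak limits of almost critical sequences are critical points of the limit functional. -/
theorem dJ_eq_zero (h : ShiftLimit θ μ V f z V' f') (hf : Admissible θ μ f)
    (hV : StepanovBounded V) {w : ℕ → H1} {w₀ : H1} (hw : WeaklyTendsto w w₀) {ε : ℕ → ℝ}
    (hε : Tendsto ε atTop (𝓝 0))
    (hdJ : ∀ n ξ, |dJ χ (fun x => V (x + z n)) (fun x u => f (x + z n) u) (w n) ξ| ≤ ε n * ‖ξ‖)
    (φ : H1) : dJ χ V' f' w₀ φ = 0 := by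
  obtain ⟨R, hR⟩ := hw.exists_norm_le
  obtain ⟨N, hN⟩ := exists_nat_ge (2 * max R ‖w₀‖)
  have h1 : Tendsto (fun n => schrodingerForm (fun x => V (x + z n)) (w n) φ) atTop
      (𝓝 (schrodingerForm V' w₀ φ)) :=
    h.tendsto_form hV (R := max R ‖φ‖) (fun n => (hR n).trans (le_max_left _ _))
      (fun _ => le_max_right _ _) (by
        simp only [schrodingerForm_comm V' _ φ]
        exact hw (h.bounded.form φ))
  have h2 := h.tendsto_integral_comp_mul hf hw.tendsto_rep (N := N)
    (fun n => by linarith [hR n, le_max_left R ‖w₀‖]) (by linarith [le_max_right R ‖w₀‖]) φ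
  have h3 : Tendsto (fun n => dJ χ (fun x => V (x + z n)) (fun x u => f (x + z n) u) (w n) φ) atTop
      (𝓝 (dJ χ V' f' w₀ φ)) := (h1.const_mul χ).sub h2
  refine tendsto_nhds_unique h3 (squeeze_zero_norm (fun n => hdJ n φ) ?_)
  simpa using hε.mul_const ‖φ‖

theorem tendsto_functionalJ (h : ShiftLimit θ μ V f z V' f') (hf : Admissible θ μ f)
    (hχ : χ = 1 ∨ χ = -1) (hV : StepanovBounded V) (w : H1) :
    Tendsto (fun n => functionalJ χ (fun x => V (x + z n)) (fun x u => f (x + z n) u) w) atTop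
      (𝓝 (functionalJ χ V' f' w)) := by
  obtain ⟨N, hN⟩ := exists_nat_ge (2 * ‖w‖)
  simp only [functionalJ_eq hχ]
  refine Tendsto.sub (((h.tendsto_form hV (u := fun _ => w) (v := fun _ => w) (fun _ => le_rfl)
    (fun _ => le_rfl) tendsto_const_nhds).const_mul χ).div_const 2) ?_
  refine tendsto_integral_of_dominated_convergence (fun x => μ N * N * w.rep x ^ 2)
    (fun n => (hf.shift (z n)).aestronglyMeasurable_primitive_comp w)
    (w.integrable_rep_sq.const_mul _) (fun n => ?_) (h.primitive.mono fun x hx => hx _)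
  filter_upwards [(hf.shift (z n)).nl] with x hx
  exact hx.abs_primitive_le (hf.mu_nonneg N) ((w.abs_rep_le x).trans hN)

theorem tendsto_integral_partialU (h : ShiftLimit θ μ V f z V' f') (hf : Admissible θ μ f)
    (w : H1) :
    Tendsto (fun n => ∫ x, StepanovNLS.partialU f (x + z n) (w.rep x) * w.rep x ^ 2) atTop
      (𝓝 (∫ x, StepanovNLS.partialU f' x (w.rep x) * w.rep x ^ 2)) := by
  obtain ⟨N, hN⟩ := exists_nat_ge (2 * ‖w‖)
  refine tendsto_integral_of_dominated_convergence (fun x => μ N * N * w.rep x ^ 2)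
    (fun n => ((hf.shift (z n)).integrable_partialU_sq w w).aestronglyMeasurable)
    (w.integrable_rep_sq.const_mul _) (fun n => ?_)
    (h.partialU.mono fun x hx => (hx _).mul_const _)
  filter_upwards [(hf.shift (z n)).nl] with x hx
  rw [norm_mul, Real.norm_eq_abs, Real.norm_eq_abs, abs_of_nonneg (sq_nonneg (w.rep x))]
  have h1 := (w.abs_rep_le x).trans hN
  exact mul_le_mul_of_nonneg_right ((hx.abs_deriv_le h1).trans
    (mul_le_mul_of_nonneg_left h1 (hf.mu_nonneg N))) (sq_nonneg _)

end ShiftLimit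

/-- Where `w` does not vanish, `0 < f w ≤ θ f_u w²`. This supplies the constant `D` for nontrivial
critical points. -/
theorem Admissible.integral_partialU_pos (hf : Admissible θ μ f) {w : H1} (hw : w ≠ 0) :
    0 < ∫ x, partialU f x (w.rep x) * w.rep x ^ 2 := by
  have h0 : 0 ≤ᵐ[volume] fun x => partialU f x (w.rep x) * w.rep x ^ 2 := by
    filter_upwards [hf.nl] with x hx
    exact mul_nonneg (hx.deriv_nonneg hf.theta_pos _) (sq_nonneg _)
  refine lt_of_le_of_ne (integral_nonneg_of_ae h0) fun heq => hw ?_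
  have h1 := (integral_eq_zero_iff_of_nonneg_ae h0 (hf.integrable_partialU_sq w w)).1 heq.symm
  have h2 : w.rep =ᵐ[volume] fun _ => 0 := by
    filter_upwards [h1, hf.nl] with x hx h3
    by_contra hne
    have h4 := (h3.sign _ hne).trans_le (h3.superlinear _)
    change partialU f x (w.rep x) * w.rep x ^ 2 = 0 at hx
    change 0 < θ * (partialU f x (w.rep x) * w.rep x ^ 2) at h4
    rw [hx, mul_zero] at h4
    exact h4.false
  have h3 := Measure.eq_of_ae_eq h2 w.continuous_rep continuous_const
  refine H1.ext_rep ?_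
  rw [h3]
  ext x
  rw [H1.rep_zero]

theorem dJ_shift_neg (χ : ℝ) (V : ℝ → ℝ) (f : ℝ → ℝ → ℝ) (z : ℝ) (u ξ : H1) :
    dJ χ V f (shift (-z) u) ξ =
      dJ χ (fun x => V (x + z)) (fun x u => f (x + z) u) u (shift z ξ) := by
  rw [← dJ_shift χ V f z, shift_shift_neg]

theorem functionalJ_shift_neg (hχ : χ = 1 ∨ χ = -1) (V : ℝ → ℝ) (f : ℝ → ℝ → ℝ) (z : ℝ)
    (u : H1) : functionalJ χ V f (shift (-z) u) =
      functionalJ χ (fun x => V (x + z)) (fun x u => f (x + z) u) u := by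
  rw [← functionalJ_shift hχ V f z, shift_shift_neg]

namespace ShiftLimit

variable {z : ℕ → ℝ} {V' : ℝ → ℝ} {f' : ℝ → ℝ → ℝ}

/-- Critical points of the limit functional are almost critical for the shifted functionals. -/
theorem exists_dJ_bound (h : ShiftLimit θ μ V f z V' f') (hf : Admissible θ μ f)
    (hχ : χ = 1 ∨ χ = -1) (hV : StepanovBounded V) {w : H1} (hw : ∀ φ, dJ χ V' f' w φ = 0) :
    ∃ ε : ℕ → ℝ, Tendsto ε atTop (𝓝 0) ∧ ∀ᶠ n in atTop, ∀ ξ,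
      |dJ χ (fun x => V (x + z n)) (fun x u => f (x + z n) u) w ξ| ≤ ε n * ‖ξ‖ := by
  obtain ⟨δ, hδ, hb⟩ := h.exists_form_bound hV
  obtain ⟨N, hN⟩ := exists_nat_ge (2 * ‖w‖)
  have m1 := fun n => (hf.shift (z n)).memLp_comp w
  have m2 := h.admissible.memLp_comp w
  have h1 := tendsto_integral_sq_of_dominated (g := fun n x => f (x + z n) (w.rep x) -
    f' x (w.rep x)) (C := 2 * (μ N * N)) w (fun n => ((m1 n).sub m2).aestronglyMeasurable)
    (fun n => by
      filter_upwards [(hf.shift (z n)).nl, h.admissible.nl] with x h1 h2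
      have h3 := (w.abs_rep_le x).trans hN
      have h4 := h1.abs_le' (hf.mu_nonneg N) h3
      have h5 := h2.abs_le' (hf.mu_nonneg N) h3
      have h6 := abs_sub (f (x + z n) (w.rep x)) (f' x (w.rep x))
      linarith)
    (h.self.mono fun x hx => by simpa using (hx (w.rep x)).sub_const (f' x (w.rep x)))
  refine ⟨fun n => δ n * ‖w‖ + Real.sqrt (∫ x, (f (x + z n) (w.rep x) - f' x (w.rep x)) ^ 2),
    by simpa using (hδ.mul_const ‖w‖).add h1, ?_⟩
  filter_upwards [hb] with n hn ξ
  have h2 := abs_integral_mul_rep_le ((m1 n).sub m2) ξ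
  simp only [Pi.sub_apply, sub_mul] at h2
  rw [integral_sub ((hf.shift (z n)).integrable_comp_mul w ξ)
    (h.admissible.integrable_comp_mul w ξ)] at h2
  have h3 : dJ χ (fun x => V (x + z n)) (fun x u => f (x + z n) u) w ξ =
      χ * (schrodingerForm (fun x => V (x + z n)) w ξ - schrodingerForm V' w ξ) -
      ((∫ x, f (x + z n) (w.rep x) * ξ.rep x) - ∫ x, f' x (w.rep x) * ξ.rep x) := by
    have := hw ξ
    rw [dJ] at this ⊢
    linarith
  have h4 : |χ * (schrodingerForm (fun x => V (x + z n)) w ξ - schrodingerForm V' w ξ)| ≤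
      δ n * ‖w‖ * ‖ξ‖ := by
    rw [abs_mul, abs_sign hχ, one_mul]; exact hn w ξ
  rw [h3, add_mul]
  exact (abs_sub _ _).trans (add_le_add h4 h2)

/-- Nontrivial critical points of the limit functional are not below the Nehari level. -/
theorem nehariLevel_le (h : ShiftLimit θ μ V f z V' f') (hf : Admissible θ μ f)
    (hχ : χ = 1 ∨ χ = -1) (hV : StepanovBounded V) {P : H1 →L[ℝ] H1} {α : ℝ}
    (hE : FormDichotomy χ V (nehariSubspace χ V) P α) (hm : 0 < nehariLevel χ V f)
    {w : H1} (hw0 : w ≠ 0) (hw : ∀ φ, dJ χ V' f' w φ = 0) :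
    nehariLevel χ V f ≤ functionalJ χ V' f' w := by
  obtain ⟨ε, hε, hb⟩ := h.exists_dJ_bound hf hχ hV hw
  set D := ∫ x, StepanovNLS.partialU f' x (w.rep x) * w.rep x ^ 2
  have hD : 0 < D := h.admissible.integral_partialU_pos hw0
  refine le_of_forall_pos_le_add fun η hη => ?_
  obtain ⟨ε₁, hε₁, H⟩ := hf.nehariLevel_le hχ hV hE hm (norm_nonneg w) (half_pos hD)
    (half_pos hη)
  have h1 := (h.tendsto_integral_partialU hf w).eventually_const_lt (half_lt_self hD)
  have h2 := (h.tendsto_functionalJ hf hχ hV w).eventually_lt_const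
    (show functionalJ χ V' f' w < functionalJ χ V' f' w + η / 2 by linarith)
  obtain ⟨n, hn1, hn2, hn3, hn4⟩ :=
    (h1.and (h2.and (hb.and (hε.eventually_lt_const hε₁)))).exists
  -- Shifted back by `z n`, the critical point of the limit functional becomes an almost critical
  -- point of `J` itself, to which the estimate for `J` applies.
  have h3 := H (shift (-z n) w) (norm_shift _ _).le ?_ fun ξ => ?_
  · rw [functionalJ_shift_neg hχ] at h3
    linarith
  · rw [← integral_add_right_eq_self (fun x => StepanovNLS.partialU f x ((shift (-z n) w).rep x) *
      (shift (-z n) w).rep x ^ 2) (z n)]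
    simpa only [rep_shift, add_neg_cancel_right] using hn1.le
  · rw [dJ_shift_neg]
    refine (hn3 _).trans ?_
    rw [norm_shift]
    exact mul_le_mul_of_nonneg_right hn4.le (norm_nonneg _)

/-- Splitting of the derivative. -/
theorem exists_dJ_sub_bound (h : ShiftLimit θ μ V f z V' f') (hf : Admissible θ μ f)
    (hχ : χ = 1 ∨ χ = -1) (hV : StepanovBounded V) {w : ℕ → H1} {w₀ : H1}
    (hw : WeaklyTendsto w w₀) {ε : ℕ → ℝ} (hε : Tendsto ε atTop (𝓝 0))
    (hdJ : ∀ n ξ, |dJ χ (fun x => V (x + z n)) (fun x u => f (x + z n) u) (w n) ξ| ≤ ε n * ‖ξ‖) :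
    ∃ ε' : ℕ → ℝ, Tendsto ε' atTop (𝓝 0) ∧ ∀ᶠ n in atTop, ∀ ξ,
      |dJ χ (fun x => V (x + z n)) (fun x u => f (x + z n) u) (w n - w₀) ξ| ≤ ε' n * ‖ξ‖ := by
  have hcrit := h.dJ_eq_zero hf hV hw hε hdJ
  obtain ⟨δ, hδ, hb⟩ := h.exists_form_bound hV
  obtain ⟨R, hR⟩ := hw.exists_norm_le
  obtain ⟨N, hN⟩ := exists_nat_ge (2 * (R + ‖w₀‖))
  have hR0 : 0 ≤ R := (norm_nonneg _).trans (hR 0)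
  have hwn : ∀ n, 2 * ‖w n‖ ≤ N := fun n => by linarith [hR n, norm_nonneg w₀]
  have hw0 : 2 * ‖w₀‖ ≤ N := by linarith
  have hrn : ∀ n, 2 * ‖w n - w₀‖ ≤ N := fun n => by linarith [hR n, norm_sub_le (w n) w₀]
  have hrlim : ∀ x, Tendsto (fun n => (w n - w₀).rep x) atTop (𝓝 ((0 : H1).rep x)) := fun x => by
    simpa only [H1.rep_sub, H1.rep_zero, sub_self] using (hw.tendsto_rep x).sub_const (w₀.rep x)
  have m1 := fun n => (hf.shift (z n)).memLp_comp (w n)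
  have m2 := fun n => (hf.shift (z n)).memLp_comp (w n - w₀)
  have m3 := h.admissible.memLp_comp w₀
  -- Brezis–Lieb for `f`: the first difference is at most a multiple of `|w₀|` by the local
  -- Lipschitz bound, and so is the last term, so dominated convergence holds in `L²`.
  have h1 := tendsto_integral_sq_of_dominated (g := fun n x => f (x + z n) ((w n).rep x) -
    f (x + z n) ((w n - w₀).rep x) - f' x (w₀.rep x)) (C := 2 * (μ N * N)) w₀
    (fun n => (((m1 n).sub (m2 n)).sub m3).aestronglyMeasurable)
    (fun n => by
      filter_upwards [(hf.shift (z n)).nl, h.admissible.nl] with x h1 h2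
      have h4 := h1.abs_sub_le (hf.mu_nonneg N) le_rfl (((w n).abs_rep_le x).trans (hwn n))
        (((w n - w₀).abs_rep_le x).trans (hrn n))
      rw [H1.rep_sub, sub_sub_cancel, ← H1.rep_sub] at h4
      have h5 := h2.abs_le' (hf.mu_nonneg N) ((w₀.abs_rep_le x).trans hw0)
      have h6 := abs_sub (f (x + z n) ((w n).rep x) - f (x + z n) ((w n - w₀).rep x))
        (f' x (w₀.rep x))
      linarith)
    (by
      filter_upwards [h.ae_tendsto_comp hf hw.tendsto_rep hwn hw0,
        h.ae_tendsto_comp hf hrlim hrn (by simp), h.admissible.nl] with x h1 h2 h3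
      rw [H1.rep_zero, h3.zero] at h2
      simpa using (h1.sub h2).sub_const (f' x (w₀.rep x)))
  refine ⟨fun n => ε n + δ n * ‖w₀‖ + Real.sqrt (∫ x, (f (x + z n) ((w n).rep x) -
    f (x + z n) ((w n - w₀).rep x) - f' x (w₀.rep x)) ^ 2),
    by simpa using (hε.add (hδ.mul_const ‖w₀‖)).add h1, ?_⟩
  filter_upwards [hb] with n hn ξ
  have h2 := abs_integral_mul_rep_le (((m1 n).sub (m2 n)).sub m3) ξ
  simp only [Pi.sub_apply, sub_mul] at h2
  have i1 := (hf.shift (z n)).integrable_comp_mul (w n) ξ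
  have i2 := (hf.shift (z n)).integrable_comp_mul (w n - w₀) ξ
  have i3 : Integrable (fun x => f (x + z n) ((w n).rep x) * ξ.rep x -
      f (x + z n) ((w n - w₀).rep x) * ξ.rep x) volume := i1.sub i2
  rw [integral_sub i3 (h.admissible.integrable_comp_mul w₀ ξ), integral_sub i1 i2] at h2
  have hQ : schrodingerForm (fun x => V (x + z n)) (w n - w₀) ξ =
      schrodingerForm (fun x => V (x + z n)) (w n) ξ -
        schrodingerForm (fun x => V (x + z n)) w₀ ξ := by
    simp only [← (hV.shift (z n)).form_apply, map_sub, sub_apply]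
  have h3 : dJ χ (fun x => V (x + z n)) (fun x u => f (x + z n) u) (w n - w₀) ξ =
      dJ χ (fun x => V (x + z n)) (fun x u => f (x + z n) u) (w n) ξ -
      χ * (schrodingerForm (fun x => V (x + z n)) w₀ ξ - schrodingerForm V' w₀ ξ) +
      ((∫ x, f (x + z n) ((w n).rep x) * ξ.rep x) -
        (∫ x, f (x + z n) ((w n - w₀).rep x) * ξ.rep x) - ∫ x, f' x (w₀.rep x) * ξ.rep x) := by
    have := hcrit ξ
    rw [dJ] at this
    rw [dJ, dJ, hQ]
    linarith
  have h4 : |χ * (schrodingerForm (fun x => V (x + z n)) w₀ ξ - schrodingerForm V' w₀ ξ)| ≤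
      δ n * ‖w₀‖ * ‖ξ‖ := by
    rw [abs_mul, abs_sign hχ, one_mul]; exact hn w₀ ξ
  rw [h3, add_mul, add_mul]
  exact (abs_add_le _ _).trans
    (add_le_add ((abs_sub _ _).trans (add_le_add (hdJ n ξ) h4)) h2)

/-- Splitting of the functional. -/
theorem tendsto_functionalJ_sub (h : ShiftLimit θ μ V f z V' f') (hf : Admissible θ μ f)
    (hχ : χ = 1 ∨ χ = -1) (hV : StepanovBounded V) {w : ℕ → H1} {w₀ : H1}
    (hw : WeaklyTendsto w w₀) :
    Tendsto (fun n => functionalJ χ (fun x => V (x + z n)) (fun x u => f (x + z n) u) (w n) -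
      functionalJ χ (fun x => V (x + z n)) (fun x u => f (x + z n) u) (w n - w₀)) atTop
      (𝓝 (functionalJ χ V' f' w₀)) := by
  obtain ⟨R, hR⟩ := hw.exists_norm_le
  obtain ⟨N, hN⟩ := exists_nat_ge (4 * (R + ‖w₀‖))
  have hR0 : 0 ≤ R := (norm_nonneg _).trans (hR 0)
  have hn0 := norm_nonneg w₀
  have hwn : ∀ n, 2 * ‖w n‖ ≤ N := fun n => by linarith [hR n]
  have hw0 : 2 * ‖w₀‖ ≤ N := by linarith
  have hrn : ∀ n, 2 * ‖w n - w₀‖ ≤ N := fun n => by linarith [hR n, norm_sub_le (w n) w₀]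
  have hrlim : ∀ x, Tendsto (fun n => (w n - w₀).rep x) atTop (𝓝 ((0 : H1).rep x)) := fun x => by
    simpa only [H1.rep_sub, H1.rep_zero, sub_self] using (hw.tendsto_rep x).sub_const (w₀.rep x)
  have i1 := fun n => (hf.shift (z n)).integrable_primitive_comp (w n)
  have i2 := fun n => (hf.shift (z n)).integrable_primitive_comp (w n - w₀)
  have i3 := h.admissible.integrable_primitive_comp w₀
  -- The difference of the quadratic forms at `w_n` and `w_n - w₀` is the form at the pair `(w_n +
  -- (w_n - w₀), w₀)`, which is affine in `w_n` and so passes to the weak limit.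
  have h1 := h.tendsto_form hV (u := fun n => w n + (w n - w₀)) (v := fun _ => w₀)
    (R := 2 * R + ‖w₀‖) (fun n => by
      linarith [hR n, norm_add_le (w n) (w n - w₀), norm_sub_le (w n) w₀])
    (fun _ => by linarith) (a := schrodingerForm V' w₀ w₀) (by
      have h2 := hw (h.bounded.form w₀)
      have h3 := (h2.add h2).sub_const (h.bounded.form w₀ w₀)
      rw [add_sub_cancel_right] at h3
      refine h3.congr fun n => ?_
      rw [schrodingerForm_comm, ← h.bounded.form_apply, map_add, map_sub]
      ring)
  have h2 : Tendsto (fun n => ∫ x, (StepanovNLS.primitive f (x + z n) ((w n).rep x) -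
      StepanovNLS.primitive f (x + z n) ((w n - w₀).rep x) -
      StepanovNLS.primitive f' x (w₀.rep x))) atTop (𝓝 0) := by
    refine tendsto_integral_zero_of_le (C := 2 * (μ N * N)) hR w₀ w₀
      (fun n => (((i1 n).sub (i2 n)).sub i3).aestronglyMeasurable) (fun n => ?_) ?_
    · filter_upwards [(hf.shift (z n)).nl, h.admissible.nl] with x h1 h2
      set a := (w n).rep x
      set b := w₀.rep x
      have ha : |a| ≤ 2 * ‖w n‖ := (w n).abs_rep_le x
      have hb : |b| ≤ 2 * ‖w₀‖ := w₀.abs_rep_le x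
      have hab : |a| + |b| ≤ N := by linarith [hR n]
      have hμ := hf.mu_nonneg N
      have h4 := h1.abs_primitive_sub_le hμ hab (u := a) (v := a - b)
        (by linarith [abs_nonneg b]) (abs_sub a b)
      rw [sub_sub_cancel] at h4
      have h5 := h2.abs_primitive_le hμ (hb.trans hw0)
      have h6 := abs_sub (StepanovNLS.primitive f (x + z n) a -
        StepanovNLS.primitive f (x + z n) (a - b)) (StepanovNLS.primitive f' x b)
      rw [H1.rep_sub]
      refine h6.trans ((add_le_add h4 h5).trans ?_)
      have h7 : μ N * (|a| + |b|) ^ 2 * |b| ≤ μ N * N * (|a| + |b|) * |b| := by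
        rw [pow_two, ← mul_assoc]
        gcongr
      have h8 : μ N * N * b ^ 2 ≤ μ N * N * (|a| + |b|) * |b| := by
        rw [← sq_abs b, pow_two, ← mul_assoc]
        gcongr
        linarith [abs_nonneg a]
      linarith
    · filter_upwards [h.ae_tendsto_primitive_comp hf hw.tendsto_rep hwn hw0,
        h.ae_tendsto_primitive_comp hf hrlim hrn (by simp)] with x h1 h2
      rw [H1.rep_zero, StepanovNLS.primitive, intervalIntegral.integral_same] at h2
      simpa using (h1.sub h2).sub_const (StepanovNLS.primitive f' x (w₀.rep x))
  have h3 := ((h1.const_mul χ).div_const 2).sub (h2.add_const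
    (∫ x, StepanovNLS.primitive f' x (w₀.rep x)))
  rw [zero_add, ← functionalJ_eq hχ] at h3
  refine h3.congr fun n => ?_
  have hQ : schrodingerForm (fun x => V (x + z n)) (w n + (w n - w₀)) w₀ =
      schrodingerForm (fun x => V (x + z n)) (w n) (w n) -
        schrodingerForm (fun x => V (x + z n)) (w n - w₀) (w n - w₀) := by
    have hc : (hV.shift (z n)).form w₀ (w n) = (hV.shift (z n)).form (w n) w₀ :=
      schrodingerForm_comm _ _ _
    simp only [← (hV.shift (z n)).form_apply, map_sub, map_add, sub_apply, add_apply, hc]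
    ring
  have i4 : Integrable (fun x => StepanovNLS.primitive f (x + z n) ((w n).rep x) -
      StepanovNLS.primitive f (x + z n) ((w n - w₀).rep x)) volume := (i1 n).sub (i2 n)
  have i5 := i1 n
  have i6 := i2 n
  simp only [primitive_shift] at i5 i6
  rw [integral_sub i4 i3, integral_sub i5 i6, hQ, functionalJ_eq hχ, functionalJ_eq hχ]
  simp only [primitive_shift]
  ring

/-- Almost critical sequences of the shifted functionals at a level below twice the Nehari level
converge strongly if they have a nontrivial weak limit. -/
theorem tendsto_of_weaklyTendsto (h : ShiftLimit θ μ V f z V' f') (hf : Admissible θ μ f)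
    (hχ : χ = 1 ∨ χ = -1) (hV : StepanovBounded V) {P : H1 →L[ℝ] H1} {α : ℝ}
    (hE : FormDichotomy χ V (nehariSubspace χ V) P α) (hm : 0 < nehariLevel χ V f)
    {w : ℕ → H1} {w₀ : H1} (hw : WeaklyTendsto w w₀) (hw0 : w₀ ≠ 0) {ε : ℕ → ℝ}
    (hε : Tendsto ε atTop (𝓝 0))
    (hdJ : ∀ n ξ, |dJ χ (fun x => V (x + z n)) (fun x u => f (x + z n) u) (w n) ξ| ≤ ε n * ‖ξ‖)
    {d : ℝ} (hd : d < 2 * nehariLevel χ V f)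
    (hJ : Tendsto (fun n => functionalJ χ (fun x => V (x + z n)) (fun x u => f (x + z n) u) (w n))
      atTop (𝓝 d)) :
    Tendsto w atTop (𝓝 w₀) ∧ IsCriticalPoint (functionalJ χ V' f') w₀ ∧
      functionalJ χ V' f' w₀ = d := by
  have hcrit := h.dJ_eq_zero hf hV hw hε hdJ
  have hle := h.nehariLevel_le hf hχ hV hE hm hw0 hcrit
  obtain ⟨ε', hε', hb⟩ := h.exists_dJ_sub_bound hf hχ hV hw hε hdJ
  have hJr := hJ.sub (h.tendsto_functionalJ_sub hf hχ hV hw)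
  simp only [sub_sub_cancel, ← functionalJ_shift_neg hχ] at hJr
  obtain ⟨R, hR⟩ := hw.exists_norm_le
  -- The level of the remainder is `d - J_h(w₀) ≤ d - m < m`, so once shifted back it is an almost
  -- critical sequence of `J` below the Nehari level.
  have hv : Tendsto (fun n => shift (-z n) (w n - w₀)) atTop (𝓝 0) := by
    refine hf.tendsto_zero_of_level_lt hχ hV hE hm (R := R + ‖w₀‖) (fun n => ?_) hε' ?_ hJr
      (by linarith)
    · rw [norm_shift]
      linarith [hR n, norm_sub_le (w n) w₀]
    · filter_upwards [hb] with n hn ξ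
      rw [dJ_shift_neg, ← norm_shift (z n) ξ]
      exact hn _
  refine ⟨?_, h.admissible.isCriticalPoint hχ h.bounded hcrit, ?_⟩
  · rw [tendsto_iff_norm_sub_tendsto_zero]
    simpa only [norm_shift, norm_zero] using hv.norm
  -- The energy of the remainder tends both to `J(0) = 0` and to `d - J_h(w₀)`.
  · have h1 := ((hf.continuous_functionalJ hχ hV).tendsto 0).comp hv
    have h2 : functionalJ χ V f 0 = 0 := by
      rw [functionalJ_eq hχ, ← hV.form_apply]
      simp [H1.rep_zero, StepanovNLS.primitive]
    rw [h2] at h1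
    have := tendsto_nhds_unique h1 hJr
    linarith

end ShiftLimit

/-! ### Palais–Smale sequences -/

theorem IsPalaisSmale.exists_dJ_bound {c : ℝ} {u : ℕ → H1}
    (hu : IsPalaisSmale (functionalJ χ V f) c u) (hf : Admissible θ μ f) (hχ : χ = 1 ∨ χ = -1)
    (hV : StepanovBounded V) :
    ∃ ε : ℕ → ℝ, Tendsto ε atTop (𝓝 0) ∧ ∀ n ξ, |dJ χ V f (u n) ξ| ≤ ε n * ‖ξ‖ := by
  refine ⟨fun n => ‖fderiv ℝ (functionalJ χ V f) (u n)‖, 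
    (tendsto_zero_iff_norm_tendsto_zero (E := StrongDual ℝ H1)).1 hu.2, fun n ξ => ?_⟩
  rw [← hf.fderiv_apply hχ hV]
  exact (fderiv ℝ (functionalJ χ V f) (u n)).le_opNorm ξ

/-- A sequence that is small in the supremum norm has a vanishing nonlinear term. -/
theorem Admissible.integral_comp_mul_le (hf : Admissible θ μ f) {u : H1} {n : ℕ}
    (hn : 2 * ‖u‖ ≤ n) {κ : ℝ} (hκ : ∀ x, |u.rep x| ≤ κ) :
    ∫ x, f x (u.rep x) * u.rep x ≤ μ n * κ * ‖u‖ ^ 2 := by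
  have hμ := hf.mu_nonneg n
  have hκ0 : 0 ≤ κ := (abs_nonneg _).trans (hκ 0)
  have h1 : ∫ x, f x (u.rep x) * u.rep x ≤ ∫ x, μ n * κ * u.rep x ^ 2 := by
    refine integral_mono_ae (hf.integrable_comp_mul u u) (u.integrable_rep_sq.const_mul _) ?_
    filter_upwards [hf.nl] with x hx
    have h2 := hx.abs_le hμ ((u.abs_rep_le x).trans hn)
    have h3 := mul_le_mul h2 (hκ x) (abs_nonneg _) (by positivity)
    rw [← abs_mul] at h3
    linarith [le_abs_self (f x (u.rep x) * u.rep x)]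
  rw [integral_const_mul] at h1
  exact h1.trans (mul_le_mul_of_nonneg_left u.integral_rep_sq_le (by positivity))

/-- Bounded almost critical sequences at a positive level do not vanish in the supremum norm. -/
theorem Admissible.exists_lower_bound (hf : Admissible θ μ f) (hχ : χ = 1 ∨ χ = -1)
    {u : ℕ → H1} {R : ℝ} (hR : ∀ n, ‖u n‖ ≤ R) {ε : ℕ → ℝ}
    (hε : Tendsto ε atTop (𝓝 0)) (hdJ : ∀ n ξ, |dJ χ V f (u n) ξ| ≤ ε n * ‖ξ‖) {c : ℝ}
    (hc : 0 < c) (hJ : Tendsto (fun n => functionalJ χ V f (u n)) atTop (𝓝 c)) :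
    ∃ κ > 0, ∀ᶠ n in atTop, ∃ x, κ ≤ |(u n).rep x| := by
  have hR0 : 0 ≤ R := (norm_nonneg _).trans (hR 0)
  obtain ⟨N, hN⟩ := exists_nat_ge (2 * R)
  have hμ := hf.mu_nonneg N
  -- If `|u_n|` stays below this value, then `∫ f u ≤ c`. Since `F ≥ 0`, `J ≤ dJ(u, u)/2 + (∫ f u)/2
  -- < c/4 + c/2`, which is below the level.
  refine ⟨c / (μ N * R ^ 2 + 1), by positivity, ?_⟩
  have h1 : Tendsto (fun n => |ε n| * R) atTop (𝓝 0) := by simpa using hε.abs.mul_const R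
  filter_upwards [hJ.eventually_const_lt (show 3 / 4 * c < c by linarith),
    h1.eventually_lt_const (show (0 : ℝ) < c / 2 by positivity)] with n h2 h3
  by_contra! hcon
  have h4 := hf.integral_comp_mul_le (u := u n) (by linarith [hR n]) fun x => (hcon x).le
  have h5 : functionalJ χ V f (u n) ≤
      dJ χ V f (u n) (u n) / 2 + (∫ x, f x ((u n).rep x) * (u n).rep x) / 2 := by
    have h6 : 0 ≤ ∫ x, primitive f x ((u n).rep x) := integral_nonneg_of_ae (by
      filter_upwards [hf.nl] with x hx
      exact hx.primitive_nonneg hf.theta_pos _)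
    rw [functionalJ_eq hχ, dJ]
    linarith
  have h6 : dJ χ V f (u n) (u n) ≤ |ε n| * R := (le_abs_self _).trans ((hdJ n _).trans
    (mul_le_mul (le_abs_self _) (hR n) (norm_nonneg _) (abs_nonneg _)))
  have h7 : μ N * (c / (μ N * R ^ 2 + 1)) * ‖u n‖ ^ 2 ≤ c * (μ N * R ^ 2 / (μ N * R ^ 2 + 1)) := by
    have h8 : ‖u n‖ ^ 2 ≤ R ^ 2 := pow_le_pow_left₀ (norm_nonneg _) (hR n) 2
    calc μ N * (c / (μ N * R ^ 2 + 1)) * ‖u n‖ ^ 2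
        ≤ μ N * (c / (μ N * R ^ 2 + 1)) * R ^ 2 := mul_le_mul_of_nonneg_left h8 (by positivity)
      _ = _ := by ring
  have h8 : c * (μ N * R ^ 2 / (μ N * R ^ 2 + 1)) ≤ c * 1 :=
    mul_le_mul_of_nonneg_left ((div_le_one (by positivity)).2 (by linarith)) hc.le
  linarith

/-- Points at which a weakly null sequence stays away from zero escape to infinity. -/
theorem WeaklyTendsto.tendsto_abs_atTop {u : ℕ → H1} (hu : WeaklyTendsto u 0) {κ : ℝ} (hκ : 0 < κ)
    {x : ℕ → ℝ} (hx : ∀ᶠ n in atTop, κ ≤ |(u n).rep (x n)|) :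
    Tendsto (fun n => |x n|) atTop atTop := by
  obtain ⟨R, hR⟩ := hu.exists_norm_le
  rw [tendsto_atTop]
  intro B
  by_contra hcon
  have hfr : ∃ᶠ n in atTop, x n ∈ Icc (-B) B := by
    refine (not_eventually.1 hcon).mono fun n hn => ?_
    rw [mem_Icc, ← abs_le]
    exact (not_le.1 hn).le
  -- At a limit point `y` of bounded `x_n`, the uniform Hölder bound transfers the lower bound to
  -- `u_n(y)`, which tends to zero.
  obtain ⟨y, -, φ, hφ, hy⟩ := isCompact_Icc.tendsto_subseq' hfr
  have h1 : Tendsto (fun n => (u (φ n)).rep y) atTop (𝓝 0) := by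
    have := (hu.tendsto_rep y).comp hφ.tendsto_atTop
    rwa [H1.rep_zero] at this
  have h2 : Tendsto (fun n => Real.sqrt (|x (φ n) - y| * R ^ 2)) atTop (𝓝 0) := by
    have := (((hy.sub_const y).abs).mul_const (R ^ 2)).sqrt
    simpa using this
  have h3 : Tendsto (fun n => (u (φ n)).rep (x (φ n)) - (u (φ n)).rep y) atTop (𝓝 0) := by
    refine squeeze_zero_norm (fun n => ?_) h2
    refine Real.abs_le_sqrt (((u (φ n)).abs_rep_sub_rep_le y (x (φ n))).trans ?_)
    exact mul_le_mul_of_nonneg_left (pow_le_pow_left₀ (norm_nonneg _) (hR _) 2) (abs_nonneg _)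
  have h4 := (h3.add h1).abs
  simp only [sub_add_cancel, add_zero, abs_zero] at h4
  exact absurd (ge_of_tendsto h4 (hφ.tendsto_atTop.eventually hx)) (not_le.2 hκ)

end StepanovNLS

end

/-! ### The two alternatives for the weak limit. -/

theorem lemma5p1 (χ : ℝ) (V : ℝ → ℝ) (f : ℝ → ℝ → ℝ) (hyp : StandingAssumptions χ V f)
    (c : ℝ) (hc : c ∈ Set.Ico (nehariLevel χ V f) (2 * nehariLevel χ V f))
    (u : ℕ → H1) (hu : IsPalaisSmale (functionalJ χ V f) c u)
    (u₀ : H1) (hu₀ : WeaklyTendsto u u₀) :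
    (u₀ ≠ 0 →
      Tendsto u atTop (𝓝 u₀) ∧ IsCriticalPoint (functionalJ χ V f) u₀ ∧
        functionalJ χ V f u₀ = c) ∧
    (u₀ = 0 →
      ∃ x : ℕ → ℝ, Tendsto (fun n => |x n|) atTop atTop ∧
      ∃ (V' : ℝ → ℝ) (f' : ℝ → ℝ → ℝ), InEnvelope V f V' f' ∧
      ∃ v : H1, v ≠ 0 ∧ IsCriticalPoint (functionalJ χ V' f') v ∧ functionalJ χ V' f' v = c ∧
      ∃ φ : ℕ → ℕ, StrictMono φ ∧
        Tendsto (fun k => shift (x (φ k)) (u (φ k))) atTop (𝓝 v) ∧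
        Tendsto (fun k => u (φ k) - shift (-x (φ k)) v) atTop (𝓝 0)) := by

  obtain ⟨θ, μ, hf⟩ := hyp.exists_admissible
  have hχ := hyp.sign
  have hV := hyp.potential.1
  obtain ⟨P, α, hE⟩ := exists_formDichotomy hχ hV hyp.zero_notMem_spectrum
  -- Positivity of `m` need not be proved separately: `[m, 2m)` is nonempty.
  have hm : 0 < nehariLevel χ V f := by linarith [hc.1, hc.2]
  obtain ⟨ε, hε, hdJ⟩ := hu.exists_dJ_bound hf hχ hV
  refine ⟨fun h0 => ?_, fun h0 => ?_⟩
  · refine (shiftLimit_zero hV hf).tendsto_of_weaklyTendsto hf hχ hV hE hm hu₀ h0 hε ?_ hc.2 ?_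
    · simpa only [add_zero] using hdJ
    · simpa only [add_zero] using hu.1
  subst h0
  obtain ⟨R, hR⟩ := hu₀.exists_norm_le
  obtain ⟨κ, hκ, hlow⟩ := hf.exists_lower_bound hχ hR hε hdJ (hm.trans_le hc.1) hu.1
  obtain ⟨x, hx⟩ : ∃ x : ℕ → ℝ, ∀ᶠ n in atTop, κ ≤ |(u n).rep (x n)| := by
    -- The lower bound holds only eventually; the default point `0` fills in the remaining indices.
    have : ∀ n, ∃ y, (∃ x, κ ≤ |(u n).rep x|) → κ ≤ |(u n).rep y| := fun n => by
      by_cases h : ∃ x, κ ≤ |(u n).rep x|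
      · exact ⟨h.choose, fun _ => h.choose_spec⟩
      · exact ⟨0, fun h' => absurd h' h⟩
    choose x hx using this
    exact ⟨x, hlow.mono fun n hn => hx n hn⟩
  obtain ⟨φ, hφ, v, hv⟩ := exists_subseq_weaklyTendsto (u := fun n => shift (x n) (u n)) (R := R)
    fun n => (norm_shift _ _).trans_le (hR n)
  obtain ⟨ψ, hψ, V', f', henv, hL⟩ := hyp.exists_shiftLimit hf (x ∘ φ)
  have hφψ : StrictMono (φ ∘ ψ) := hφ.comp hψ
  have hv' : WeaklyTendsto (fun k => shift (x (φ (ψ k))) (u (φ (ψ k)))) v := fun ℓ =>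
    (hv ℓ).comp hψ.tendsto_atTop
  -- Weak convergence implies convergence at the point `0`, where the translated functions take the
  -- values `u_n(x_n)`.
  have hv0 : v ≠ 0 := by
    rintro rfl
    have h1 := (hv'.tendsto_rep 0).abs
    simp only [rep_shift, zero_add, H1.rep_zero, abs_zero] at h1
    exact absurd (ge_of_tendsto h1 (hφψ.tendsto_atTop.eventually hx)) (not_le.2 hκ)
  obtain ⟨h1, h2, h3⟩ := hL.tendsto_of_weaklyTendsto hf hχ hV hE hm hv' hv0
    (hε.comp hφψ.tendsto_atTop) (fun k ξ => by
      have h1 := hdJ (φ (ψ k)) (shift (-x (φ (ψ k))) ξ)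
      rw [norm_shift, ← dJ_shift χ V f (x (φ (ψ k))), shift_shift_neg] at h1
      exact h1) hc.2 (by
      refine (hu.1.comp hφψ.tendsto_atTop).congr fun k => ?_
      exact (functionalJ_shift hχ V f (x (φ (ψ k))) (u (φ (ψ k)))).symm)
  refine ⟨x, hu₀.tendsto_abs_atTop hκ hx, V', f', henv, v, hv0, h2, h3, φ ∘ ψ, hφψ, h1, ?_⟩
  rw [tendsto_iff_norm_sub_tendsto_zero] at h1
  rw [tendsto_zero_iff_norm_tendsto_zero]
  refine h1.congr fun k => ?_
  -- Shifts are isometries, so the second convergence is the first one translated back.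
  rw [← norm_shift (-x (φ (ψ k))), shift_sub, shift_neg_shift]
  rfl
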